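/- **Setting.** Let $M$ be a closed connected smooth $n$-manifold, $g$ a Riemannian metric on $M$, $\lambda=p\,dq$ and $\omega=d\lambda$ on $T^*M$, $Y=p\,\partial_p$ (so $i_Y\omega=\lambda$) with flow $\phi^Y_t(q,p)=(q,e^tp)$, $X_F$ the vector field with $i_{X_F}\omega=-dF$, and $\Lambda T^*M=C^\infty(S^1,T^*M)$, $S^1=\mathbb R/\mathbb Z$. A *fibrewise starshaped hypersurface* is a closed connected hypersurface $\Sigma\subset T^*M$ bounding a compact region $D(\Sigma)$ such that $Y$ is transverse to $\Sigma$ and points out of $D(\Sigma)$; $D^\circ(\Sigma)$ is the interior of $D(\Sigma)$, $\xi_\Sigma=\ker\lambda\cap T\Sigma$, and $R_\Sigma$ is the Reeb vector field of $\lambda|_\Sigma$. * $\mathcal D(\Sigma)$: the $F\in C^\infty(T^*M)$ with $F^{-1}(0)=\Sigma$, $X_F$ compactly supported and $X_F|_\Sigma=R_\Sigma$; $\mathcal D=\bigcup_\Sigma\mathcal D(\Sigma)$. * $\mathcal F$: the strictly increasing smooth $f:\mathbb R\to(0,\infty)$ with $\lim_{-\infty}f=0$ and $0<f'\le 1$.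 For $a,r>0$, $\mathcal F(a,r)$ is the set of $f\in\mathcal F$ with $f(\eta)=\eta$ for $\eta\ge a$ and $Af'(-A)>r$ for some $A>0$. * $\mathcal X$: the smooth $\chi:S^1\to[0,\infty)$ for which there is $t_0=t_0(\chi)\in(0,1]$ such that $t\mapsto\int_0^t\chi$ is strictly increasing on $[0,t_0]$ and equal to $1$ on $[t_0,1]$; $\mathcal X_0=\{\chi\in\mathcal X: t_0(\chi)<1/2\}$. * $\mathcal H$: the $H\in C_c^\infty(S^1\times T^*M)$ with $H(t,\cdot)=0$ for $t\in[0,1/2]$; $\kappa(H)=\sup_{x\in\Lambda T^*M}\bigl|\int_0^1(\lambda(X_H(t,x))-H(t,x))\,dt\bigr|$ and $\mathcal H(c)=\{H\in\mathcal H:\kappa(H)\le c\}$. * $\mathfrak F_0$: the quadruples $\mathfrak f=(F,f,\chi,H)\in\mathcal D\times\mathcal F\times\mathcal X\times\mathcal H$ with $H=0$ or $\chi\in\mathcal X_0$. Put $$A_{\mathfrak f}(x,\eta)=\int x^*\lambda-f(\eta)\int_0^1\chi(t)F(x)\,dt-\int_0^1H(t,x)\,dt,\qquad (x,\eta)\in\Lambda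 T^*M\times\mathbb R .$$ $\mathfrak f\in\mathfrak F_0$ is *regular* if $H=0$ and $A_{\mathfrak f}$ is Morse–Bott with $\mathrm{Crit}(A_{\mathfrak f})$ a discrete union of circles, or $\chi\in\mathcal X_0$ and $A_{\mathfrak f}$ is Morse. * For $\alpha\in[S^1,M]$: $\mathrm{Crit}(A_{\mathfrak f},\alpha)$ is the set of critical points $(x,\eta)$ with $[\pi\circ x]=\alpha$, $\mathcal A(A_{\mathfrak f},\alpha)=A_{\mathfrak f}(\mathrm{Crit}(A_{\mathfrak f},\alpha))$, and $\mathrm{Crit}^{(a,b)}(A_{\mathfrak f},\alpha)$ is the subset with action in $(a,b)$, with the $C^\infty$-topology. * $\mathcal J$: the smooth families $J=(J_t)_{t\in S^1}$ of almost complex structures on $T^*M$ such that each $\omega(J_t\cdot,\cdot)$ is a Riemannian metric. $\mathcal J(S)$, for a fibrewise starshaped $S$: those $J\in\mathcal J$ that are independent of $t$ on $T^*M\setminus D^\circ(S)$ and satisfy $J(\xi_S)=\xi_S$, $\omega(JY,Y)=1$ and $d\phi^Y_t\circ J=J\circ d\phi^Y_t$ ($t\ge0$) at all points of $S$. * $\mathcal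 M^{(a,b)}(\nabla_JA_{\mathfrak f},\alpha)$: the smooth $u=(x,\eta):\mathbb R\to\Lambda T^*M\times\mathbb R$ with $\partial_sx+J_t(x)(\partial_tx-f(\eta)\chi X_F(x)-X_H(t,x))=0$, $\partial_s\eta-f'(\eta)\int_0^1\chi F(x)\,dt=0$, $a<A_{\mathfrak f}(u(s))<b$ and $[\pi\circ x(s,\cdot)]=\alpha$ for all $s$. * $\mathcal F(F,a,b)=\mathcal F\bigl(\tfrac a6,\tfrac{b-a}{\rho_1}\bigr)$, $\rho_1=\min\{\rho,\tfrac a{4T}\}$, with the following constants $\rho=\rho(F)$, $T=T(F)$: choose $k>0$ with $\tfrac12+k\le\lambda(X_F)\le\tfrac32-k$ on $U_k=F^{-1}(-k,k)$ and put $T=\|\lambda|_{U_k}\|_\infty$, $\rho=\min\bigl\{\tfrac k2,\tfrac k{2\|dF\|_\infty}\bigr\}$, the norms being those of the metrics $\omega(J'_t\cdot,\cdot)$ of some auxiliary $J'\in\mathcal J$. (The theorem holds for every choice of $k$ and $J'$.) For $J\in\mathcal J$ and $0<a<b<\infty$ and regular $\mathfrak f$, the quadruple $(\mathfrak f,a,b,J)$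 is called *$\alpha$-admissible* if 1. $\mathcal A(A_{\mathfrak f},\alpha)\cap\{a,b\}=\emptyset$; 2. $\mathrm{Crit}^{(a,b)}(A_{\mathfrak f},\alpha)$ is compact; 3. there are $C_{\rm loop},C_{\rm mult}>0$ such that $\|x\|_{L^\infty}<C_{\rm loop}$ (in the fibre norm of $g$) and $\|\eta\|_{L^\infty}<C_{\rm mult}$ for all $(x,\eta)\in\mathcal M^{(a,b)}(\nabla_JA_{\mathfrak f},\alpha)$. **Theorem.** Fix $\alpha\in[S^1,M]$. Let $\mathfrak f=(F,f,\chi,H)\in\mathfrak F_0$ be regular with $F\in\mathcal D(\Sigma)$, and let $0<a<b<\infty$ with $a,b\notin\mathcal A(A_{\mathfrak f},\alpha)$. Suppose that $f\in\mathcal F(F,a,b)$ and $H\in\mathcal H(a/2)$. Let $S$ be a fibrewise starshaped hypersurface with $D(\Sigma)\subseteq D^\circ(S)$ and $\mathrm{supp}(X_F)\subseteq D^\circ(S)$, and let $J\in\mathcal J(S)$. Then $(\mathfrak f,a,b,J)$ is $\alpha$-admissible. -/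

import Mathlib

open scoped Manifold ContDiff Topology
open Bundle

noncomputable section

namespace RFH

/-! ## The cotangent bundle and its canonical structures -/

/-- The cotangent bundle `T*M`; a point is a pair `⟨q, p⟩` with `p` a linear form on `T_q M`. -/
abbrev Cot (n : ℕ) (M : Type*) [TopologicalSpace M] [ChartedSpace (EuclideanSpace ℝ (Fin n)) M]
    [IsManifold (𝓡 n) ∞ M] : Type _ :=
  TotalSpace (EuclideanSpace ℝ (Fin n) →L[ℝ] ℝ)
    (fun q : M => TangentSpace (𝓡 n) q →L[ℝ] Trivial M ℝ q)

/-- The model space of `T*M`. -/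
abbrev CotVec (n : ℕ) : Type :=
  EuclideanSpace ℝ (Fin n) × (EuclideanSpace ℝ (Fin n) →L[ℝ] ℝ)

/-- The model with corners of `T*M`. -/
abbrev cotI (n : ℕ) :
    ModelWithCorners ℝ (CotVec n)
      (ModelProd (EuclideanSpace ℝ (Fin n)) (EuclideanSpace ℝ (Fin n) →L[ℝ] ℝ)) :=
  (𝓡 n).prod 𝓘(ℝ, EuclideanSpace ℝ (Fin n) →L[ℝ] ℝ)

section Curves

variable {E H : Type*} [NormedAddCommGroup E] [NormedSpace ℝ E] [TopologicalSpace H]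
  (I : ModelWithCorners ℝ E H) {N : Type*} [TopologicalSpace N] [ChartedSpace H N]

/-- The velocity `γ'(t)` of a curve. -/
def vel (γ : ℝ → N) (t : ℝ) : TangentSpace I (γ t) :=
  mfderiv 𝓘(ℝ, ℝ) I γ t (1 : ℝ)

/-- The velocity as a point `(γ(t), γ'(t))` of the tangent bundle. -/
def velT (γ : ℝ → N) (t : ℝ) : TangentBundle I N := ⟨γ t, vel I γ t⟩

variable (N) in
/-- The free loop space `C^∞(S¹, N)`; a loop is a smooth `1`-periodic map `ℝ → N`. -/
structure SmoothLoop where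
  toFun : ℝ → N
  smooth : ContMDiff 𝓘(ℝ, ℝ) I ∞ toFun
  periodic : Function.Periodic toFun 1

instance : CoeFun (SmoothLoop I N) (fun _ => ℝ → N) := ⟨SmoothLoop.toFun⟩

/-- The `C^∞`-topology on the loop space: the coarsest topology for which all derivatives of
`φ ∘ x`, where `φ` is a smooth function on `N`, depend continuously on the loop `x` with respect
to uniform convergence.  (Taking for `φ` the coordinates of a closed embedding in a Euclidean
space one sees that this is the usual topology.) -/
instance : TopologicalSpace (SmoothLoop I N) :=
  ⨅ (φ : C^∞⟮I, N; 𝓘(ℝ, ℝ), ℝ⟯) (k : ℕ),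
    TopologicalSpace.induced
      (fun x : SmoothLoop I N => UniformFun.ofFun (iteratedDeriv k (fun t : ℝ => φ (x t))))
      (UniformFun.topologicalSpace ℝ ℝ)

end Curves

/-- Free homotopy of continuous maps `S¹ → M`. -/
def freeHomotopySetoid (M : Type*) [TopologicalSpace M] : Setoid C(UnitAddCircle, M) :=
  ⟨ContinuousMap.Homotopic, ContinuousMap.Homotopic.equivalence⟩

/-- The set `[S¹, M]` of free homotopy classes. -/
def FreeHomotopyClass (M : Type*) [TopologicalSpace M] : Type _ :=
  Quotient (freeHomotopySetoid M)

section Cotangent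

variable {n : ℕ} {M : Type*} [TopologicalSpace M] [ChartedSpace (EuclideanSpace ℝ (Fin n)) M]
  [IsManifold (𝓡 n) ∞ M]

/-- The Liouville form `λ = p dq`. -/
def liouville (z : Cot n M) (v : TangentSpace (cotI n) z) : ℝ :=
  z.2 (mfderiv (cotI n) (𝓡 n) (fun y : Cot n M => y.1) z v)

/-- The pull-back of the Liouville form by the inverse of the chart of `T*M` around `z₀`. -/
def liouvilleInChart (z₀ : Cot n M) (y v : CotVec n) : ℝ :=
  liouville ((extChartAt (cotI n) z₀).symm y)
    (mfderiv 𝓘(ℝ, CotVec n) (cotI n) (extChartAt (cotI n) z₀).symm y v)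

/-- The symplectic form `ω = dλ`: the exterior derivative
`dλ(v, w) = ∂_v (λ(w)) - ∂_w (λ(v))`, computed in the chart around `z`. -/
def omega (z : Cot n M) (v w : TangentSpace (cotI n) z) : ℝ :=
  let φ := extChartAt (cotI n) z
  let v' : CotVec n := mfderiv (cotI n) 𝓘(ℝ, CotVec n) φ z v
  let w' : CotVec n := mfderiv (cotI n) 𝓘(ℝ, CotVec n) φ z w
  fderiv ℝ (fun y => liouvilleInChart z y w') (φ z) v'
    - fderiv ℝ (fun y => liouvilleInChart z y v') (φ z) w'

/-- The differential `dF_z(v)`. -/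
def dfun (F : Cot n M → ℝ) (z : Cot n M) (v : TangentSpace (cotI n) z) : ℝ :=
  mfderiv (cotI n) 𝓘(ℝ, ℝ) F z v

/-- The symplectic gradient `X_F`, the unique vector field with `ω(X_F, ·) = -dF`
(it exists and is unique as `ω` is non-degenerate). -/
def hamVF (F : Cot n M → ℝ) (z : Cot n M) : TangentSpace (cotI n) z :=
  Classical.epsilon fun v => ∀ w, omega z v w = - dfun F z w

/-- The map `(q, p) ↦ (q, c p)`. -/
def fibreScale (c : ℝ) (z : Cot n M) : Cot n M := ⟨z.1, c • z.2⟩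

/-- The Liouville vector field `Y = p ∂_p`. -/
def liouvilleVF (z : Cot n M) : TangentSpace (cotI n) z :=
  mfderiv 𝓘(ℝ, ℝ) (cotI n) (fun c : ℝ => fibreScale c z) (1 : ℝ) (1 : ℝ)

/-- The flow `φ_t(q, p) = (q, e^t p)` of `Y`. -/
def liouvilleFlow (t : ℝ) (z : Cot n M) : Cot n M := fibreScale (Real.exp t) z

/-- The norm `|p|_g = max {p(v) : g(v, v) ≤ 1}` of a covector. -/
def covectorNorm
    (g : ContMDiffRiemannianMetric (𝓡 n) ∞ (EuclideanSpace ℝ (Fin n))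
      (fun q : M => TangentSpace (𝓡 n) q))
    (z : Cot n M) : ℝ :=
  sSup {r : ℝ | ∃ v : TangentSpace (𝓡 n) z.1, g.inner z.1 v v ≤ 1 ∧ r = z.2 v}

/-! ## Fibrewise starshaped hypersurfaces and defining Hamiltonians -/

/-- The region `D(Σ)` bounded by `Σ`: the union of `Σ` and the relatively compact components
of its complement. -/
def region (S : Set (Cot n M)) : Set (Cot n M) :=
  S ∪ {z | z ∉ S ∧ IsCompact (closure (connectedComponentIn Sᶜ z))}

/-- A fibrewise starshaped hypersurface: a closed connected hypersurface that bounds the compact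
region `D(Σ)` and to which `Y` is transverse, pointing out of `D(Σ)`.  Here `h` is a local
defining function of `Σ` that is negative in the interior of `D(Σ)` and positive outside. -/
structure IsStarshaped (S : Set (Cot n M)) : Prop where
  isCompact : IsCompact S
  isConnected : IsConnected S
  isCompact_region : IsCompact (region S)
  outward : ∀ z ∈ S, ∃ U : Set (Cot n M), IsOpen U ∧ z ∈ U ∧ ∃ h : Cot n M → ℝ,
    ContMDiffOn (cotI n) 𝓘(ℝ, ℝ) ∞ h U ∧
    (∀ y ∈ U, y ∈ S ↔ h y = 0) ∧
    (∀ y ∈ U, y ∈ region S ↔ h y ≤ 0) ∧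
    0 < dfun h z (liouvilleVF z)

/-- The tangent space `T_z Σ` of a closed submanifold: the vectors annihilated by the
differentials of all smooth functions that vanish on `Σ`. -/
def tangentTo (S : Set (Cot n M)) (z : Cot n M) : Set (TangentSpace (cotI n) z) :=
  {v | ∀ h : Cot n M → ℝ, ContMDiff (cotI n) 𝓘(ℝ, ℝ) ∞ h → (∀ y ∈ S, h y = 0) → dfun h z v = 0}

/-- `R` is the value at `z ∈ Σ` of the Reeb vector field of the contact form `λ|_Σ`. -/
def IsReeb (S : Set (Cot n M)) (z : Cot n M) (R : TangentSpace (cotI n) z) : Prop :=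
  R ∈ tangentTo S z ∧ liouville z R = 1 ∧ ∀ w ∈ tangentTo S z, omega z R w = 0

/-- The contact hyperplane `ξ_Σ = ker λ ∩ TΣ` at `z`. -/
def contactPlane (S : Set (Cot n M)) (z : Cot n M) : Set (TangentSpace (cotI n) z) :=
  {v | v ∈ tangentTo S z ∧ liouville z v = 0}

/-- The support of the Hamiltonian vector field `X_F`. -/
def suppVF (F : Cot n M → ℝ) : Set (Cot n M) := closure {z | hamVF F z ≠ 0}

/-- `F ∈ 𝓓(Σ)`: `F` is a defining Hamiltonian for `Σ`. -/
structure IsDefining (S : Set (Cot n M)) (F : Cot n M → ℝ) : Prop where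
  smooth : ContMDiff (cotI n) 𝓘(ℝ, ℝ) ∞ F
  zeroSet : F ⁻¹' {0} = S
  compact : IsCompact (suppVF F)
  reeb : ∀ z ∈ S, IsReeb S z (hamVF F z)

/-! ## The functions `f`, `χ` and `H` -/

/-- The class `𝓕`. -/
structure IsF (f : ℝ → ℝ) : Prop where
  smooth : ContDiff ℝ ∞ f
  pos : ∀ η, 0 < f η
  strictMono : StrictMono f
  limit : Filter.Tendsto f Filter.atBot (𝓝 0)
  deriv_pos : ∀ η, 0 < deriv f η
  deriv_le : ∀ η, deriv f η ≤ 1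

/-- The class `𝓕(a, r)`: functions in `𝓕` that are the identity on `[a, ∞)` and satisfy
`A f'(-A) > r` for some `A > 0`. -/
structure IsFar (a r : ℝ) (f : ℝ → ℝ) : Prop extends IsF f where
  eq_id : ∀ η, a ≤ η → f η = η
  exists_A : ∃ A : ℝ, 0 < A ∧ r < A * deriv f (-A)

/-- `χ ∈ 𝓧` with `t₀(χ) = t₀`: a smooth `1`-periodic function `χ ≥ 0` such that
`t ↦ ∫₀ᵗ χ` is strictly increasing on `[0, t₀]` and equal to `1` on `[t₀, 1]`. -/
structure IsChi (χ : ℝ → ℝ) (t₀ : ℝ) : Prop where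
  smooth : ContDiff ℝ ∞ χ
  periodic : Function.Periodic χ 1
  nonneg : ∀ t, 0 ≤ χ t
  pos_t₀ : 0 < t₀
  t₀_le : t₀ ≤ 1
  eq_one : ∀ t ∈ Set.Icc t₀ 1, ∫ τ in (0 : ℝ)..t, χ τ = 1
  strictMono : StrictMonoOn (fun t => ∫ τ in (0 : ℝ)..t, χ τ) (Set.Icc 0 t₀)

/-- `χ ∈ 𝓧₀`, that is, `t₀(χ) < 1/2`. -/
def IsChi₀ (χ : ℝ → ℝ) : Prop := ∃ t₀ : ℝ, IsChi χ t₀ ∧ t₀ < 1 / 2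

/-- The class `𝓗` of compactly supported Hamiltonians on `S¹ × T*M` that vanish for
`t ∈ [0, 1/2]`. -/
structure IsH (H : ℝ → Cot n M → ℝ) : Prop where
  smooth : ContMDiff (𝓘(ℝ, ℝ).prod (cotI n)) 𝓘(ℝ, ℝ) ∞ (fun p : ℝ × Cot n M => H p.1 p.2)
  periodic : Function.Periodic H 1
  compact : ∃ K : Set (Cot n M), IsCompact K ∧ ∀ t, ∀ z ∉ K, H t z = 0
  zero : ∀ t ∈ Set.Icc (0 : ℝ) (1 / 2), ∀ z, H t z = 0

/-- The semi-norm `κ(H) = sup_x |∫₀¹ (λ(X_H(t, x)) - H(t, x)) dt|` over all loops `x` in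
`T*M`, as an extended non-negative number. -/
def kappa (H : ℝ → Cot n M → ℝ) : ENNReal :=
  ⨆ x : SmoothLoop (cotI n) (Cot n M),
    ENNReal.ofReal |∫ t in (0 : ℝ)..1, (liouville (x t) (hamVF (H t) (x t)) - H t (x t))|

/-! ## The perturbed Rabinowitz action functional -/

variable (n M) in
/-- A quadruple `𝔣 = (F, f, χ, H)`. -/
structure Data where
  F : Cot n M → ℝ
  f : ℝ → ℝ
  χ : ℝ → ℝ
  H : ℝ → Cot n M → ℝ

/-- `𝔣 ∈ 𝔉₀`: `F ∈ 𝓓`, `f ∈ 𝓕`, `χ ∈ 𝓧`, `H ∈ 𝓗`, and `H = 0` or `χ ∈ 𝓧₀`. -/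
structure IsData₀ (𝔣 : Data n M) : Prop where
  F_mem : ∃ S : Set (Cot n M), IsStarshaped S ∧ IsDefining S 𝔣.F
  f_mem : IsF 𝔣.f
  χ_mem : ∃ t₀, IsChi 𝔣.χ t₀
  H_mem : IsH 𝔣.H
  split : 𝔣.H = 0 ∨ IsChi₀ 𝔣.χ

/-- The perturbed Rabinowitz action functional
`A_𝔣(x, η) = ∫ x^*λ - f(η) ∫₀¹ χ(t) F(x) dt - ∫₀¹ H(t, x) dt`. -/
def action (𝔣 : Data n M) (x : ℝ → Cot n M) (η : ℝ) : ℝ :=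
  (∫ t in (0 : ℝ)..1, liouville (x t) (vel (cotI n) x t))
    - 𝔣.f η * (∫ t in (0 : ℝ)..1, 𝔣.χ t * 𝔣.F (x t))
    - ∫ t in (0 : ℝ)..1, 𝔣.H t (x t)

/-- `Crit(A_𝔣)`: the pairs `(x, η)` at which the first variation of `A_𝔣` along every smooth
path `(X_s, e_s)` in `ΛT*M × ℝ` through `(x, η)` vanishes. -/
def Crit (𝔣 : Data n M) : Set (SmoothLoop (cotI n) (Cot n M) × ℝ) :=
  {v | ∀ (X : ℝ → ℝ → Cot n M) (e : ℝ → ℝ),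
    ContMDiff 𝓘(ℝ, ℝ × ℝ) (cotI n) ∞ (fun p : ℝ × ℝ => X p.1 p.2) →
    (∀ s, Function.Periodic (X s) 1) → ContDiff ℝ ∞ e →
    (∀ t, X 0 t = v.1 t) → e 0 = v.2 →
    HasDerivAt (fun s => action 𝔣 (X s) (e s)) 0 0}

/-- The class `[π ∘ x] ∈ [S¹, M]` of a loop in `T*M`. -/
def loopClass (x : SmoothLoop (cotI n) (Cot n M)) : FreeHomotopyClass M :=
  Quotient.mk (freeHomotopySetoid M)
    { toFun := Function.Periodic.lift (f := fun t => (x t).1) (c := 1)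
        (fun t => congrArg TotalSpace.proj (x.periodic t))
      continuous_toFun := by
        refine continuous_coinduced_dom.mpr ?_
        exact (FiberBundle.continuous_proj _ _).comp x.smooth.continuous }

/-- `Crit(A_𝔣, α)`. -/
def CritIn (𝔣 : Data n M) (α : FreeHomotopyClass M) :
    Set (SmoothLoop (cotI n) (Cot n M) × ℝ) :=
  {v | v ∈ Crit 𝔣 ∧ loopClass v.1 = α}

/-- `Crit^{(a,b)}(A_𝔣, α)`. -/
def CritWindow (𝔣 : Data n M) (α : FreeHomotopyClass M) (a b : ℝ) :
    Set (SmoothLoop (cotI n) (Cot n M) × ℝ) :=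
  {v | v ∈ CritIn 𝔣 α ∧ action 𝔣 v.1 v.2 ∈ Set.Ioo a b}

/-- The action spectrum `𝓐(A_𝔣, α) = A_𝔣(Crit(A_𝔣, α))`. -/
def actionSpectrum (𝔣 : Data n M) (α : FreeHomotopyClass M) : Set ℝ :=
  (fun v : SmoothLoop (cotI n) (Cot n M) × ℝ => action 𝔣 v.1 v.2) '' CritIn 𝔣 α

/-! ## Regularity -/

/-- The tangent vector `(ξ, b)` of `ΛT*M × ℝ` at the critical point `(x, η)` lies in the kernel of
the Hessian of `A_𝔣`: for every smooth two-parameter family `(X_{s,r}, e_{s,r})` in `ΛT*M × ℝ`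
through `(x, η)` with `s`-velocity `(ξ, b)` at `(0, 0)` one has `∂_s ∂_r A_𝔣 = 0` at `(0, 0)`.
A tangent vector of the loop space at `x` is a loop `ξ` in the tangent bundle that lies over `x`
(so that `x` is determined by `ξ`). -/
def InHessianKernel (𝔣 : Data n M) (η : ℝ)
    (ξ : SmoothLoop (cotI n).tangent (TangentBundle (cotI n) (Cot n M))) (b : ℝ) : Prop :=
  ∀ (X : ℝ → ℝ → ℝ → Cot n M) (e : ℝ → ℝ → ℝ),
    ContMDiff 𝓘(ℝ, ℝ × ℝ × ℝ) (cotI n) ∞ (fun p : ℝ × ℝ × ℝ => X p.1 p.2.1 p.2.2) →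
    (∀ s r, Function.Periodic (X s r) 1) →
    ContDiff ℝ ∞ (fun p : ℝ × ℝ => e p.1 p.2) →
    e 0 0 = η →
    (∀ t, velT (cotI n) (fun s => X s 0 t) 0 = ξ t) →
    deriv (fun s => e s 0) 0 = b →
    deriv (fun s => deriv (fun r => action 𝔣 (X s r) (e s r)) 0) 0 = 0

/-- `A_𝔣` is a Morse function: the Hessian at every critical point is non-degenerate. -/
def IsMorse (𝔣 : Data n M) : Prop :=
  ∀ v ∈ Crit 𝔣, ∀ (ξ : SmoothLoop (cotI n).tangent (TangentBundle (cotI n) (Cot n M))) (b : ℝ),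
    (∀ t, (ξ t).1 = v.1 t) → InHessianKernel 𝔣 v.2 ξ b → (∀ t, (ξ t).2 = 0) ∧ b = 0

/-- `θ ↦ (γ_θ, e_θ)` is a smoothly embedded circle in `ΛT*M × ℝ` that consists of critical points
of `A_𝔣`, is open in `Crit(A_𝔣)`, and along which the kernel of the Hessian is the tangent line
of the circle. -/
structure IsMorseBottCircle (𝔣 : Data n M) (γ : ℝ → SmoothLoop (cotI n) (Cot n M))
    (e : ℝ → ℝ) : Prop where
  smooth : ContMDiff 𝓘(ℝ, ℝ × ℝ) (cotI n) ∞ (fun p : ℝ × ℝ => γ p.1 p.2)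
  smooth_e : ContDiff ℝ ∞ e
  periodic : Function.Periodic γ 1
  periodic_e : Function.Periodic e 1
  injective : ∀ θ θ' : ℝ, γ θ = γ θ' → e θ = e θ' → ∃ k : ℤ, θ - θ' = k
  immersed : ∀ θ, (∃ t, vel (cotI n) (fun θ' => γ θ' t) θ ≠ 0) ∨ deriv e θ ≠ 0
  critical : ∀ θ, (γ θ, e θ) ∈ Crit 𝔣
  isOpen : ∃ U : Set (SmoothLoop (cotI n) (Cot n M) × ℝ), IsOpen U ∧
    U ∩ Crit 𝔣 = Set.range (fun θ => (γ θ, e θ))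
  kernel : ∀ (θ : ℝ) (ξ : SmoothLoop (cotI n).tangent (TangentBundle (cotI n) (Cot n M))) (b : ℝ),
    (∀ t, (ξ t).1 = γ θ t) → InHessianKernel 𝔣 (e θ) ξ b →
    ∃ c : ℝ, (∀ t, ξ t = ⟨γ θ t, c • vel (cotI n) (fun θ' => γ θ' t) θ⟩) ∧ b = c * deriv e θ

/-- `A_𝔣` is Morse-Bott and `Crit(A_𝔣)` is a discrete union of circles. -/
def IsMorseBott (𝔣 : Data n M) : Prop :=
  ∀ v ∈ Crit 𝔣, ∃ (γ : ℝ → SmoothLoop (cotI n) (Cot n M)) (e : ℝ → ℝ),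
    IsMorseBottCircle 𝔣 γ e ∧ (γ 0, e 0) = v

/-- `𝔣 ∈ 𝔉₀` is regular: `H = 0` and `A_𝔣` is Morse-Bott with `Crit(A_𝔣)` a discrete union of
circles, or `χ ∈ 𝓧₀` and `A_𝔣` is Morse. -/
structure IsRegular (𝔣 : Data n M) : Prop extends IsData₀ 𝔣 where
  nondegenerate : (𝔣.H = 0 ∧ IsMorseBott 𝔣) ∨ (IsChi₀ 𝔣.χ ∧ IsMorse 𝔣)

/-! ## Almost complex structures and gradient flow lines -/

variable (n M) in
/-- A time-dependent endomorphism field of `T(T*M)`. -/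
abbrev EndField : Type _ :=
  ℝ → (z : Cot n M) → TangentSpace (cotI n) z →L[ℝ] TangentSpace (cotI n) z

/-- `J ∈ 𝓙`: a smooth `1`-periodic family of almost complex structures `J_t` on `T*M` such that
`ω(J_t ·, ·)` is a Riemannian metric. -/
structure IsACS (J : EndField n M) : Prop where
  smooth : ContMDiff (𝓘(ℝ, ℝ).prod (cotI n).tangent) (cotI n).tangent ∞
    (fun p : ℝ × TangentBundle (cotI n) (Cot n M) =>
      (⟨p.2.1, J p.1 p.2.1 p.2.2⟩ : TangentBundle (cotI n) (Cot n M)))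
  periodic : Function.Periodic J 1
  sq : ∀ t z v, J t z (J t z v) = -v
  symm : ∀ t z v w, omega z (J t z v) w = omega z (J t z w) v
  pos : ∀ t z v, v ≠ 0 → 0 < omega z (J t z v) v

/-- `J ∈ 𝓙(S)`: on the complement of the interior of `D(S)` the structure `J_t` is independent of
`t` and convex. -/
structure IsConvexACS (S : Set (Cot n M)) (J : EndField n M) : Prop extends IsACS J where
  indep : ∀ t t' : ℝ, ∀ z ∉ interior (region S), J t z = J t' z
  contact : ∀ t, ∀ z ∈ S, (J t z) '' contactPlane S z = contactPlane S z
  normalized : ∀ t, ∀ z ∈ S, omega z (J t z (liouvilleVF z)) (liouvilleVF z) = 1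
  invariant : ∀ t, ∀ z ∈ S, ∀ τ : ℝ, 0 ≤ τ → ∀ v : TangentSpace (cotI n) z,
    mfderiv (cotI n) (cotI n) (liouvilleFlow τ) z (J t z v)
      = J t (liouvilleFlow τ z) (mfderiv (cotI n) (cotI n) (liouvilleFlow τ) z v)

/-- `u = (x, η)` is a gradient flow line `∂_s u + ∇_J A_𝔣(u) = 0`, where
`∇_J A_𝔣(x, η) = (J_t(x)(∂_t x - f(η) χ(t) X_F(x) - X_H(t, x)), -f'(η) ∫₀¹ χ(t) F(x) dt)`
is the gradient of `A_𝔣` for the `L²`-metric of `J`. -/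
structure IsFlowLine (𝔣 : Data n M) (J : EndField n M)
    (u : ℝ → SmoothLoop (cotI n) (Cot n M) × ℝ) : Prop where
  smooth : ContMDiff 𝓘(ℝ, ℝ × ℝ) (cotI n) ∞ (fun p : ℝ × ℝ => (u p.1).1 p.2)
  smooth_η : ContDiff ℝ ∞ (fun s => (u s).2)
  loop_eq : ∀ s t : ℝ,
    vel (cotI n) (fun s' => (u s').1 t) s
      + J t ((u s).1 t) (vel (cotI n) (u s).1 t
          - (𝔣.f (u s).2 * 𝔣.χ t) • hamVF 𝔣.F ((u s).1 t) - hamVF (𝔣.H t) ((u s).1 t)) = 0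
  mult_eq : ∀ s : ℝ,
    deriv (fun s' => (u s').2) s
      - deriv 𝔣.f (u s).2 * (∫ t in (0 : ℝ)..1, 𝔣.χ t * 𝔣.F ((u s).1 t)) = 0

/-- `𝓜^{(a,b)}(∇_J A_𝔣, α)`. -/
def FlowLines (𝔣 : Data n M) (J : EndField n M) (α : FreeHomotopyClass M) (a b : ℝ) :
    Set (ℝ → SmoothLoop (cotI n) (Cot n M) × ℝ) :=
  {u | IsFlowLine 𝔣 J u ∧ (∀ s, action 𝔣 (u s).1 (u s).2 ∈ Set.Ioo a b) ∧
    ∀ s, loopClass (u s).1 = α}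

/-! ## The class `𝓕(F, a, b)` -/

/-- The norm `|v| = ω(J_t v, v)^{1/2}`. -/
def jNorm (J : EndField n M) (t : ℝ) (z : Cot n M) (v : TangentSpace (cotI n) z) : ℝ :=
  Real.sqrt (omega z (J t z v) v)

/-- `ρ` and `T` are a pair of constants `ρ(F)`, `T(F)` of `F`.  With `U_k = {|F| < k}`, where
`k > 0` is such that `1/2 + k ≤ λ(X_F) ≤ 3/2 - k` on `U_k`, they are
`T = ‖λ|_{U_k}‖_∞` and `ρ = min {k/2, k/(2‖dF‖_∞)}`; the norms are taken with respect to an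
auxiliary element of `𝓙`. -/
def IsConstants (F : Cot n M → ℝ) (ρ T : ℝ) : Prop :=
  ∃ (J : EndField n M) (k G : ℝ), IsACS J ∧ 0 < k ∧
    (∀ z, |F z| < k →
      1 / 2 + k ≤ liouville z (hamVF F z) ∧ liouville z (hamVF F z) ≤ 3 / 2 - k) ∧
    IsLUB {r : ℝ | ∃ (t : ℝ) (z : Cot n M) (v : TangentSpace (cotI n) z),
      |F z| < k ∧ jNorm J t z v ≤ 1 ∧ r = |liouville z v|} T ∧
    IsLUB {r : ℝ | ∃ (t : ℝ) (z : Cot n M) (v : TangentSpace (cotI n) z),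
      jNorm J t z v ≤ 1 ∧ r = |dfun F z v|} G ∧
    ρ = min (k / 2) (k / (2 * G))

/-- The class `𝓕(F, a, b) = 𝓕(a/6, (b - a)/ρ₁)` with `ρ₁ = min {ρ(F), a/(4 T(F))}`. -/
def IsFFab (F : Cot n M → ℝ) (a b : ℝ) (f : ℝ → ℝ) : Prop :=
  ∃ ρ T : ℝ, IsConstants F ρ T ∧ IsFar (a / 6) ((b - a) / min ρ (a / (4 * T))) f

/-! ## Admissible quadruples -/

/-- The quadruple `(𝔣, a, b, J)`, with `𝔣` regular, `J ∈ 𝓙` and `0 < a < b`, is `α`-admissible.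
The loop component is measured by the fibre norm of a Riemannian metric `g` on `M`. -/
structure IsAdmissible
    (g : ContMDiffRiemannianMetric (𝓡 n) ∞ (EuclideanSpace ℝ (Fin n))
      (fun q : M => TangentSpace (𝓡 n) q))
    (α : FreeHomotopyClass M) (𝔣 : Data n M) (a b : ℝ) (J : EndField n M) : Prop where
  regular : IsRegular 𝔣
  acs : IsACS J
  pos : 0 < a
  lt : a < b
  spectrum : actionSpectrum 𝔣 α ∩ {a, b} = ∅
  compact : IsCompact (CritWindow 𝔣 α a b)
  bounded : ∃ Cloop Cmult : ℝ, 0 < Cloop ∧ 0 < Cmult ∧ ∀ u ∈ FlowLines 𝔣 J α a b,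
    (∀ s t, covectorNorm g ((u s).1 t) < Cloop) ∧ ∀ s, |(u s).2| < Cmult

end Cotangent

end RFH

end

/-!
# Admissibility of perturbed Rabinowitz action functionals

The theorem asserts a priori bounds for gradient flow lines `u = (x, η)` with action in `(a, b)`,
and compactness of the set of critical points in this window.  Everything is local on `T*M` except
for the geometry at infinity, so all computations take place in natural coordinates `(q, p)`, in
which `λ = p dq` (`liouville_eq`) and `ω = dp ∧ dq` (`omega_eq`).

*The loops.*  The starshaped hypersurface `S` and the convex almost complex structure `J` define a
radial function `r = ω(JY, Y)` (`radius`), which is `e^τ` on the image of `S` under the Liouville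
flow at time `τ`; its sublevel sets are compact (`IsConvexACS.isCompact_radius_le`).  Let `R` be
so large that all Hamiltonian vector fields vanish on `{r > R}`.  There the loops of a flow line
satisfy the Cauchy-Riemann equation.  For a cut-off `Ψ` that depends on `r` only, is positive on
`{r > R}` and vanishes elsewhere, the form `-d(Ψλ)` dominates a positive multiple of the metric on
complex lines (`IsConvexACS.cutoff_estimate`).  Hence `G(s) = -∫ Ψ λ(∂ₜx) dt` is monotone, while
`G²` is bounded by the energy density of the flow line, whose integral is at most `b - a`; both
together force `G = 0`.  Thus `x` is locally constant where it lies in `{r > R}`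
(`IsFlowLine.vel_eq_zero_of_far`), so that it either never enters this set or is a constant point.
In the second case only the multiplier moves, and the action would be unbounded or not positive
(`IsFlowLine.false_of_const`).  This proves `IsFlowLine.radius_le`.

*The multipliers.*  Let the gradient at `(x, η)` be small and let `x` lie in a compact set.  Up to a
small error and up to the contribution of `H`, which is at most `a/2`, the action is
`f(η) ∫ χ (λ(X_F) - F)`.  If `η` is very negative, then `f(η)` is small and the action cannot exceed
`a`.  If `η ≥ a/6`, then `f(η) = η` and `f'(η) = 1`, so that `∫ χ F(x)` is small; moreover `F` is
almost constant on the support of `χ`, and as `λ(X_F) - F` is bounded below by `1/2` near `F = 0`,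
the action bounds `η` from above (`exists_mult_bound`).  On every interval of a certain length a
flow line has a time at which the gradient is small, since its energy is at most `b - a`, and `∂ₛη`
is bounded; hence `η` is bounded at all times (`exists_mult_bound_flowLine`).

*The critical points.*  The first variation (`hasDerivAt_action`) shows that `(x, η)` is critical if
and only if `∂ₜx = f(η) χ X_F + X_H` and `∫ χ F(x) = 0` (`defect_eq_zero_of_mem_crit`,
`integral_eq_zero_of_mem_crit`, `mem_crit`).  The previous bounds apply, so every ultrafilter of
critical points in the window has a pointwise limit.  For a smooth function `Φ(η, t, z)` the
derivative of `Φ(η, t, x(t))` is, by the equation, a function of the same type (`timeDeriv`);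
therefore pointwise convergence of critical loops is uniform, with all derivatives, and the limit
is again a smooth solution (`IsCritLimit.contMDiff_limit`, `IsCritLimit.tendsto_loop`).  The
homotopy class passes to the limit because nearby loops are homotopic
(`exists_loopClass_eq_of_close`), and the limit action lies in the open window because the end
points of the window do not belong to the spectrum (`isCompact_critWindow`).
-/

noncomputable section

namespace RFH

variable {n : ℕ} {M : Type*} [TopologicalSpace M] [ChartedSpace (EuclideanSpace ℝ (Fin n)) M]
  [IsManifold (𝓡 n) ∞ M]

/-! ### Instance shortcuts

These repeat instances that are found by unification anyway; they shorten the search. -/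

instance instTopologicalSpaceTangentCot (z : Cot n M) :
    TopologicalSpace (TangentSpace (cotI n) z) := inferInstance

instance instAddCommGroupTangentCot (z : Cot n M) :
    AddCommGroup (TangentSpace (cotI n) z) := inferInstance

instance instModuleTangentCot (z : Cot n M) : Module ℝ (TangentSpace (cotI n) z) := inferInstance

instance instChartedSpaceCot : ChartedSpace (ModelProd (EuclideanSpace ℝ (Fin n))
    (EuclideanSpace ℝ (Fin n) →L[ℝ] ℝ)) (Cot n M) := inferInstance

instance instIsManifoldCot : IsManifold (cotI n) ∞ (Cot n M) := inferInstance

instance instIsManifoldOneCot : IsManifold (cotI n) 1 (Cot n M) := inferInstance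

instance instTopologicalSpaceTangentBundleCot :
    TopologicalSpace (TangentBundle (cotI n) (Cot n M)) := inferInstance

instance instChartedSpaceTangentCot : ChartedSpace (ModelProd (ModelProd (EuclideanSpace ℝ (Fin n))
    (EuclideanSpace ℝ (Fin n) →L[ℝ] ℝ)) (CotVec n)) (TangentBundle (cotI n) (Cot n M)) :=
  inferInstance

/-! ### Natural coordinates of the cotangent bundle -/

/-- The natural coordinates `(q, p)` of `T*M` around `z₀`. -/
def co (z₀ z : Cot n M) : CotVec n := extChartAt (cotI n) z₀ z

/-- The inverse of the natural coordinates around `z₀`. -/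
def coInv (z₀ : Cot n M) (y : CotVec n) : Cot n M := (extChartAt (cotI n) z₀).symm y

/-- The domain of the natural coordinates around `z₀`. -/
def dom (z₀ : Cot n M) : Set (Cot n M) := (extChartAt (cotI n) z₀).source

/-- The range of the natural coordinates around `z₀`. -/
def tgt (z₀ : Cot n M) : Set (CotVec n) := (extChartAt (cotI n) z₀).target

/-- The differential at `z` of the natural coordinates around `z₀`. -/
def dco (z₀ z : Cot n M) : TangentSpace (cotI n) z →L[ℝ] CotVec n :=
  mfderiv (cotI n) 𝓘(ℝ, CotVec n) (extChartAt (cotI n) z₀) z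

theorem isOpen_dom (z₀ : Cot n M) : IsOpen (dom z₀) := isOpen_extChartAt_source z₀

theorem isOpen_tgt (z₀ : Cot n M) : IsOpen (tgt z₀) := isOpen_extChartAt_target z₀

theorem mem_dom_self (z₀ : Cot n M) : z₀ ∈ dom z₀ := mem_extChartAt_source z₀

theorem dom_mem_nhds {z₀ z : Cot n M} (hz : z ∈ dom z₀) : dom z₀ ∈ 𝓝 z :=
  (isOpen_dom z₀).mem_nhds hz

theorem mem_dom_iff (z₀ z : Cot n M) :
    z ∈ dom z₀ ↔ z.1 ∈ (chartAt (EuclideanSpace ℝ (Fin n)) z₀.1).source := by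
  rw [dom, FiberBundle.extChartAt]
  simp only [mfld_simps, hom_trivializationAt_source, hom_trivializationAt_apply]
  simp

theorem mem_chart_source {z₀ z : Cot n M} (hz : z ∈ dom z₀) :
    z ∈ (chartAt (ModelProd (EuclideanSpace ℝ (Fin n)) (EuclideanSpace ℝ (Fin n) →L[ℝ] ℝ))
      z₀).source := by
  rwa [dom, extChartAt_source] at hz

theorem coInv_co {z₀ z : Cot n M} (hz : z ∈ dom z₀) : coInv z₀ (co z₀ z) = z :=
  (extChartAt (cotI n) z₀).left_inv hz

theorem co_coInv {z₀ : Cot n M} {y : CotVec n} (hy : y ∈ tgt z₀) : co z₀ (coInv z₀ y) = y :=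
  (extChartAt (cotI n) z₀).right_inv hy

theorem co_mem {z₀ z : Cot n M} (hz : z ∈ dom z₀) : co z₀ z ∈ tgt z₀ :=
  (extChartAt (cotI n) z₀).map_source hz

theorem coInv_mem {z₀ : Cot n M} {y : CotVec n} (hy : y ∈ tgt z₀) : coInv z₀ y ∈ dom z₀ :=
  (extChartAt (cotI n) z₀).map_target hy

theorem contMDiffAt_co {z₀ z : Cot n M} (hz : z ∈ dom z₀) :
    ContMDiffAt (cotI n) 𝓘(ℝ, CotVec n) ∞ (co z₀) z :=
  contMDiffAt_extChartAt' (mem_chart_source hz)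

theorem contMDiffAt_coInv {z₀ : Cot n M} {y : CotVec n} (hy : y ∈ tgt z₀) :
    ContMDiffAt 𝓘(ℝ, CotVec n) (cotI n) ∞ (coInv z₀) y :=
  (contMDiffOn_extChartAt_symm (I := cotI n) (n := ∞) z₀).contMDiffAt ((isOpen_tgt z₀).mem_nhds hy)

theorem mdifferentiableAt_co {z₀ z : Cot n M} (hz : z ∈ dom z₀) :
    MDifferentiableAt (cotI n) 𝓘(ℝ, CotVec n) (co z₀) z :=
  (contMDiffAt_co hz).mdifferentiableAt (by simp)

theorem mdifferentiableAt_coInv {z₀ : Cot n M} {y : CotVec n} (hy : y ∈ tgt z₀) :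
    MDifferentiableAt 𝓘(ℝ, CotVec n) (cotI n) (coInv z₀) y :=
  (contMDiffAt_coInv hy).mdifferentiableAt (by simp)

theorem hasMFDerivAt_co {z₀ z : Cot n M} (hz : z ∈ dom z₀) :
    HasMFDerivAt (cotI n) 𝓘(ℝ, CotVec n) (co z₀) z (dco z₀ z) :=
  (mdifferentiableAt_co hz).hasMFDerivAt

/-- The differential of the coordinates along a curve is the derivative in coordinates. -/
theorem dco_vel {γ : ℝ → Cot n M} {t : ℝ} (hγ : MDifferentiableAt 𝓘(ℝ, ℝ) (cotI n) γ t)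
    {z₀ : Cot n M} (hz : γ t ∈ dom z₀) :
    dco z₀ (γ t) (vel (cotI n) γ t) = deriv (fun τ => co z₀ (γ τ)) t := by
  let L : ℝ →L[ℝ] CotVec n := (dco z₀ (γ t)).comp (mfderiv 𝓘(ℝ, ℝ) (cotI n) γ t)
  have h2 : HasFDerivAt (fun τ => co z₀ (γ τ)) L t :=
    ((hasMFDerivAt_co hz).comp t hγ.hasMFDerivAt).hasFDerivAt
  exact h2.hasDerivAt.deriv.symm

theorem dco_injective {z₀ z : Cot n M} (hz : z ∈ dom z₀) : Function.Injective (dco z₀ z) :=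
  (isInvertible_mfderiv_extChartAt (I := cotI n) hz).injective

theorem dco_surjective {z₀ z : Cot n M} (hz : z ∈ dom z₀) : Function.Surjective (dco z₀ z) :=
  (isInvertible_mfderiv_extChartAt (I := cotI n) hz).surjective

theorem mfderiv_coInv_co {z₀ : Cot n M} {y : CotVec n} (hy : y ∈ tgt z₀) (v : CotVec n) :
    dco z₀ (coInv z₀ y) (mfderiv 𝓘(ℝ, CotVec n) (cotI n) (coInv z₀) y v) = v := by
  let L : CotVec n →L[ℝ] CotVec n :=
    (dco z₀ (coInv z₀ y)).comp (mfderiv 𝓘(ℝ, CotVec n) (cotI n) (coInv z₀) y)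
  have h2 : HasFDerivAt (co z₀ ∘ coInv z₀) L y :=
    ((hasMFDerivAt_co (coInv_mem hy)).comp y (mdifferentiableAt_coInv hy).hasMFDerivAt).hasFDerivAt
  have h3 : HasFDerivAt (co z₀ ∘ coInv z₀) (ContinuousLinearMap.id ℝ _) y :=
    (hasFDerivAt_id y).congr_of_eventuallyEq
      (Filter.eventually_of_mem ((isOpen_tgt z₀).mem_nhds hy) fun _ h => co_coInv h)
  exact DFunLike.congr_fun (h2.unique h3) v

theorem co_fst (z₀ z : Cot n M) : (co z₀ z).1 = extChartAt (𝓡 n) z₀.1 z.1 := by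
  rw [co, FiberBundle.extChartAt]
  simp [hom_trivializationAt_apply]

theorem co_snd_apply (z₀ z : Cot n M) (v : EuclideanSpace ℝ (Fin n)) :
    (co z₀ z).2 v = z.2 ((trivializationAt (EuclideanSpace ℝ (Fin n))
      (TangentSpace (𝓡 n)) z₀.1).symmL ℝ z.1 v) := by
  rw [co, FiberBundle.extChartAt]
  simp only [hom_trivializationAt_apply, ContinuousLinearMap.inCoordinates, mfld_simps]
  change (Bundle.Trivial.trivialization M ℝ).continuousLinearMapAt ℝ z.proj (z.2 _) = _
  rw [Bundle.Trivial.continuousLinearMapAt_trivialization]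
  rfl

theorem co_snd_mfderiv {z₀ z : Cot n M} (hz : z ∈ dom z₀) (w : TangentSpace (𝓡 n) z.1) :
    (co z₀ z).2 (mfderiv (𝓡 n) 𝓘(ℝ, EuclideanSpace ℝ (Fin n)) (extChartAt (𝓡 n) z₀.1) z.1 w)
      = z.2 w := by
  rw [mem_dom_iff] at hz
  refine (co_snd_apply z₀ z _).trans (congrArg z.2 ?_)
  rw [← TangentBundle.continuousLinearMapAt_trivializationAt hz]
  exact (trivializationAt (EuclideanSpace ℝ (Fin n))
    (TangentSpace (𝓡 n)) z₀.1).symmL_continuousLinearMapAt (R := ℝ) (b := z.1) (by simpa using hz) w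

theorem contMDiff_footpoint : ContMDiff (cotI n) (𝓡 n) ∞ (fun y : Cot n M => y.1) :=
  Bundle.contMDiff_proj _

/-- The Liouville form is `p dq` in natural coordinates. -/
theorem liouville_eq {z₀ z : Cot n M} (hz : z ∈ dom z₀) (v : TangentSpace (cotI n) z) :
    liouville z v = (co z₀ z).2 (dco z₀ z v).1 := by
  have hq : z.1 ∈ (chartAt (EuclideanSpace ℝ (Fin n)) z₀.1).source := (mem_dom_iff _ _).1 hz
  rw [liouville, ← co_snd_mfderiv hz]
  congr 1
  have h1 := (mdifferentiableAt_extChartAt (I := 𝓡 n) hq).hasMFDerivAt.comp z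
    ((contMDiff_footpoint (M := M) (n := n) z).mdifferentiableAt (by simp)).hasMFDerivAt
  have h2 := ((ContinuousLinearMap.fst ℝ (EuclideanSpace ℝ (Fin n))
    (EuclideanSpace ℝ (Fin n) →L[ℝ] ℝ)).hasMFDerivAt (x := co z₀ z)).comp z (hasMFDerivAt_co hz)
  have h3 : (⇑(ContinuousLinearMap.fst ℝ (EuclideanSpace ℝ (Fin n))
    (EuclideanSpace ℝ (Fin n) →L[ℝ] ℝ)) ∘ co z₀) =
      (extChartAt (𝓡 n) z₀.1 ∘ fun y : Cot n M => y.1) := by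
    funext y; exact co_fst z₀ y
  rw [h3] at h2
  exact DFunLike.congr_fun (hasMFDerivAt_unique h1 h2) v

theorem fibreScale_mem_dom {z₀ z : Cot n M} (c : ℝ) : fibreScale c z ∈ dom z₀ ↔ z ∈ dom z₀ := by
  rw [mem_dom_iff, mem_dom_iff]; rfl

theorem co_fibreScale (z₀ z : Cot n M) (c : ℝ) :
    co z₀ (fibreScale c z) = ((co z₀ z).1, c • (co z₀ z).2) := by
  refine Prod.ext ?_ ?_
  · rw [co_fst, co_fst]; rfl
  · ext v
    change _ = c • ((co z₀ z).2 v)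
    rw [co_snd_apply, co_snd_apply]
    rfl

instance instT2SpaceCot [T2Space M] : T2Space (Cot n M) := by
  refine ⟨fun x y hxy => ?_⟩
  by_cases h : x.1 = y.1
  · have hy : y ∈ dom x := (mem_dom_iff x y).2 (h ▸ _root_.mem_chart_source _ x.1)
    have hne : co x x ≠ co x y := fun he => hxy <| by
      rw [← coInv_co (mem_dom_self x), he, coInv_co hy]
    obtain ⟨U, V, hU, hV, hxU, hyV, hUV⟩ := t2_separation hne
    obtain ⟨U', hU', hU'o, hxU'⟩ := mem_nhds_iff.1
      ((contMDiffAt_co (mem_dom_self x)).continuousAt.preimage_mem_nhds (hU.mem_nhds hxU))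
    obtain ⟨V', hV', hV'o, hyV'⟩ := mem_nhds_iff.1
      ((contMDiffAt_co hy).continuousAt.preimage_mem_nhds (hV.mem_nhds hyV))
    exact ⟨U', V', hU'o, hV'o, hxU', hyV',
      (hUV.preimage (co x)).mono hU' hV'⟩
  · exact separated_by_continuous (FiberBundle.continuous_proj _ _) h

instance instLocallyConnectedSpaceCot : LocallyConnectedSpace (Cot n M) :=
  haveI : LocallyConnectedSpace (ModelProd (EuclideanSpace ℝ (Fin n))
      (EuclideanSpace ℝ (Fin n) →L[ℝ] ℝ)) :=
    inferInstanceAs (LocallyConnectedSpace (CotVec n))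
  ChartedSpace.locallyConnectedSpace (ModelProd (EuclideanSpace ℝ (Fin n))
    (EuclideanSpace ℝ (Fin n) →L[ℝ] ℝ)) _

/-! ### The symplectic form in natural coordinates -/

/-- Along two-parameter families the differentials of the coordinates are partial derivatives. -/
theorem dco_vel_snd {X : ℝ × ℝ → Cot n M} {z₁ : Cot n M} {s t : ℝ}
    (hX : ContMDiffAt 𝓘(ℝ, ℝ × ℝ) (cotI n) 1 X (s, t)) (hz : X (s, t) ∈ dom z₁) :
    dco z₁ (X (s, t)) (vel (cotI n) (fun τ => X (s, τ)) t)
      = fderiv ℝ (fun p => co z₁ (X p)) (s, t) (0, 1) := by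
  have h1 : MDifferentiableAt 𝓘(ℝ, ℝ) (cotI n) (fun τ => X (s, τ)) t := by
    have : MDifferentiableAt 𝓘(ℝ, ℝ) 𝓘(ℝ, ℝ × ℝ) (fun τ : ℝ => (s, τ)) t :=
      DifferentiableAt.mdifferentiableAt (by fun_prop)
    exact (hX.mdifferentiableAt (by simp)).comp t this
  have h2 : DifferentiableAt ℝ (fun p => co z₁ (X p)) (s, t) :=
    ((((contMDiffAt_co hz).of_le (by simp)).comp (s, t) hX).mdifferentiableAt (by simp)).differentiableAt
  rw [dco_vel (γ := fun τ => X (s, τ)) h1 hz]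
  have h3 : HasDerivAt (fun τ : ℝ => (s, τ)) ((0 : ℝ), (1 : ℝ)) t :=
    (hasDerivAt_const t s).prodMk (hasDerivAt_id t)
  exact (h2.hasFDerivAt.comp_hasDerivAt t h3).deriv

theorem dco_vel_fst {X : ℝ × ℝ → Cot n M} {z₁ : Cot n M} {s t : ℝ}
    (hX : ContMDiffAt 𝓘(ℝ, ℝ × ℝ) (cotI n) 1 X (s, t)) (hz : X (s, t) ∈ dom z₁) :
    dco z₁ (X (s, t)) (vel (cotI n) (fun σ => X (σ, t)) s)
      = fderiv ℝ (fun p => co z₁ (X p)) (s, t) (1, 0) := by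
  have h1 : MDifferentiableAt 𝓘(ℝ, ℝ) (cotI n) (fun σ => X (σ, t)) s := by
    have : MDifferentiableAt 𝓘(ℝ, ℝ) 𝓘(ℝ, ℝ × ℝ) (fun σ : ℝ => (σ, t)) s :=
      DifferentiableAt.mdifferentiableAt (by fun_prop)
    exact (hX.mdifferentiableAt (by simp)).comp s this
  have h2 : DifferentiableAt ℝ (fun p => co z₁ (X p)) (s, t) :=
    ((((contMDiffAt_co hz).of_le (by simp)).comp (s, t) hX).mdifferentiableAt (by simp)).differentiableAt
  rw [dco_vel (γ := fun σ => X (σ, t)) h1 hz]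
  have h3 : HasDerivAt (fun σ : ℝ => (σ, t)) ((1 : ℝ), (0 : ℝ)) s :=
    (hasDerivAt_id s).prodMk (hasDerivAt_const s t)
  exact (h2.hasFDerivAt.comp_hasDerivAt s h3).deriv

/-- The canonical symplectic form of the model space. -/
def stdForm (v w : CotVec n) : ℝ := v.2 w.1 - w.2 v.1

/-- The function `p dq(∂ᵥ Z)` for a map `Z` into the model space. -/
theorem contDiffAt_pdq {Z : ℝ × ℝ → CotVec n} {p : ℝ × ℝ} (hZ : ContDiffAt ℝ ∞ Z p) (v : ℝ × ℝ) :
    ContDiffAt ℝ ∞ (fun q => (Z q).2 (fderiv ℝ Z q v).1) p := by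
  have h1 : ContDiffAt ℝ ∞ (fderiv ℝ Z) p := hZ.fderiv_right (by simp)
  exact hZ.snd.clm_apply (h1.clm_apply contDiffAt_const).fst

theorem fderiv_pdq {Z : ℝ × ℝ → CotVec n} {p : ℝ × ℝ} (hZ : ContDiffAt ℝ ∞ Z p) (v w : ℝ × ℝ) :
    fderiv ℝ (fun q => (Z q).2 (fderiv ℝ Z q v).1) p w =
      (fderiv ℝ Z p w).2 (fderiv ℝ Z p v).1 + (Z p).2 (fderiv ℝ (fderiv ℝ Z) p w v).1 := by
  have h1 : ContDiffAt ℝ ∞ (fderiv ℝ Z) p := hZ.fderiv_right (by simp)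
  have hZ' := (hZ.differentiableAt (by simp)).hasFDerivAt
  have h1' := (h1.differentiableAt (by simp)).hasFDerivAt
  have h2 := hZ'.snd.clm_apply (h1'.clm_apply (hasFDerivAt_const v p)).fst
  rw [h2.fderiv]
  simp [add_comm]

theorem fderiv_pdq_sub {Z : ℝ × ℝ → CotVec n} {p : ℝ × ℝ} (hZ : ContDiffAt ℝ ∞ Z p) (v w : ℝ × ℝ) :
    fderiv ℝ (fun q => (Z q).2 (fderiv ℝ Z q v).1) p w
      - fderiv ℝ (fun q => (Z q).2 (fderiv ℝ Z q w).1) p v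
      = stdForm (fderiv ℝ Z p w) (fderiv ℝ Z p v) := by
  have := (hZ.isSymmSndFDerivAt (by simpa using (WithTop.coe_le_coe.2 le_top : ((2 : ℕ∞) : WithTop ℕ∞) ≤ ∞))).eq v w
  rw [fderiv_pdq hZ, fderiv_pdq hZ, this, stdForm]
  ring

theorem liouvilleInChart_eq {z₀ : Cot n M} {y : CotVec n} (hy : y ∈ tgt z₀) (v : CotVec n) :
    liouvilleInChart z₀ y v = y.2 v.1 := by
  have h := liouville_eq (coInv_mem hy) (mfderiv 𝓘(ℝ, CotVec n) (cotI n) (coInv z₀) y v)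
  rw [mfderiv_coInv_co hy, co_coInv hy] at h
  exact h

theorem omega_self_eq (z : Cot n M) (v w : TangentSpace (cotI n) z) :
    omega z v w = stdForm (dco z z v) (dco z z w) := by
  have key (u : CotVec n) : fderiv ℝ (fun y => liouvilleInChart z y u) (co z z) =
      (ContinuousLinearMap.apply ℝ ℝ u.1).comp (ContinuousLinearMap.snd ℝ _ _) := by
    have h1 : (fun y => liouvilleInChart z y u) =ᶠ[𝓝 (co z z)]
        ((ContinuousLinearMap.apply ℝ ℝ u.1).comp (ContinuousLinearMap.snd ℝ _ _)) :=
      Filter.eventually_of_mem ((isOpen_tgt z).mem_nhds (co_mem (mem_dom_self z)))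
        fun y hy => liouvilleInChart_eq hy u
    rw [h1.fderiv_eq]
    exact ContinuousLinearMap.fderiv _
  have h := congrArg₂ (fun a b : ℝ => a - b)
    (DFunLike.congr_fun (key (dco z z w)) (dco z z v))
    (DFunLike.congr_fun (key (dco z z v)) (dco z z w))
  exact h

section Curl

variable {X : ℝ × ℝ → Cot n M} {z₁ : Cot n M} {s t : ℝ}

theorem contDiffAt_co_comp (hX : ContMDiffAt 𝓘(ℝ, ℝ × ℝ) (cotI n) ∞ X (s, t))
    (hz : X (s, t) ∈ dom z₁) : ContDiffAt ℝ ∞ (fun p => co z₁ (X p)) (s, t) :=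
  ((contMDiffAt_co hz).comp (s, t) hX).contDiffAt

theorem liouville_vel_snd_eventually (hX : ContMDiffAt 𝓘(ℝ, ℝ × ℝ) (cotI n) ∞ X (s, t))
    (hz : X (s, t) ∈ dom z₁) :
    (fun p : ℝ × ℝ => liouville (X p) (vel (cotI n) (fun τ => X (p.1, τ)) p.2)) =ᶠ[𝓝 (s, t)]
      fun p => (co z₁ (X p)).2 (fderiv ℝ (fun q => co z₁ (X q)) p (0, 1)).1 := by
  filter_upwards [(contMDiffAt_iff_contMDiffAt_nhds (by simp)).1 (hX.of_le (m := 1) (by simp)),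
    hX.continuousAt.preimage_mem_nhds (dom_mem_nhds hz)]
    with p hp hp'
  rw [liouville_eq hp', ← dco_vel_snd hp hp']

theorem liouville_vel_fst_eventually (hX : ContMDiffAt 𝓘(ℝ, ℝ × ℝ) (cotI n) ∞ X (s, t))
    (hz : X (s, t) ∈ dom z₁) :
    (fun p : ℝ × ℝ => liouville (X p) (vel (cotI n) (fun σ => X (σ, p.2)) p.1)) =ᶠ[𝓝 (s, t)]
      fun p => (co z₁ (X p)).2 (fderiv ℝ (fun q => co z₁ (X q)) p (1, 0)).1 := by
  filter_upwards [(contMDiffAt_iff_contMDiffAt_nhds (by simp)).1 (hX.of_le (m := 1) (by simp)),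
    hX.continuousAt.preimage_mem_nhds (dom_mem_nhds hz)]
    with p hp hp'
  rw [liouville_eq hp', ← dco_vel_fst hp hp']

theorem contDiffAt_liouville_vel_snd (hX : ContMDiffAt 𝓘(ℝ, ℝ × ℝ) (cotI n) ∞ X (s, t)) :
    ContDiffAt ℝ ∞ (fun p : ℝ × ℝ => liouville (X p) (vel (cotI n) (fun τ => X (p.1, τ)) p.2))
      (s, t) :=
  (contDiffAt_pdq (contDiffAt_co_comp hX (mem_dom_self _)) (0, 1)).congr_of_eventuallyEq
    (liouville_vel_snd_eventually hX (mem_dom_self _))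

theorem contDiffAt_liouville_vel_fst (hX : ContMDiffAt 𝓘(ℝ, ℝ × ℝ) (cotI n) ∞ X (s, t)) :
    ContDiffAt ℝ ∞ (fun p : ℝ × ℝ => liouville (X p) (vel (cotI n) (fun σ => X (σ, p.2)) p.1))
      (s, t) :=
  (contDiffAt_pdq (contDiffAt_co_comp hX (mem_dom_self _)) (1, 0)).congr_of_eventuallyEq
    (liouville_vel_fst_eventually hX (mem_dom_self _))

/-- `∂ₛ λ(∂ₜX) - ∂ₜ λ(∂ₛX)` in arbitrary natural coordinates. -/
theorem curl_liouville_chart (hX : ContMDiffAt 𝓘(ℝ, ℝ × ℝ) (cotI n) ∞ X (s, t))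
    (hz : X (s, t) ∈ dom z₁) :
    fderiv ℝ (fun p : ℝ × ℝ => liouville (X p) (vel (cotI n) (fun τ => X (p.1, τ)) p.2))
        (s, t) (1, 0)
      - fderiv ℝ (fun p : ℝ × ℝ => liouville (X p) (vel (cotI n) (fun σ => X (σ, p.2)) p.1))
        (s, t) (0, 1)
      = stdForm (dco z₁ (X (s, t)) (vel (cotI n) (fun σ => X (σ, t)) s))
          (dco z₁ (X (s, t)) (vel (cotI n) (fun τ => X (s, τ)) t)) := by
  rw [(liouville_vel_snd_eventually hX hz).fderiv_eq, (liouville_vel_fst_eventually hX hz).fderiv_eq,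
    fderiv_pdq_sub (contDiffAt_co_comp hX hz), dco_vel_fst (hX.of_le (by simp)) hz, dco_vel_snd (hX.of_le (by simp)) hz]

/-- The Cartan formula `∂ₛ λ(∂ₜX) - ∂ₜ λ(∂ₛX) = ω(∂ₛX, ∂ₜX)` for a two-parameter family. -/
theorem curl_liouville (hX : ContMDiffAt 𝓘(ℝ, ℝ × ℝ) (cotI n) ∞ X (s, t)) :
    fderiv ℝ (fun p : ℝ × ℝ => liouville (X p) (vel (cotI n) (fun τ => X (p.1, τ)) p.2))
        (s, t) (1, 0)
      - fderiv ℝ (fun p : ℝ × ℝ => liouville (X p) (vel (cotI n) (fun σ => X (σ, p.2)) p.1))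
        (s, t) (0, 1)
      = omega (X (s, t)) (vel (cotI n) (fun σ => X (σ, t)) s)
          (vel (cotI n) (fun τ => X (s, τ)) t) := by
  rw [curl_liouville_chart hX (mem_dom_self _), omega_self_eq]

end Curl

/-- The symplectic form is `dp ∧ dq` in all natural coordinates: compare the Cartan formula
for the family `(s, t) ↦ y + s v + t w` in two charts. -/
theorem omega_eq {z₁ z : Cot n M} (hz : z ∈ dom z₁) (v w : TangentSpace (cotI n) z) :
    omega z v w = stdForm (dco z₁ z v) (dco z₁ z w) := by
  let X : ℝ × ℝ → Cot n M := fun p =>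
    coInv z₁ (co z₁ z + p.1 • dco z₁ z v + p.2 • dco z₁ z w)
  have h0 : co z₁ z + (0 : ℝ) • dco z₁ z v + (0 : ℝ) • dco z₁ z w = co z₁ z := by simp
  have hX0 : X (0, 0) = z := by simp only [X, h0, coInv_co hz]
  have hX : ContMDiffAt 𝓘(ℝ, ℝ × ℝ) (cotI n) ∞ X (0, 0) := by
    have h1 : ContMDiffAt 𝓘(ℝ, CotVec n) (cotI n) ∞ (coInv z₁)
        (co z₁ z + (0 : ℝ) • dco z₁ z v + (0 : ℝ) • dco z₁ z w) := by
      rw [h0]; exact contMDiffAt_coInv (co_mem hz)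
    have h2 : ContDiff ℝ ∞ (fun p : ℝ × ℝ => co z₁ z + p.1 • dco z₁ z v + p.2 • dco z₁ z w) := by
      fun_prop
    exact ContMDiffAt.comp (I' := 𝓘(ℝ, CotVec n)) (0, 0) h1 h2.contDiffAt.contMDiffAt
  have hz' : X (0, 0) ∈ dom z₁ := by rwa [hX0]
  have hloc : (fun p => co z₁ (X p)) =ᶠ[𝓝 (0, 0)]
      fun p : ℝ × ℝ => co z₁ z + p.1 • dco z₁ z v + p.2 • dco z₁ z w := by
    have h2 : ContinuousAt (fun p : ℝ × ℝ => co z₁ z + p.1 • dco z₁ z v + p.2 • dco z₁ z w)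
        (0, 0) := by fun_prop
    filter_upwards [h2.preimage_mem_nhds
      ((isOpen_tgt z₁).mem_nhds (by simpa [h0] using co_mem hz))] with p hp
    exact co_coInv hp
  have hD : HasFDerivAt (fun p => co z₁ (X p))
      ((ContinuousLinearMap.fst ℝ ℝ ℝ).smulRight (dco z₁ z v)
        + (ContinuousLinearMap.snd ℝ ℝ ℝ).smulRight (dco z₁ z w)) (0, 0) := by
    refine HasFDerivAt.congr_of_eventuallyEq ?_ hloc
    exact ((hasFDerivAt_fst.smul_const (dco z₁ z v)).const_add (co z₁ z)).add
      (hasFDerivAt_snd.smul_const (dco z₁ z w))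
  have e1 := (curl_liouville_chart hX hz').symm.trans (curl_liouville hX)
  rw [dco_vel_fst (hX.of_le (by simp)) hz', dco_vel_snd (hX.of_le (by simp)) hz', hD.fderiv] at e1
  have hv : dco z₁ (X (0, 0)) (vel (cotI n) (fun σ => X (σ, 0)) 0) = dco z₁ z v := by
    rw [dco_vel_fst (hX.of_le (by simp)) hz', hD.fderiv]; simp
  have hw : dco z₁ (X (0, 0)) (vel (cotI n) (fun τ => X (0, τ)) 0) = dco z₁ z w := by
    rw [dco_vel_snd (hX.of_le (by simp)) hz', hD.fderiv]; simp
  have hgen : ∀ (z' : Cot n M) (_ : z' = z) (v' w' : TangentSpace (cotI n) z'),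
      dco z₁ z' v' = dco z₁ z v → dco z₁ z' w' = dco z₁ z w → omega z' v' w' = omega z v w := by
    rintro z' rfl v' w' h h'
    rw [dco_injective hz h, dco_injective hz h']
  rw [hgen _ hX0 _ _ hv hw] at e1
  simpa using e1.symm

/-! ### Linear algebra of the symplectic form and Hamiltonian vector fields -/

theorem dco_add (z₀ z : Cot n M) (v w : TangentSpace (cotI n) z) :
    dco z₀ z (v + w) = dco z₀ z v + dco z₀ z w := ContinuousLinearMap.map_add _ v w

theorem dco_smul (z₀ z : Cot n M) (c : ℝ) (v : TangentSpace (cotI n) z) :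
    dco z₀ z (c • v) = c • dco z₀ z v := ContinuousLinearMap.map_smul _ c v

theorem dco_zero (z₀ z : Cot n M) : dco z₀ z 0 = 0 := ContinuousLinearMap.map_zero _

theorem omega_antisymm (z : Cot n M) (v w : TangentSpace (cotI n) z) :
    omega z v w = -omega z w v := by
  rw [omega_self_eq, omega_self_eq, stdForm, stdForm]; ring

theorem omega_self (z : Cot n M) (v : TangentSpace (cotI n) z) : omega z v v = 0 := by
  rw [omega_self_eq, stdForm]; ring

theorem omega_add_left (z : Cot n M) (u v w : TangentSpace (cotI n) z) :
    omega z (u + v) w = omega z u w + omega z v w := by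
  simp only [omega_self_eq, stdForm, Prod.fst_add, Prod.snd_add,
    _root_.add_apply, ContinuousLinearMap.map_add]
  ring

theorem omega_smul_left (z : Cot n M) (c : ℝ) (v w : TangentSpace (cotI n) z) :
    omega z (c • v) w = c * omega z v w := by
  simp only [omega_self_eq, stdForm, Prod.smul_fst, Prod.smul_snd,
    _root_.smul_apply, ContinuousLinearMap.map_smul, smul_eq_mul]
  ring

theorem omega_add_right (z : Cot n M) (u v w : TangentSpace (cotI n) z) :
    omega z u (v + w) = omega z u v + omega z u w := by
  rw [omega_antisymm, omega_add_left, omega_antisymm z v, omega_antisymm z w]; ring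

theorem omega_smul_right (z : Cot n M) (c : ℝ) (v w : TangentSpace (cotI n) z) :
    omega z v (c • w) = c * omega z v w := by
  rw [omega_antisymm, omega_smul_left, omega_antisymm z w]; ring

theorem omega_neg_left (z : Cot n M) (v w : TangentSpace (cotI n) z) :
    omega z (-v) w = -omega z v w := by
  rw [← neg_one_smul ℝ v, omega_smul_left]; ring

theorem omega_neg_right (z : Cot n M) (v w : TangentSpace (cotI n) z) :
    omega z v (-w) = -omega z v w := by
  rw [← neg_one_smul ℝ w, omega_smul_right]; ring

theorem omega_sub_right (z : Cot n M) (u v w : TangentSpace (cotI n) z) :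
    omega z u (v - w) = omega z u v - omega z u w := by
  rw [sub_eq_add_neg, omega_add_right, omega_neg_right]; ring

theorem omega_zero_left (z : Cot n M) (w : TangentSpace (cotI n) z) : omega z 0 w = 0 := by
  simpa using omega_smul_left z 0 0 w

theorem omega_zero_right (z : Cot n M) (w : TangentSpace (cotI n) z) : omega z w 0 = 0 := by
  simpa using omega_smul_right z 0 w 0

theorem liouville_add (z : Cot n M) (v w : TangentSpace (cotI n) z) :
    liouville z (v + w) = liouville z v + liouville z w := by
  simp only [liouville_eq (mem_dom_self z), Prod.fst_add,
    ContinuousLinearMap.map_add]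

theorem liouville_smul (z : Cot n M) (c : ℝ) (v : TangentSpace (cotI n) z) :
    liouville z (c • v) = c * liouville z v := by
  simp only [liouville_eq (mem_dom_self z), Prod.smul_fst,
    ContinuousLinearMap.map_smul, smul_eq_mul]

theorem liouville_zero (z : Cot n M) : liouville z 0 = 0 := by
  simpa using liouville_smul z 0 0

theorem liouville_neg (z : Cot n M) (v : TangentSpace (cotI n) z) :
    liouville z (-v) = -liouville z v := by
  rw [← neg_one_smul ℝ v, liouville_smul]; ring

theorem liouville_sub (z : Cot n M) (v w : TangentSpace (cotI n) z) :
    liouville z (v - w) = liouville z v - liouville z w := by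
  rw [sub_eq_add_neg, liouville_add, liouville_neg]; ring

theorem dfun_add (F : Cot n M → ℝ) (z : Cot n M) (v w : TangentSpace (cotI n) z) :
    dfun F z (v + w) = dfun F z v + dfun F z w := by
  exact ContinuousLinearMap.map_add (mfderiv (cotI n) 𝓘(ℝ, ℝ) F z) v w

theorem dfun_smul (F : Cot n M → ℝ) (z : Cot n M) (c : ℝ) (v : TangentSpace (cotI n) z) :
    dfun F z (c • v) = c * dfun F z v := by
  exact ContinuousLinearMap.map_smul (mfderiv (cotI n) 𝓘(ℝ, ℝ) F z) c v

theorem dfun_zero (F : Cot n M → ℝ) (z : Cot n M) : dfun F z 0 = 0 := by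
  exact ContinuousLinearMap.map_zero (mfderiv (cotI n) 𝓘(ℝ, ℝ) F z)

theorem dfun_neg (F : Cot n M → ℝ) (z : Cot n M) (v : TangentSpace (cotI n) z) :
    dfun F z (-v) = -dfun F z v := by
  exact ContinuousLinearMap.map_neg (mfderiv (cotI n) 𝓘(ℝ, ℝ) F z) v

instance instAddCommGroupDual : AddCommGroup (CotVec n →L[ℝ] ℝ) :=
  ContinuousLinearMap.addCommGroup

instance instFiniteDimensionalDual : FiniteDimensional ℝ (CotVec n →L[ℝ] ℝ) :=
  (LinearMap.toContinuousLinearMap : (CotVec n →ₗ[ℝ] ℝ) ≃ₗ[ℝ] _).finiteDimensional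

/-- The linear map `v ↦ ω(v, ·)` from the model space to its dual. -/
def stdFlatAux : CotVec n →ₗ[ℝ] (CotVec n →L[ℝ] ℝ) where
  toFun v := v.2.comp (ContinuousLinearMap.fst ℝ _ _)
    - (ContinuousLinearMap.apply ℝ ℝ v.1).comp (ContinuousLinearMap.snd ℝ _ _)
  map_add' u v := ContinuousLinearMap.ext fun w => by
    change (u.2 + v.2) w.1 - w.2 (u.1 + v.1) = (u.2 w.1 - w.2 u.1) + (v.2 w.1 - w.2 v.1)
    rw [ContinuousLinearMap.map_add, _root_.add_apply]; ring
  map_smul' c v := ContinuousLinearMap.ext fun w => by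
    change (c • v.2) w.1 - w.2 (c • v.1) = c * (v.2 w.1 - w.2 v.1)
    rw [ContinuousLinearMap.map_smul, _root_.smul_apply, smul_eq_mul, smul_eq_mul]; ring

theorem stdFlatAux_apply (v w : CotVec n) : stdFlatAux v w = stdForm v w := rfl

theorem stdFlatAux_injective : Function.Injective (stdFlatAux (n := n)) := by
  refine (injective_iff_map_eq_zero _).2 fun v hv => ?_
  have h (w : CotVec n) : stdForm v w = 0 := by rw [← stdFlatAux_apply, hv]; rfl
  refine Prod.ext ?_ ?_
  · by_contra hne
    have := h (0, innerSL ℝ v.1)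
    simp [stdForm] at this
    exact hne this
  · ext w
    simpa [stdForm] using h (w, 0)

/-- The isomorphism `v ↦ ω(v, ·)` of the model space with its dual. -/
def stdFlat : CotVec n ≃L[ℝ] (CotVec n →L[ℝ] ℝ) :=
  (LinearEquiv.ofInjectiveOfFinrankEq stdFlatAux stdFlatAux_injective (by
    rw [← (LinearMap.toContinuousLinearMap : (CotVec n →ₗ[ℝ] ℝ) ≃ₗ[ℝ] _).finrank_eq]
    exact (Subspace.dual_finrank_eq (K := ℝ) (V := CotVec n)).symm)).toContinuousLinearEquiv

theorem stdFlat_apply (v w : CotVec n) : stdFlat v w = stdForm v w := rfl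

theorem stdForm_stdFlat_symm (β : CotVec n →L[ℝ] ℝ) (w : CotVec n) :
    stdForm (stdFlat.symm β) w = β w := by
  rw [← stdFlat_apply, ContinuousLinearEquiv.apply_symm_apply]

theorem omega_nondegenerate {z : Cot n M} {v : TangentSpace (cotI n) z}
    (h : ∀ w, omega z v w = 0) : v = 0 := by
  apply dco_injective (mem_dom_self z)
  rw [dco_zero]
  apply stdFlat.injective
  refine ContinuousLinearMap.ext fun w => ?_
  obtain ⟨w', rfl⟩ := dco_surjective (mem_dom_self z) w
  rw [stdFlat_apply, ← omega_self_eq, h]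
  exact (DFunLike.congr_fun stdFlat.toLinearEquiv.map_zero _).symm

/-- The defining equation of the Hamiltonian vector field. -/
theorem omega_hamVF_left (F : Cot n M → ℝ) (z : Cot n M) (w : TangentSpace (cotI n) z) :
    omega z (hamVF F z) w = -dfun F z w := by
  suffices h : ∃ v : TangentSpace (cotI n) z, ∀ w, omega z v w = - dfun F z w from
    Classical.epsilon_spec h w
  let e : TangentSpace (cotI n) z ≃ₗ[ℝ] CotVec n :=
    LinearEquiv.ofBijective (dco z z).toLinearMap
      ⟨dco_injective (mem_dom_self z), dco_surjective (mem_dom_self z)⟩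
  let β : CotVec n →ₗ[ℝ] ℝ :=
    -((mfderiv (cotI n) 𝓘(ℝ, ℝ) F z : TangentSpace (cotI n) z →L[ℝ] ℝ).toLinearMap ∘ₗ
      e.symm.toLinearMap)
  obtain ⟨v, hv⟩ := dco_surjective (mem_dom_self z)
    (stdFlat.symm (LinearMap.toContinuousLinearMap β))
  refine ⟨v, fun w => ?_⟩
  rw [omega_self_eq, hv, stdForm_stdFlat_symm]
  change -(mfderiv (cotI n) 𝓘(ℝ, ℝ) F z (e.symm (e w))) = _
  rw [LinearEquiv.symm_apply_apply]
  rfl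

theorem omega_hamVF_right (F : Cot n M → ℝ) (z : Cot n M) (v : TangentSpace (cotI n) z) :
    omega z v (hamVF F z) = dfun F z v := by
  rw [omega_antisymm, omega_hamVF_left, neg_neg]

theorem dfun_hamVF_self (F : Cot n M → ℝ) (z : Cot n M) : dfun F z (hamVF F z) = 0 := by
  rw [← omega_hamVF_right, omega_self]

theorem hamVF_eq_zero {F : Cot n M → ℝ} {z : Cot n M} (h : ∀ w, dfun F z w = 0) :
    hamVF F z = 0 :=
  omega_nondegenerate fun w => by rw [omega_hamVF_left, h, neg_zero]

theorem hamVF_eq_zero_of_eventually {F : Cot n M → ℝ} {z : Cot n M} (h : ∀ᶠ y in 𝓝 z, F y = 0) :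
    hamVF F z = 0 := by
  refine hamVF_eq_zero fun w => ?_
  have h1 : F =ᶠ[𝓝 z] fun _ => (0 : ℝ) := h
  rw [dfun, h1.mfderiv_eq, mfderiv_const]
  rfl

/-! ### Smoothness of maps into `T*M` and its tangent bundle -/

section Smoothness

variable {EN HN N : Type*} [NormedAddCommGroup EN] [NormedSpace ℝ EN] [TopologicalSpace HN]
  {IN : ModelWithCorners ℝ EN HN} [TopologicalSpace N] [ChartedSpace HN N]

theorem contMDiffAt_of_co {f : N → Cot n M} {z₀ : Cot n M} {x : N}
    (hz : ∀ᶠ y in 𝓝 x, f y ∈ dom z₀)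
    (h : ContMDiffAt IN 𝓘(ℝ, CotVec n) ∞ (fun y => co z₀ (f y)) x) :
    ContMDiffAt IN (cotI n) ∞ f x := by
  have h1 : ContMDiffAt IN (cotI n) ∞ (fun y => coInv z₀ (co z₀ (f y))) x :=
    ContMDiffAt.comp x (contMDiffAt_coInv (co_mem hz.self_of_nhds)) h
  exact h1.congr_of_eventuallyEq (hz.mono fun y hy => (coInv_co hy).symm)

theorem trivializationAt_tangent_snd {z₀ z : Cot n M} (hz : z ∈ dom z₀)
    (v : TangentSpace (cotI n) z) :
    (trivializationAt (CotVec n) (TangentSpace (cotI n)) z₀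
      (⟨z, v⟩ : TangentBundle (cotI n) (Cot n M))).2 = dco z₀ z v := by
  have hs := mem_chart_source hz
  have hb : z ∈ (trivializationAt (CotVec n) (TangentSpace (cotI n)) z₀).baseSet := by
    rwa [TangentBundle.trivializationAt_baseSet]
  have h := TangentBundle.continuousLinearMapAt_trivializationAt (I := cotI n) hs
  have h2 := (trivializationAt (CotVec n) (TangentSpace (cotI n)) z₀).coe_linearMapAt_of_mem
    (R := ℝ) hb
  exact (congrFun h2 v).symm.trans (DFunLike.congr_fun h v)

theorem contMDiffAt_tangentBundle {f : N → TangentBundle (cotI n) (Cot n M)} {x : N}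
    (hf : ContMDiffAt IN (cotI n) ∞ (fun y => (f y).1) x)
    (h : ContMDiffAt IN 𝓘(ℝ, CotVec n) ∞ (fun y => dco (f x).1 (f y).1 (f y).2) x) :
    ContMDiffAt IN (cotI n).tangent ∞ f x := by
  refine Bundle.contMDiffAt_totalSpace.2 ⟨hf, h.congr_of_eventuallyEq ?_⟩
  filter_upwards [hf.continuousAt.preimage_mem_nhds (dom_mem_nhds (mem_dom_self _))] with y hy
  exact trivializationAt_tangent_snd hy _

theorem contMDiffAt_dco (p : TangentBundle (cotI n) (Cot n M)) :
    ContMDiffAt (cotI n).tangent 𝓘(ℝ, CotVec n) ∞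
      (fun q : TangentBundle (cotI n) (Cot n M) => dco p.1 q.1 q.2) p := by
  have h := Bundle.contMDiffAt_totalSpace.1
    (contMDiffAt_id : ContMDiffAt (cotI n).tangent (cotI n).tangent ∞ id p)
  refine h.2.congr_of_eventuallyEq ?_
  filter_upwards [h.1.continuousAt.preimage_mem_nhds (dom_mem_nhds (mem_dom_self _))] with y hy
  exact (trivializationAt_tangent_snd hy _).symm

theorem contMDiff_tangentProj :
    ContMDiff (cotI n).tangent (cotI n) ∞ (fun q : TangentBundle (cotI n) (Cot n M) => q.1) :=
  Bundle.contMDiff_proj _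

theorem eventually_mem_dom_tangent (p : TangentBundle (cotI n) (Cot n M)) :
    ∀ᶠ q : TangentBundle (cotI n) (Cot n M) in 𝓝 p, q.1 ∈ dom p.1 :=
  (contMDiff_tangentProj p).continuousAt.preimage_mem_nhds (dom_mem_nhds (mem_dom_self _))

theorem contMDiff_liouville : ContMDiff (cotI n).tangent 𝓘(ℝ, ℝ) ∞
    (fun q : TangentBundle (cotI n) (Cot n M) => liouville q.1 q.2) := by
  intro p
  have h1 : ContMDiffAt (cotI n).tangent 𝓘(ℝ, CotVec n) ∞
      (fun q : TangentBundle (cotI n) (Cot n M) => co p.1 q.1) p :=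
    ContMDiffAt.comp p (contMDiffAt_co (mem_dom_self _)) (contMDiff_tangentProj p)
  have h2 : ContDiff ℝ ∞ (fun w : CotVec n × CotVec n => w.1.2 w.2.1) :=
    contDiff_fst.snd.clm_apply contDiff_snd.fst
  have h3 := h2.contDiffAt.contMDiffAt.comp p (h1.prodMk_space (contMDiffAt_dco p))
  exact h3.congr_of_eventuallyEq ((eventually_mem_dom_tangent p).mono fun q hq => liouville_eq hq _)

/-- The differential of a function on `T*M` in natural coordinates. -/
theorem mfderiv_eq_fderiv_coInv {W : Type*} [NormedAddCommGroup W] [NormedSpace ℝ W]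
    {F : Cot n M → W} {z₀ z : Cot n M} (hz : z ∈ dom z₀)
    (hF : MDifferentiableAt (cotI n) 𝓘(ℝ, W) F z) (v : TangentSpace (cotI n) z) :
    mfderiv (cotI n) 𝓘(ℝ, W) F z v = fderiv ℝ (fun y => F (coInv z₀ y)) (co z₀ z) (dco z₀ z v) := by
  have h1 : MDifferentiableAt 𝓘(ℝ, CotVec n) 𝓘(ℝ, W) (fun y => F (coInv z₀ y)) (co z₀ z) := by
    refine MDifferentiableAt.comp (I' := cotI n) (co z₀ z) ?_ (mdifferentiableAt_coInv (co_mem hz))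
    rwa [coInv_co hz]
  have h2 : HasMFDerivAt (cotI n) 𝓘(ℝ, W) ((fun y => F (coInv z₀ y)) ∘ co z₀) z
      ((fderiv ℝ (fun y => F (coInv z₀ y)) (co z₀ z)).comp (dco z₀ z)) :=
    HasMFDerivAt.comp z h1.differentiableAt.hasFDerivAt.hasMFDerivAt (hasMFDerivAt_co hz)
  have h3 : F =ᶠ[𝓝 z] (fun y => F (coInv z₀ y)) ∘ co z₀ :=
    Filter.eventually_of_mem (dom_mem_nhds hz) fun y hy => by simp [coInv_co hy]
  exact DFunLike.congr_fun (h2.congr_of_eventuallyEq h3).mfderiv v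

theorem contMDiffAt_comp_coInv {W : Type*} [NormedAddCommGroup W] [NormedSpace ℝ W]
    {F : Cot n M → W} {z₀ z : Cot n M} (hz : z ∈ dom z₀)
    (hF : ContMDiffAt (cotI n) 𝓘(ℝ, W) ∞ F z) :
    ContDiffAt ℝ ∞ (fun y => F (coInv z₀ y)) (co z₀ z) := by
  refine ContMDiffAt.contDiffAt (ContMDiffAt.comp (I' := cotI n) (co z₀ z) ?_
    (contMDiffAt_coInv (co_mem hz)))
  rwa [coInv_co hz]

/-- The differential of a smooth function is a smooth function on the tangent bundle. -/
theorem contMDiff_dfun {F : Cot n M → ℝ} (hF : ContMDiff (cotI n) 𝓘(ℝ, ℝ) ∞ F) :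
    ContMDiff (cotI n).tangent 𝓘(ℝ, ℝ) ∞
      (fun q : TangentBundle (cotI n) (Cot n M) => dfun F q.1 q.2) := by
  intro p
  have h1 : ContMDiffAt (cotI n).tangent 𝓘(ℝ, CotVec n) ∞
      (fun q : TangentBundle (cotI n) (Cot n M) => co p.1 q.1) p :=
    ContMDiffAt.comp p (contMDiffAt_co (mem_dom_self _)) (contMDiff_tangentProj p)
  have h2 : ContDiffAt ℝ ∞ (fun w : CotVec n × CotVec n =>
      fderiv ℝ (fun y => F (coInv p.1 y)) w.1 w.2) (co p.1 p.1, dco p.1 p.1 p.2) := by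
    have h := (contMDiffAt_comp_coInv (mem_dom_self p.1) (hF p.1)).fderiv_right
      (m := ∞) (by simp)
    exact h.fst'.clm_apply contDiffAt_snd
  have h3 := ContMDiffAt.comp (I' := 𝓘(ℝ, CotVec n × CotVec n)) p h2.contMDiffAt
    (h1.prodMk_space (contMDiffAt_dco p))
  exact h3.congr_of_eventuallyEq ((eventually_mem_dom_tangent p).mono fun q hq =>
    mfderiv_eq_fderiv_coInv hq ((hF q.1).mdifferentiableAt (by simp)) q.2)

end Smoothness

/-- The linear map that sends `dF` to the Hamiltonian vector in the model space. -/
def hamLin : (CotVec n →L[ℝ] ℝ) →L[ℝ] CotVec n :=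
  -(stdFlat (n := n)).symm.toContinuousLinearMap

theorem stdForm_hamLin (β : CotVec n →L[ℝ] ℝ) (w : CotVec n) : stdForm (hamLin β) w = -β w := by
  rw [← stdForm_stdFlat_symm β w]
  change (-(stdFlat.symm β)).2 w.1 - w.2 (-(stdFlat.symm β)).1 = _
  rw [Prod.snd_neg, Prod.fst_neg, ContinuousLinearMap.map_neg, _root_.neg_apply, stdForm]
  ring

theorem stdForm_ext {v v' : CotVec n} (h : ∀ w, stdForm v w = stdForm v' w) : v = v' :=
  stdFlat.injective (ContinuousLinearMap.ext h)

theorem dco_hamVF {F : Cot n M → ℝ} {z₀ z : Cot n M} (hz : z ∈ dom z₀)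
    (hF : MDifferentiableAt (cotI n) 𝓘(ℝ, ℝ) F z) :
    dco z₀ z (hamVF F z) = hamLin (fderiv ℝ (fun y => F (coInv z₀ y)) (co z₀ z)) := by
  refine stdForm_ext fun w => ?_
  obtain ⟨w', rfl⟩ := dco_surjective hz w
  rw [← omega_eq hz, omega_hamVF_left, stdForm_hamLin]
  exact congrArg Neg.neg (mfderiv_eq_fderiv_coInv hz hF w')

theorem contDiffAt_partial_fderiv {V V' : Type*} [NormedAddCommGroup V] [NormedSpace ℝ V]
    [NormedAddCommGroup V'] [NormedSpace ℝ V'] {G : ℝ × V → ℝ} {p : ℝ × V}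
    (hG : ContDiffAt ℝ ∞ G p) (L : (V →L[ℝ] ℝ) →L[ℝ] V') :
    ContDiffAt ℝ ∞ (fun w : ℝ × V => L ((fderiv ℝ G w).comp (ContinuousLinearMap.inr ℝ ℝ V))) p :=
  L.contDiff.contDiffAt.comp _ ((hG.fderiv_right (m := ∞) (by simp)).clm_comp contDiffAt_const)

theorem fderiv_partial {V : Type*} [NormedAddCommGroup V] [NormedSpace ℝ V] {G : ℝ × V → ℝ}
    {p : ℝ × V} (hG : DifferentiableAt ℝ G p) :
    (fderiv ℝ G p).comp (ContinuousLinearMap.inr ℝ ℝ V) = fderiv ℝ (fun y => G (p.1, y)) p.2 := by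
  have h8 : HasFDerivAt (fun y : V => (p.1, y)) (ContinuousLinearMap.inr ℝ ℝ V) p.2 :=
    (hasFDerivAt_const p.1 _).prodMk (hasFDerivAt_id _)
  exact (hG.hasFDerivAt.comp p.2 h8).fderiv.symm

/-- Hamiltonian vector fields depend smoothly on the point and on parameters. -/
theorem contMDiff_hamVF {G : ℝ → Cot n M → ℝ}
    (hG : ContMDiff (𝓘(ℝ, ℝ).prod (cotI n)) 𝓘(ℝ, ℝ) ∞ (fun p : ℝ × Cot n M => G p.1 p.2)) :
    ContMDiff (𝓘(ℝ, ℝ).prod (cotI n)) (cotI n).tangent ∞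
      (fun p : ℝ × Cot n M => (⟨p.2, hamVF (G p.1) p.2⟩ : TangentBundle (cotI n) (Cot n M))) := by
  rintro ⟨t, z⟩
  refine contMDiffAt_tangentBundle contMDiffAt_snd ?_
  change ContMDiffAt _ _ _ (fun p : ℝ × Cot n M => dco z p.2 (hamVF (G p.1) p.2)) (t, z)
  have h0 : ContDiffAt ℝ ∞ (fun w : ℝ × CotVec n => G w.1 (coInv z w.2)) (t, co z z) := by
    refine ContMDiffAt.contDiffAt ?_
    rw [modelWithCornersSelf_prod, ← chartedSpaceSelf_prod]
    have h1 : ContMDiffAt (𝓘(ℝ, ℝ).prod 𝓘(ℝ, CotVec n)) (𝓘(ℝ, ℝ).prod (cotI n)) ∞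
        (fun w : ℝ × CotVec n => (w.1, coInv z w.2)) (t, co z z) :=
      contMDiffAt_fst.prodMk (ContMDiffAt.comp (t, co z z)
        (contMDiffAt_coInv (co_mem (mem_dom_self z))) contMDiffAt_snd)
    exact ContMDiffAt.comp (t, co z z) (hG _) h1
  have h1 := contDiffAt_partial_fderiv h0 hamLin
  have h2 : ContMDiffAt (𝓘(ℝ, ℝ).prod (cotI n)) 𝓘(ℝ, ℝ × CotVec n) ∞
      (fun p : ℝ × Cot n M => (p.1, co z p.2)) (t, z) :=
    contMDiffAt_fst.prodMk_space (ContMDiffAt.comp (t, z)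
      (contMDiffAt_co (mem_dom_self z)) contMDiffAt_snd)
  have h3 := ContMDiffAt.comp (I' := 𝓘(ℝ, ℝ × CotVec n)) (t, z) h1.contMDiffAt h2
  refine h3.congr_of_eventuallyEq ?_
  have h4 : ∀ᶠ p : ℝ × Cot n M in 𝓝 (t, z), p.2 ∈ dom z :=
    continuousAt_snd.preimage_mem_nhds (dom_mem_nhds (mem_dom_self z))
  have h5 := (h0.of_le (m := 1) (by simp)).eventually (by simp)
  have h6 := h2.continuousAt.eventually h5
  filter_upwards [h4, h6] with p hp hp'
  have hGp : MDifferentiableAt (cotI n) 𝓘(ℝ, ℝ) (G p.1) p.2 := by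
    have h7 : ContMDiffAt (cotI n) (𝓘(ℝ, ℝ).prod (cotI n)) ∞
      (fun y : Cot n M => (p.1, y)) p.2 := contMDiffAt_const.prodMk contMDiffAt_id
    exact (ContMDiffAt.comp p.2 (hG (p.1, p.2)) h7).mdifferentiableAt (by simp)
  rw [dco_hamVF hp hGp]
  exact congrArg hamLin (fderiv_partial (hp'.differentiableAt (by simp))).symm

/-! ### Curves in `T*M` and the Liouville vector field -/

theorem hasDerivAt_comp_curve {W : Type*} [NormedAddCommGroup W] [NormedSpace ℝ W]
    {Φ : Cot n M → W} {γ : ℝ → Cot n M} {t : ℝ}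
    (hΦ : MDifferentiableAt (cotI n) 𝓘(ℝ, W) Φ (γ t))
    (hγ : MDifferentiableAt 𝓘(ℝ, ℝ) (cotI n) γ t) :
    HasDerivAt (fun τ => Φ (γ τ)) (mfderiv (cotI n) 𝓘(ℝ, W) Φ (γ t) (vel (cotI n) γ t)) t := by
  let L : ℝ →L[ℝ] W := (mfderiv (cotI n) 𝓘(ℝ, W) Φ (γ t)).comp (mfderiv 𝓘(ℝ, ℝ) (cotI n) γ t)
  have h : HasFDerivAt (fun τ => Φ (γ τ)) L t :=
    (hΦ.hasMFDerivAt.comp t hγ.hasMFDerivAt).hasFDerivAt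
  exact h.hasDerivAt

theorem hasDerivAt_co_curve {γ : ℝ → Cot n M} {t : ℝ}
    (hγ : MDifferentiableAt 𝓘(ℝ, ℝ) (cotI n) γ t) {z₀ : Cot n M} (hz : γ t ∈ dom z₀) :
    HasDerivAt (fun τ => co z₀ (γ τ)) (dco z₀ (γ t) (vel (cotI n) γ t)) t :=
  hasDerivAt_comp_curve (mdifferentiableAt_co hz) hγ

/-- A curve whose velocity vanishes as long as it stays in an open set, and that visits this
open set, is constant. -/
theorem curve_const_of_vel_eq_zero [T2Space M] {γ : ℝ → Cot n M}
    (hγ : MDifferentiable 𝓘(ℝ, ℝ) (cotI n) γ) {O : Set (Cot n M)} (hO : IsOpen O)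
    (h : ∀ t, γ t ∈ O → vel (cotI n) γ t = 0) {t₀ : ℝ} (ht₀ : γ t₀ ∈ O) (t : ℝ) :
    γ t = γ t₀ := by
  have hc : Continuous γ := hγ.continuous
  have hclosed : IsClosed {t | γ t = γ t₀} := isClosed_eq hc continuous_const
  have hopen : IsOpen {t | γ t = γ t₀} := by
    rw [Metric.isOpen_iff]
    intro s hs
    have h1 : γ ⁻¹' (O ∩ dom (γ t₀)) ∈ 𝓝 s := by
      refine hc.continuousAt.preimage_mem_nhds ((hO.inter (isOpen_dom _)).mem_nhds ?_)
      rw [show γ s = γ t₀ from hs]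
      exact ⟨ht₀, mem_dom_self _⟩
    obtain ⟨ε, hε, hball⟩ := Metric.mem_nhds_iff.1 h1
    refine ⟨ε, hε, fun τ hτ => ?_⟩
    have h2 (σ : ℝ) (hσ : σ ∈ Metric.ball s ε) :
        HasDerivAt (fun τ => co (γ t₀) (γ τ)) 0 σ := by
      have := hasDerivAt_co_curve (hγ σ) (hball hσ).2
      rwa [h σ (hball hσ).1, dco_zero] at this
    have h3 := (convex_ball s ε).is_const_of_fderivWithin_eq_zero (𝕜 := ℝ)
      (f := fun τ => co (γ t₀) (γ τ))
      (fun σ hσ => (h2 σ hσ).differentiableAt.differentiableWithinAt)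
      (fun σ hσ => by
        rw [fderivWithin_of_isOpen Metric.isOpen_ball hσ]
        have := (h2 σ hσ).hasFDerivAt.fderiv
        rw [this, ContinuousLinearMap.toSpanSingleton_zero]) hτ (Metric.mem_ball_self hε)
    have h4 : co (γ t₀) (γ τ) = co (γ t₀) (γ s) := h3
    change γ τ = γ t₀
    rw [← coInv_co (hball hτ).2, h4, show γ s = γ t₀ from hs, coInv_co (mem_dom_self _)]
  have huniv := IsClopen.eq_univ ⟨hclosed, hopen⟩ ⟨t₀, rfl⟩
  exact Set.eq_univ_iff_forall.1 huniv t

theorem contMDiff_fibreScale : ContMDiff (𝓘(ℝ, ℝ).prod (cotI n)) (cotI n) ∞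
    (fun p : ℝ × Cot n M => fibreScale p.1 p.2) := by
  rintro ⟨c, z⟩
  have h4 : ∀ᶠ p : ℝ × Cot n M in 𝓝 (c, z), p.2 ∈ dom z :=
    continuousAt_snd.preimage_mem_nhds (dom_mem_nhds (mem_dom_self z))
  refine contMDiffAt_of_co (z₀ := z) (h4.mono fun p hp => (fibreScale_mem_dom _).2 hp) ?_
  simp only [co_fibreScale]
  have h2 : ContMDiffAt (𝓘(ℝ, ℝ).prod (cotI n)) 𝓘(ℝ, ℝ × CotVec n) ∞
      (fun p : ℝ × Cot n M => (p.1, co z p.2)) (c, z) :=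
    contMDiffAt_fst.prodMk_space (ContMDiffAt.comp (c, z)
      (contMDiffAt_co (mem_dom_self z)) contMDiffAt_snd)
  have h3 : ContDiff ℝ ∞ (fun w : ℝ × CotVec n => (w.2.1, w.1 • w.2.2)) :=
    contDiff_snd.fst.prodMk (contDiff_fst.smul contDiff_snd.snd)
  exact ContMDiffAt.comp (I' := 𝓘(ℝ, ℝ × CotVec n)) (c, z) h3.contDiffAt.contMDiffAt h2

theorem contMDiff_fibreScale_left (z : Cot n M) :
    ContMDiff 𝓘(ℝ, ℝ) (cotI n) ∞ (fun c : ℝ => fibreScale c z) :=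
  contMDiff_fibreScale.comp (contMDiff_id.prodMk contMDiff_const)

theorem contMDiff_fibreScale_right (c : ℝ) :
    ContMDiff (cotI n) (cotI n) ∞ (fun z : Cot n M => fibreScale c z) :=
  contMDiff_fibreScale.comp (contMDiff_const.prodMk contMDiff_id)

theorem contMDiff_liouvilleFlow (τ : ℝ) :
    ContMDiff (cotI n) (cotI n) ∞ (liouvilleFlow τ : Cot n M → Cot n M) :=
  contMDiff_fibreScale_right _

theorem fibreScale_one (z : Cot n M) : fibreScale 1 z = z := by
  rw [fibreScale, one_smul]

theorem fibreScale_fibreScale (c d : ℝ) (z : Cot n M) :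
    fibreScale c (fibreScale d z) = fibreScale (c * d) z := by
  rw [fibreScale, fibreScale, fibreScale, mul_smul]

/-- Tangent vectors at equal points can be compared without transport, as all tangent spaces are
copies of the model space. -/
theorem dco_congr_point {z₀ z z' : Cot n M} (h : z' = z) (v : CotVec n) :
    dco z₀ z' v = dco z₀ z v := by
  subst h; rfl

theorem dco_vel_fibreScale {z₀ z : Cot n M} (hz : z ∈ dom z₀) (c : ℝ) :
    dco z₀ (fibreScale c z) (vel (cotI n) (fun c : ℝ => fibreScale c z) c)
      = (0, (co z₀ z).2) := by
  have h1 := (contMDiff_fibreScale_left z).mdifferentiable (by simp) c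
  have h := dco_vel (γ := fun c : ℝ => fibreScale c z) h1
    (z₀ := z₀) (by rwa [fibreScale_mem_dom])
  simp only [co_fibreScale] at h
  refine h.trans (HasDerivAt.deriv ?_)
  have := (hasDerivAt_const c (co z₀ z).1).prodMk ((hasDerivAt_id c).smul_const (co z₀ z).2)
  simpa using this

/-- The Liouville vector field is `p ∂_p` in natural coordinates. -/
theorem dco_liouvilleVF {z₀ z : Cot n M} (hz : z ∈ dom z₀) :
    dco z₀ z (liouvilleVF z) = (0, (co z₀ z).2) :=
  (dco_congr_point (fibreScale_one z)
    (vel (cotI n) (fun c : ℝ => fibreScale c z) 1)).symm.trans (dco_vel_fibreScale hz 1)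

theorem vel_fibreScale {c : ℝ} (z : Cot n M) :
    c • vel (cotI n) (fun c : ℝ => fibreScale c z) c = liouvilleVF (fibreScale c z) := by
  have hz : fibreScale c z ∈ dom z := by rw [fibreScale_mem_dom]; exact mem_dom_self z
  apply dco_injective hz
  rw [dco_liouvilleVF hz, dco_smul, dco_vel_fibreScale (mem_dom_self z), co_fibreScale]
  simp

theorem omega_liouvilleVF (z : Cot n M) (v : TangentSpace (cotI n) z) :
    omega z (liouvilleVF z) v = liouville z v := by
  rw [omega_self_eq, liouville_eq (mem_dom_self z), dco_liouvilleVF (mem_dom_self z), stdForm]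
  simp

theorem liouville_liouvilleVF (z : Cot n M) : liouville z (liouvilleVF z) = 0 := by
  rw [← omega_liouvilleVF, omega_self]

theorem contMDiff_liouvilleVF : ContMDiff (cotI n) (cotI n).tangent ∞
    (fun z : Cot n M => (⟨z, liouvilleVF z⟩ : TangentBundle (cotI n) (Cot n M))) := by
  intro z
  refine contMDiffAt_tangentBundle contMDiffAt_id ?_
  have h3 : ContDiff ℝ ∞ (fun w : CotVec n => ((0, w.2) : CotVec n)) :=
    contDiff_const.prodMk contDiff_snd
  have h4 := ContMDiffAt.comp z h3.contDiffAt.contMDiffAt (contMDiffAt_co (mem_dom_self z))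
  refine h4.congr_of_eventuallyEq ?_
  filter_upwards [dom_mem_nhds (mem_dom_self z)] with y hy
  exact dco_liouvilleVF hy

theorem contMDiff_vel {x : ℝ → Cot n M} (hx : ContMDiff 𝓘(ℝ, ℝ) (cotI n) ∞ x) :
    ContMDiff 𝓘(ℝ, ℝ) (cotI n).tangent ∞ (fun t : ℝ =>
      (⟨x t, vel (cotI n) x t⟩ : TangentBundle (cotI n) (Cot n M))) := by
  intro t
  refine contMDiffAt_tangentBundle (hx _) ?_
  have h0 : ContDiffAt ℝ ∞ (fun q => co (x t) (x q)) t :=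
    (ContMDiffAt.comp t (contMDiffAt_co (mem_dom_self _)) (hx t)).contDiffAt
  have h1 : ContDiffAt ℝ ∞ (fun p => fderiv ℝ (fun q => co (x t) (x q)) p 1) t :=
    (h0.fderiv_right (m := ∞) (by simp)).clm_apply contDiffAt_const
  refine h1.contMDiffAt.congr_of_eventuallyEq ?_
  filter_upwards [hx.continuous.continuousAt.preimage_mem_nhds
    (dom_mem_nhds (mem_dom_self (x t)))] with p hp
  exact dco_vel ((hx p).mdifferentiableAt (by simp)) hp

/-! ### The first variation of the action -/

theorem continuous_fderiv_apply {g : ℝ × ℝ → ℝ} (hg : ContDiff ℝ ∞ g) (v : ℝ × ℝ) :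
    Continuous (fun p => fderiv ℝ g p v) :=
  (hg.continuous_fderiv (by simp)).clm_apply continuous_const

theorem hasDerivAt_fst {g : ℝ × ℝ → ℝ} (hg : ContDiff ℝ ∞ g) (s t : ℝ) :
    HasDerivAt (fun σ => g (σ, t)) (fderiv ℝ g (s, t) (1, 0)) s :=
  ((hg.differentiable (by simp)) (s, t)).hasFDerivAt.comp_hasDerivAt s
    ((hasDerivAt_id s).prodMk (hasDerivAt_const s t))

theorem hasDerivAt_snd {g : ℝ × ℝ → ℝ} (hg : ContDiff ℝ ∞ g) (s t : ℝ) :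
    HasDerivAt (fun τ => g (s, τ)) (fderiv ℝ g (s, t) (0, 1)) t :=
  ((hg.differentiable (by simp)) (s, t)).hasFDerivAt.comp_hasDerivAt t
    ((hasDerivAt_const t s).prodMk (hasDerivAt_id t))

theorem continuous_slice {g : ℝ × ℝ → ℝ} (hg : Continuous g) (s : ℝ) :
    Continuous (fun t => g (s, t)) := hg.comp (by fun_prop)

theorem hasDerivAt_integral_slice {g : ℝ × ℝ → ℝ} (hg : ContDiff ℝ ∞ g) (s : ℝ) :
    HasDerivAt (fun σ => ∫ t in (0 : ℝ)..1, g (σ, t))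
      (∫ t in (0 : ℝ)..1, fderiv ℝ g (s, t) (1, 0)) s := by
  have hc := continuous_fderiv_apply hg (1, 0)
  obtain ⟨C, hC⟩ := ((isCompact_closedBall s 1).prod (isCompact_Icc (a := (0 : ℝ)) (b := 1))
    ).exists_bound_of_continuousOn hc.continuousOn
  refine (intervalIntegral.hasDerivAt_integral_of_dominated_loc_of_deriv_le
    (F := fun σ t => g (σ, t)) (F' := fun σ t => fderiv ℝ g (σ, t) (1, 0))
    (bound := fun _ => C) (Metric.closedBall_mem_nhds s one_pos)
    (Filter.Eventually.of_forall fun σ =>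
      (continuous_slice hg.continuous σ).aestronglyMeasurable)
    ((continuous_slice hg.continuous s).intervalIntegrable _ _)
    (continuous_slice hc s).aestronglyMeasurable
    (Filter.Eventually.of_forall fun t ht σ hσ => hC (σ, t) ⟨hσ, ?_⟩)
    (by simp) (Filter.Eventually.of_forall fun t _ σ _ => hasDerivAt_fst hg σ t)).2
  rw [Set.uIoc_of_le zero_le_one] at ht
  exact ⟨ht.1.le, ht.2⟩

/-- The constituents of `𝔣` are smooth. -/
structure IsSmoothData (𝔣 : Data n M) : Prop where
  F : ContMDiff (cotI n) 𝓘(ℝ, ℝ) ∞ 𝔣.F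
  f : ContDiff ℝ ∞ 𝔣.f
  χ : ContDiff ℝ ∞ 𝔣.χ
  H : ContMDiff (𝓘(ℝ, ℝ).prod (cotI n)) 𝓘(ℝ, ℝ) ∞ (fun p : ℝ × Cot n M => 𝔣.H p.1 p.2)

/-- The vector field `∂ₜx - f(η) χ X_F(x) - X_H(t, x)` along a loop `x`; up to the almost complex
structure it is the loop component of the gradient of the action. -/
def defect (𝔣 : Data n M) (x : ℝ → Cot n M) (η t : ℝ) : TangentSpace (cotI n) (x t) :=
  vel (cotI n) x t - (𝔣.f η * 𝔣.χ t) • hamVF 𝔣.F (x t) - hamVF (𝔣.H t) (x t)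

theorem IsSmoothData.H_slice {𝔣 : Data n M} (h𝔣 : IsSmoothData 𝔣) (t : ℝ) :
    ContMDiff (cotI n) 𝓘(ℝ, ℝ) ∞ (𝔣.H t) :=
  h𝔣.H.comp (contMDiff_const.prodMk contMDiff_id)

section FirstVariation

variable {𝔣 : Data n M} {X : ℝ → ℝ → Cot n M}

theorem contDiff_liouville_vel_snd
    (hX : ContMDiff 𝓘(ℝ, ℝ × ℝ) (cotI n) ∞ (fun p : ℝ × ℝ => X p.1 p.2)) :
    ContDiff ℝ ∞ (fun p : ℝ × ℝ => liouville (X p.1 p.2) (vel (cotI n) (X p.1) p.2)) :=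
  contDiff_iff_contDiffAt.2 fun p => contDiffAt_liouville_vel_snd (s := p.1) (t := p.2) (hX p)

theorem contDiff_liouville_vel_fst
    (hX : ContMDiff 𝓘(ℝ, ℝ × ℝ) (cotI n) ∞ (fun p : ℝ × ℝ => X p.1 p.2)) :
    ContDiff ℝ ∞ (fun p : ℝ × ℝ =>
      liouville (X p.1 p.2) (vel (cotI n) (fun σ => X σ p.2) p.1)) :=
  contDiff_iff_contDiffAt.2 fun p => contDiffAt_liouville_vel_fst (s := p.1) (t := p.2) (hX p)

theorem contDiff_F_family (h𝔣 : IsSmoothData 𝔣)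
    (hX : ContMDiff 𝓘(ℝ, ℝ × ℝ) (cotI n) ∞ (fun p : ℝ × ℝ => X p.1 p.2)) :
    ContDiff ℝ ∞ (fun p : ℝ × ℝ => 𝔣.χ p.2 * 𝔣.F (X p.1 p.2)) :=
  (h𝔣.χ.comp contDiff_snd).mul (h𝔣.F.comp hX).contDiff

theorem contDiff_H_family (h𝔣 : IsSmoothData 𝔣)
    (hX : ContMDiff 𝓘(ℝ, ℝ × ℝ) (cotI n) ∞ (fun p : ℝ × ℝ => X p.1 p.2)) :
    ContDiff ℝ ∞ (fun p : ℝ × ℝ => 𝔣.H p.2 (X p.1 p.2)) := by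
  have h1 : ContMDiff 𝓘(ℝ, ℝ × ℝ) (𝓘(ℝ, ℝ).prod (cotI n)) ∞
      (fun p : ℝ × ℝ => (p.2, X p.1 p.2)) := contDiff_snd.contMDiff.prodMk hX
  exact (h𝔣.H.comp h1).contDiff

theorem mdifferentiable_fst
    (hX : ContMDiff 𝓘(ℝ, ℝ × ℝ) (cotI n) ∞ (fun p : ℝ × ℝ => X p.1 p.2)) (t : ℝ) :
    MDifferentiable 𝓘(ℝ, ℝ) (cotI n) (fun s => X s t) := by
  have h1 : ContMDiff 𝓘(ℝ, ℝ) 𝓘(ℝ, ℝ × ℝ) ∞ (fun s : ℝ => (s, t)) :=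
    ContDiff.contMDiff (by fun_prop)
  exact (hX.comp h1).mdifferentiable (by simp)

theorem mdifferentiable_snd
    (hX : ContMDiff 𝓘(ℝ, ℝ × ℝ) (cotI n) ∞ (fun p : ℝ × ℝ => X p.1 p.2)) (s : ℝ) :
    MDifferentiable 𝓘(ℝ, ℝ) (cotI n) (X s) := by
  have h1 : ContMDiff 𝓘(ℝ, ℝ) 𝓘(ℝ, ℝ × ℝ) ∞ (fun t : ℝ => (s, t)) :=
    ContDiff.contMDiff (by fun_prop)
  exact (hX.comp h1).mdifferentiable (by simp)

theorem fderiv_F_family (h𝔣 : IsSmoothData 𝔣)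
    (hX : ContMDiff 𝓘(ℝ, ℝ × ℝ) (cotI n) ∞ (fun p : ℝ × ℝ => X p.1 p.2)) (s t : ℝ) :
    fderiv ℝ (fun p : ℝ × ℝ => 𝔣.χ p.2 * 𝔣.F (X p.1 p.2)) (s, t) (1, 0)
      = 𝔣.χ t * dfun 𝔣.F (X s t) (vel (cotI n) (fun σ => X σ t) s) := by
  refine (hasDerivAt_fst (contDiff_F_family h𝔣 hX) s t).unique ?_
  have h : HasDerivAt (fun σ => 𝔣.F (X σ t))
      (dfun 𝔣.F (X s t) (vel (cotI n) (fun σ => X σ t) s)) s :=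
    hasDerivAt_comp_curve (h𝔣.F.mdifferentiable (by simp) _) (mdifferentiable_fst hX t s)
  exact h.const_mul (𝔣.χ t)

theorem fderiv_H_family (h𝔣 : IsSmoothData 𝔣)
    (hX : ContMDiff 𝓘(ℝ, ℝ × ℝ) (cotI n) ∞ (fun p : ℝ × ℝ => X p.1 p.2)) (s t : ℝ) :
    fderiv ℝ (fun p : ℝ × ℝ => 𝔣.H p.2 (X p.1 p.2)) (s, t) (1, 0)
      = dfun (𝔣.H t) (X s t) (vel (cotI n) (fun σ => X σ t) s) := by
  refine (hasDerivAt_fst (contDiff_H_family h𝔣 hX) s t).unique ?_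
  exact hasDerivAt_comp_curve ((h𝔣.H_slice t).mdifferentiable (by simp) _)
    (mdifferentiable_fst hX t s)

/-- The integrand of the first variation. -/
theorem omega_vel_defect (h𝔣 : IsSmoothData 𝔣)
    (hX : ContMDiff 𝓘(ℝ, ℝ × ℝ) (cotI n) ∞ (fun p : ℝ × ℝ => X p.1 p.2)) (η s t : ℝ) :
    omega (X s t) (vel (cotI n) (fun σ => X σ t) s) (defect 𝔣 (X s) η t)
      = fderiv ℝ (fun p : ℝ × ℝ => liouville (X p.1 p.2) (vel (cotI n) (X p.1) p.2)) (s, t) (1, 0)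
        - fderiv ℝ (fun p : ℝ × ℝ =>
            liouville (X p.1 p.2) (vel (cotI n) (fun σ => X σ p.2) p.1)) (s, t) (0, 1)
        - 𝔣.f η * fderiv ℝ (fun p : ℝ × ℝ => 𝔣.χ p.2 * 𝔣.F (X p.1 p.2)) (s, t) (1, 0)
        - fderiv ℝ (fun p : ℝ × ℝ => 𝔣.H p.2 (X p.1 p.2)) (s, t) (1, 0) := by
  have h := curl_liouville (X := fun p : ℝ × ℝ => X p.1 p.2) (s := s) (t := t) (hX _)
  rw [fderiv_F_family h𝔣 hX, fderiv_H_family h𝔣 hX, h, defect, omega_sub_right, omega_sub_right,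
    omega_smul_right, omega_hamVF_right, omega_hamVF_right]
  ring

theorem continuous_omega_vel_defect (h𝔣 : IsSmoothData 𝔣)
    (hX : ContMDiff 𝓘(ℝ, ℝ × ℝ) (cotI n) ∞ (fun p : ℝ × ℝ => X p.1 p.2)) {e : ℝ → ℝ}
    (he : Continuous e) : Continuous (fun p : ℝ × ℝ =>
      omega (X p.1 p.2) (vel (cotI n) (fun σ => X σ p.2) p.1) (defect 𝔣 (X p.1) (e p.1) p.2)) := by
  simp only [omega_vel_defect h𝔣 hX]
  have h1 := continuous_fderiv_apply (contDiff_liouville_vel_snd hX) (1, 0)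
  have h2 := continuous_fderiv_apply (contDiff_liouville_vel_fst hX) (0, 1)
  have h3 := continuous_fderiv_apply (contDiff_F_family h𝔣 hX) (1, 0)
  have h4 := continuous_fderiv_apply (contDiff_H_family h𝔣 hX) (1, 0)
  exact ((h1.sub h2).sub ((h𝔣.f.continuous.comp (he.comp continuous_fst)).mul h3)).sub h4

/-- The first variation of the action functional. -/
theorem hasDerivAt_action (h𝔣 : IsSmoothData 𝔣)
    (hX : ContMDiff 𝓘(ℝ, ℝ × ℝ) (cotI n) ∞ (fun p : ℝ × ℝ => X p.1 p.2))
    (hper : ∀ s, Function.Periodic (X s) 1) {e : ℝ → ℝ} (he : ContDiff ℝ ∞ e) (s : ℝ) :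
    HasDerivAt (fun s => action 𝔣 (X s) (e s))
      ((∫ t in (0 : ℝ)..1, omega (X s t) (vel (cotI n) (fun σ => X σ t) s)
          (defect 𝔣 (X s) (e s) t))
        - deriv 𝔣.f (e s) * deriv e s * ∫ t in (0 : ℝ)..1, 𝔣.χ t * 𝔣.F (X s t)) s := by
  have h1 := contDiff_liouville_vel_snd hX
  have h2 := contDiff_liouville_vel_fst hX
  have h3 := contDiff_F_family h𝔣 hX
  have h4 := contDiff_H_family h𝔣 hX
  have hfe : HasDerivAt (fun s => 𝔣.f (e s)) (deriv 𝔣.f (e s) * deriv e s) s :=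
    ((h𝔣.f.differentiable (by simp)) (e s)).hasDerivAt.comp s
      ((he.differentiable (by simp)) s).hasDerivAt
  have hD := ((hasDerivAt_integral_slice h1 s).sub (hfe.mul (hasDerivAt_integral_slice h3 s))).sub
    (hasDerivAt_integral_slice h4 s)
  -- the term `∂ₜ λ(∂ₛX)` integrates to zero by periodicity
  have hb : ∫ t in (0 : ℝ)..1, fderiv ℝ (fun p : ℝ × ℝ =>
      liouville (X p.1 p.2) (vel (cotI n) (fun σ => X σ p.2) p.1)) (s, t) (0, 1) = 0 := by
    rw [intervalIntegral.integral_eq_sub_of_hasDerivAt (fun t _ => hasDerivAt_snd h2 s t)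
      ((continuous_slice (continuous_fderiv_apply h2 (0, 1)) s).intervalIntegrable _ _)]
    have h01 : (fun σ => X σ 1) = fun σ => X σ 0 := by
      funext σ; simpa using hper σ 0
    have hgen : ∀ γ γ' : ℝ → Cot n M, γ = γ' →
        liouville (γ s) (vel (cotI n) γ s) = liouville (γ' s) (vel (cotI n) γ' s) := by
      rintro γ _ rfl; rfl
    exact sub_eq_zero.2 (hgen _ _ h01)
  refine hD.congr_deriv ?_
  have i1 := (continuous_slice (continuous_fderiv_apply h1 (1, 0)) s).intervalIntegrable
    (μ := MeasureTheory.volume) 0 1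
  have i2 := (continuous_slice (continuous_fderiv_apply h2 (0, 1)) s).intervalIntegrable
    (μ := MeasureTheory.volume) 0 1
  have i3 := (continuous_slice (continuous_fderiv_apply h3 (1, 0)) s).intervalIntegrable
    (μ := MeasureTheory.volume) 0 1
  have i4 := (continuous_slice (continuous_fderiv_apply h4 (1, 0)) s).intervalIntegrable
    (μ := MeasureTheory.volume) 0 1
  simp only [omega_vel_defect h𝔣 hX]
  rw [intervalIntegral.integral_sub ((i1.sub i2).sub (i3.const_mul _)) i4,
    intervalIntegral.integral_sub (i1.sub i2) (i3.const_mul _),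
    intervalIntegral.integral_sub i1 i2, hb, intervalIntegral.integral_const_mul]
  ring

end FirstVariation

/-! ### The metric of a compatible almost complex structure -/

section ACS

variable {J : EndField n M}

theorem IsACS.omega_map_map (hJ : IsACS J) (t : ℝ) (z : Cot n M) (v w : TangentSpace (cotI n) z) :
    omega z (J t z v) (J t z w) = omega z v w := by
  rw [hJ.symm, hJ.sq, omega_neg_left, ← omega_antisymm]

theorem IsACS.nonneg (hJ : IsACS J) (t : ℝ) (z : Cot n M) (v : TangentSpace (cotI n) z) :
    0 ≤ omega z (J t z v) v := by
  rcases eq_or_ne v 0 with rfl | hv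
  · rw [omega_zero_right]
  · exact (hJ.pos t z v hv).le

theorem IsACS.eq_zero (hJ : IsACS J) {t : ℝ} {z : Cot n M} {v : TangentSpace (cotI n) z}
    (h : omega z (J t z v) v ≤ 0) : v = 0 := by
  by_contra hv
  exact absurd (hJ.pos t z v hv) h.not_gt

theorem EndField.map_add (J : EndField n M) (t : ℝ) (z : Cot n M)
    (v w : TangentSpace (cotI n) z) : J t z (v + w) = J t z v + J t z w :=
  ContinuousLinearMap.map_add _ v w

theorem EndField.map_smul (J : EndField n M) (t : ℝ) (z : Cot n M) (c : ℝ)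
    (v : TangentSpace (cotI n) z) : J t z (c • v) = c • J t z v :=
  ContinuousLinearMap.map_smul _ c v

theorem EndField.map_neg (J : EndField n M) (t : ℝ) (z : Cot n M)
    (v : TangentSpace (cotI n) z) : J t z (-v) = -J t z v :=
  ContinuousLinearMap.map_neg _ v

/-- The Cauchy-Schwarz inequality for the metric `ω(J ·, ·)`. -/
theorem IsACS.cauchySchwarz (hJ : IsACS J) (t : ℝ) (z : Cot n M)
    (v w : TangentSpace (cotI n) z) :
    omega z (J t z v) w ^ 2 ≤ omega z (J t z v) v * omega z (J t z w) w := by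
  have h (c : ℝ) : 0 ≤ omega z (J t z w) w * (c * c) + 2 * omega z (J t z v) w * c
      + omega z (J t z v) v := by
    have := hJ.nonneg t z (v + c • w)
    rw [J.map_add, J.map_smul, omega_add_left, omega_add_right, omega_add_right, omega_smul_left,
      omega_smul_left, omega_smul_right, omega_smul_right, hJ.symm t z w v] at this
    linarith
  have := discrim_le_zero h
  rw [discrim] at this
  linarith

theorem IsACS.omega_sq_le (hJ : IsACS J) (t : ℝ) (z : Cot n M) (v w : TangentSpace (cotI n) z) :
    omega z v w ^ 2 ≤ omega z (J t z v) v * omega z (J t z w) w := by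
  have h := hJ.cauchySchwarz t z (J t z v) w
  rwa [hJ.sq, omega_neg_left, omega_neg_left, neg_sq, ← omega_antisymm] at h

theorem IsACS.liouville_sq_le (hJ : IsACS J) (t : ℝ) (z : Cot n M) (v : TangentSpace (cotI n) z) :
    liouville z v ^ 2 ≤ omega z (J t z (liouvilleVF z)) (liouvilleVF z) * omega z (J t z v) v := by
  rw [← omega_liouvilleVF]; exact hJ.omega_sq_le t z _ _

theorem IsACS.dfun_sq_le (hJ : IsACS J) (t : ℝ) (z : Cot n M) (F : Cot n M → ℝ)
    (v : TangentSpace (cotI n) z) :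
    dfun F z v ^ 2 ≤ omega z (J t z (hamVF F z)) (hamVF F z) * omega z (J t z v) v := by
  have h := hJ.omega_sq_le t z v (hamVF F z)
  rwa [omega_hamVF_right, mul_comm] at h

theorem omega_left_liouvilleVF (z : Cot n M) (v : TangentSpace (cotI n) z) :
    omega z v (liouvilleVF z) = -liouville z v := by
  rw [omega_antisymm, omega_liouvilleVF]

theorem IsACS.contMDiff_apply (hJ : IsACS J) {Z : ∀ z : Cot n M, TangentSpace (cotI n) z}
    (hZ : ContMDiff (cotI n) (cotI n).tangent ∞
      (fun z : Cot n M => (⟨z, Z z⟩ : TangentBundle (cotI n) (Cot n M)))) :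
    ContMDiff (𝓘(ℝ, ℝ).prod (cotI n)) (cotI n).tangent ∞ (fun p : ℝ × Cot n M =>
      (⟨p.2, J p.1 p.2 (Z p.2)⟩ : TangentBundle (cotI n) (Cot n M))) := by
  have h1 : ContMDiff (𝓘(ℝ, ℝ).prod (cotI n)) (𝓘(ℝ, ℝ).prod (cotI n).tangent) ∞
      (fun p : ℝ × Cot n M => (p.1, (⟨p.2, Z p.2⟩ : TangentBundle (cotI n) (Cot n M)))) :=
    contMDiff_fst.prodMk (hZ.comp contMDiff_snd)
  exact hJ.smooth.comp h1

theorem IsACS.contMDiff_liouville_apply (hJ : IsACS J) :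
    ContMDiff (𝓘(ℝ, ℝ).prod (cotI n)) 𝓘(ℝ, ℝ) ∞ (fun p : ℝ × Cot n M =>
      liouville p.2 (J p.1 p.2 (liouvilleVF p.2))) :=
  contMDiff_liouville.comp (hJ.contMDiff_apply contMDiff_liouvilleVF)

theorem contMDiff_hamVF_autonomous {F : Cot n M → ℝ} (hF : ContMDiff (cotI n) 𝓘(ℝ, ℝ) ∞ F) :
    ContMDiff (cotI n) (cotI n).tangent ∞
      (fun z : Cot n M => (⟨z, hamVF F z⟩ : TangentBundle (cotI n) (Cot n M))) := by
  have h1 : ContMDiff (cotI n) (𝓘(ℝ, ℝ).prod (cotI n)) ∞ (fun z : Cot n M => ((0 : ℝ), z)) :=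
    contMDiff_const.prodMk contMDiff_id
  exact (contMDiff_hamVF (G := fun _ => F) (hF.comp contMDiff_snd)).comp h1

/-- A continuous function that depends on `t` only through a periodic family is bounded on
compact sets, uniformly in `t`. -/
theorem exists_bound_of_periodic {q : ℝ → Cot n M → ℝ}
    (hq : Continuous (fun p : ℝ × Cot n M => q p.1 p.2)) (hper : Function.Periodic q 1)
    {K : Set (Cot n M)} (hK : IsCompact K) : ∃ C : ℝ, 0 < C ∧ ∀ t, ∀ z ∈ K, |q t z| ≤ C := by
  obtain ⟨C, hC⟩ := ((isCompact_Icc (a := (0 : ℝ)) (b := 1)).prod hK).exists_bound_of_continuousOn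
    hq.continuousOn
  refine ⟨max C 1, lt_max_of_lt_right one_pos, fun t z hz => ?_⟩
  obtain ⟨t', ht', h⟩ := hper.exists_mem_Ico₀ one_pos t
  rw [h]
  exact (hC (t', z) ⟨⟨ht'.1, ht'.2.le⟩, hz⟩).trans (le_max_left _ _)

theorem IsACS.exists_liouville_bound (hJ : IsACS J) {K : Set (Cot n M)} (hK : IsCompact K) :
    ∃ C : ℝ, 0 < C ∧ ∀ t, ∀ z ∈ K, ∀ v : TangentSpace (cotI n) z,
      liouville z v ^ 2 ≤ C * omega z (J t z v) v := by
  obtain ⟨C, hC0, hC⟩ := exists_bound_of_periodic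
    (q := fun t z => liouville z (J t z (liouvilleVF z))) hJ.contMDiff_liouville_apply.continuous
    (fun t => by simp only [hJ.periodic t]) hK
  refine ⟨C, hC0, fun t z hz v => (hJ.liouville_sq_le t z v).trans ?_⟩
  refine mul_le_mul_of_nonneg_right ?_ (hJ.nonneg t z v)
  rw [omega_left_liouvilleVF]
  exact (neg_le_abs _).trans (hC t z hz)

theorem IsACS.exists_dfun_bound (hJ : IsACS J) {F : Cot n M → ℝ}
    (hF : ContMDiff (cotI n) 𝓘(ℝ, ℝ) ∞ F) {K : Set (Cot n M)} (hK : IsCompact K) :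
    ∃ C : ℝ, 0 < C ∧ ∀ t, ∀ z ∈ K, ∀ v : TangentSpace (cotI n) z,
      dfun F z v ^ 2 ≤ C * omega z (J t z v) v := by
  obtain ⟨C, hC0, hC⟩ := exists_bound_of_periodic
    (q := fun t z => dfun F z (J t z (hamVF F z)))
    ((contMDiff_dfun hF).comp (hJ.contMDiff_apply (contMDiff_hamVF_autonomous hF))).continuous
    (fun t => by simp only [hJ.periodic t]) hK
  refine ⟨C, hC0, fun t z hz v => (hJ.dfun_sq_le t z F v).trans ?_⟩
  refine mul_le_mul_of_nonneg_right ?_ (hJ.nonneg t z v)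
  rw [omega_hamVF_right]
  exact (le_abs_self _).trans (hC t z hz)

end ACS

/-! ### Starshaped hypersurfaces and the radial function -/

theorem dfun_vel {F : Cot n M → ℝ} {γ : ℝ → Cot n M} {t : ℝ}
    (hF : MDifferentiableAt (cotI n) 𝓘(ℝ, ℝ) F (γ t))
    (hγ : MDifferentiableAt 𝓘(ℝ, ℝ) (cotI n) γ t) :
    HasDerivAt (fun τ => F (γ τ)) (dfun F (γ t) (vel (cotI n) γ t)) t :=
  hasDerivAt_comp_curve hF hγ

/-- Points of the region bounded by `S` that do not lie on `S` are interior points. -/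
theorem region_diff_subset_interior [T2Space M] {S : Set (Cot n M)} (hS : IsCompact S) :
    region S \ S ⊆ interior (region S) := by
  rintro z ⟨hz, hzS⟩
  rcases hz with hz | ⟨_, hz⟩
  · exact absurd hz hzS
  refine mem_interior.2 ⟨connectedComponentIn Sᶜ z, fun y hy => Or.inr ⟨?_, ?_⟩,
    hS.isClosed.isOpen_compl.connectedComponentIn, mem_connectedComponentIn hzS⟩
  · exact connectedComponentIn_subset _ _ hy
  · rwa [← connectedComponentIn_eq hy]

/-- Moving from a point of a starshaped hypersurface towards the zero section one enters the
region that it bounds. -/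
theorem IsStarshaped.fibreScale_mem_region {S : Set (Cot n M)} (hS : IsStarshaped S)
    {z : Cot n M} {c₀ : ℝ} (hc₀ : 0 < c₀) (hz : fibreScale c₀ z ∈ S) :
    ∀ᶠ c in 𝓝[<] c₀, fibreScale c z ∈ region S := by
  obtain ⟨U, hU, hzU, h, hh, h0, hreg, hpos⟩ := hS.outward _ hz
  have hγ := contMDiff_fibreScale_left z
  have hd : HasDerivAt (fun c => h (fibreScale c z)) (dfun h (fibreScale c₀ z)
      (vel (cotI n) (fun c : ℝ => fibreScale c z) c₀)) c₀ :=
    dfun_vel (γ := fun c : ℝ => fibreScale c z)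
      (((hh _ hzU).contMDiffAt (hU.mem_nhds hzU)).mdifferentiableAt (by simp))
      (hγ.mdifferentiable (by simp) c₀)
  have hd0 : 0 < dfun h (fibreScale c₀ z) (vel (cotI n) (fun c : ℝ => fibreScale c z) c₀) := by
    rw [← vel_fibreScale, dfun_smul] at hpos
    exact (mul_pos_iff_of_pos_left hc₀).1 hpos
  have hz0 : h (fibreScale c₀ z) = 0 := (h0 _ hzU).1 hz
  have hev := (hasDerivAt_iff_tendsto_slope.1 hd).eventually (lt_mem_nhds hd0)
  have hev' : ∀ᶠ c in 𝓝[<] c₀, 0 < slope (fun c => h (fibreScale c z)) c₀ c :=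
    hev.filter_mono (nhdsWithin_mono _ fun c hc => ne_of_lt hc)
  have hUev : ∀ᶠ c in 𝓝[<] c₀, fibreScale c z ∈ U :=
    Filter.Eventually.filter_mono inf_le_left
      (hγ.continuous.continuousAt.preimage_mem_nhds (hU.mem_nhds hzU))
  filter_upwards [hev', hUev, self_mem_nhdsWithin] with c hc hcU hlt
  rw [hreg _ hcU]
  rw [slope_def_field, hz0, sub_zero] at hc
  have : c - c₀ < 0 := sub_neg.2 hlt
  by_contra hcon
  exact absurd hc (not_lt.2 (div_nonpos_of_nonneg_of_nonpos (not_le.1 hcon).le this.le))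

theorem IsStarshaped.fibreScale_zero_notMem {S : Set (Cot n M)} (hS : IsStarshaped S)
    (z : Cot n M) : fibreScale 0 z ∉ S := by
  intro hz
  obtain ⟨U, -, -, h, -, -, -, hpos⟩ := hS.outward _ hz
  have : liouvilleVF (fibreScale 0 z) = 0 := by
    rw [← vel_fibreScale, zero_smul]
  rw [this, dfun_zero] at hpos
  exact lt_irrefl _ hpos

theorem continuous_zeroSection : Continuous (fun q : M => (⟨q, 0⟩ : Cot n M)) := by
  have h : Continuous (zeroSection (EuclideanSpace ℝ (Fin n) →L[ℝ] ℝ)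
      (fun q : M => TangentSpace (𝓡 n) q →L[ℝ] Trivial M ℝ q)) :=
    (Bundle.contMDiff_zeroSection ℝ (IB := 𝓡 n) (n := ∞) _).continuous
  exact h

/-- The zero section lies in the region bounded by a starshaped hypersurface. -/
theorem IsStarshaped.fibreScale_zero_mem [T2Space M] [ConnectedSpace M] {S : Set (Cot n M)}
    (hS : IsStarshaped S) (z : Cot n M) : fibreScale 0 z ∈ region S := by
  -- the ray from a point of `S` to the zero section stays in the region
  obtain ⟨z₁, hz₁⟩ := hS.isConnected.nonempty
  have hreg := hS.isCompact_region.isClosed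
  have hγ := (contMDiff_fibreScale_left z₁).continuous
  have hray : Set.Icc (0 : ℝ) 1 ⊆ {c | fibreScale (1 - c) z₁ ∈ region S} := by
    have hcl : IsClosed ({c | fibreScale (1 - c) z₁ ∈ region S} ∩ Set.Icc (0 : ℝ) 1) :=
      (hreg.preimage (hγ.comp (by fun_prop : Continuous fun c : ℝ => 1 - c))).inter isClosed_Icc
    refine hcl.Icc_subset_of_forall_exists_gt ?_ ?_
    · change fibreScale (1 - 0) z₁ ∈ region S
      rw [sub_zero, fibreScale_one]
      exact Or.inl hz₁
    · rintro c ⟨hc, hc0, hc1⟩ y hy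
      have hev : ∀ᶠ c' in 𝓝[<] (1 - c), fibreScale c' z₁ ∈ region S := by
        by_cases hcS : fibreScale (1 - c) z₁ ∈ S
        · exact hS.fibreScale_mem_region (by linarith) hcS
        · have := region_diff_subset_interior hS.isCompact ⟨hc, hcS⟩
          have h2 := hγ.continuousAt.preimage_mem_nhds (mem_interior_iff_mem_nhds.1 this)
          exact Filter.Eventually.filter_mono inf_le_left h2
      have hy' : (1 - y : ℝ) < 1 - c := by have : c < y := hy; linarith
      obtain ⟨c', hc', hc'y⟩ := (hev.and (Ico_mem_nhdsLT hy')).exists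
      refine ⟨1 - c', by simpa using hc', ?_, ?_⟩
      · have := hc'y.2; linarith
      · have := hc'y.1; linarith
  have h0 : fibreScale 0 z₁ ∈ region S := by simpa using hray (Set.right_mem_Icc.2 zero_le_one)
  -- the zero section is connected and does not meet `S`
  rcases h0 with h0 | ⟨h0S, h0⟩
  · exact absurd h0 (hS.fibreScale_zero_notMem z₁)
  have hzero : ∀ y : Cot n M, fibreScale 0 y = ⟨y.1, 0⟩ := fun y => by
    rw [fibreScale, zero_smul]
  have hsub : Set.range (fun q : M => (⟨q, 0⟩ : Cot n M)) ⊆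
      connectedComponentIn Sᶜ (fibreScale 0 z₁) := by
    refine (isPreconnected_range continuous_zeroSection).subset_connectedComponentIn
      ⟨z₁.1, (hzero z₁).symm⟩ ?_
    rintro _ ⟨q, rfl⟩
    have := hS.fibreScale_zero_notMem ⟨q, 0⟩
    rwa [hzero] at this
  have hmem : fibreScale 0 z ∈ connectedComponentIn Sᶜ (fibreScale 0 z₁) :=
    hsub ⟨z.1, (hzero z).symm⟩
  exact Or.inr ⟨hS.fibreScale_zero_notMem z, by rwa [← connectedComponentIn_eq hmem]⟩

/-- Every point outside the interior of the region lies on the forward flow line of `Y` through a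
point of the hypersurface. -/
theorem IsStarshaped.exists_flow_eq [T2Space M] [ConnectedSpace M] {S : Set (Cot n M)}
    (hS : IsStarshaped S) {z : Cot n M} (hz : z ∉ interior (region S)) :
    ∃ z' ∈ S, ∃ τ : ℝ, 0 ≤ τ ∧ z = liouvilleFlow τ z' := by
  have hreg := hS.isCompact_region.isClosed
  have hγ := (contMDiff_fibreScale_left z).continuous
  -- the last parameter at which the ray through `z` lies in the region
  let A : Set ℝ := {c | fibreScale c z ∈ region S} ∩ Set.Icc 0 1
  have hA : IsCompact A := isCompact_Icc.inter_left (hreg.preimage hγ)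
  have hA0 : A.Nonempty := ⟨0, hS.fibreScale_zero_mem z, Set.left_mem_Icc.2 zero_le_one⟩
  obtain ⟨c, ⟨hcR, hc0, hc1⟩, hcmax⟩ := hA.exists_isGreatest hA0
  have hcS : fibreScale c z ∈ S := by
    by_contra hcS
    have hint := region_diff_subset_interior hS.isCompact ⟨hcR, hcS⟩
    rcases hc1.eq_or_lt with rfl | hlt
    · rw [fibreScale_one] at hint; exact hz hint
    have h2 := hγ.continuousAt.preimage_mem_nhds (mem_interior_iff_mem_nhds.1 hint)
    have h3 : ∀ᶠ c' in 𝓝[>] c, fibreScale c' z ∈ region S :=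
      Filter.Eventually.filter_mono inf_le_left h2
    obtain ⟨c', hc', hcc', hc'1⟩ := (h3.and (Ioc_mem_nhdsGT hlt)).exists
    exact absurd (hcmax ⟨hc', hc0.trans hcc'.le, hc'1⟩) (not_le.2 hcc')
  have hcpos : 0 < c := by
    rcases hc0.eq_or_lt with rfl | h
    · exact absurd hcS (hS.fibreScale_zero_notMem z)
    · exact h
  refine ⟨_, hcS, -Real.log c, neg_nonneg.2 (Real.log_nonpos hc0 hc1), ?_⟩
  rw [liouvilleFlow, fibreScale_fibreScale, Real.exp_neg, Real.exp_log hcpos,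
    inv_mul_cancel₀ hcpos.ne', fibreScale_one]

theorem co_liouvilleFlow (z₀ z : Cot n M) (τ : ℝ) :
    co z₀ (liouvilleFlow τ z) = ((co z₀ z).1, Real.exp τ • (co z₀ z).2) :=
  co_fibreScale _ _ _

theorem liouvilleFlow_mem_dom {z₀ z : Cot n M} (τ : ℝ) :
    liouvilleFlow τ z ∈ dom z₀ ↔ z ∈ dom z₀ := fibreScale_mem_dom _

/-- The differential of the Liouville flow in coordinates. -/
theorem dco_mfderiv_liouvilleFlow {z₀ z : Cot n M} (hz : z ∈ dom z₀) (τ : ℝ)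
    (v : TangentSpace (cotI n) z) :
    dco z₀ (liouvilleFlow τ z) (mfderiv (cotI n) (cotI n) (liouvilleFlow τ) z v)
      = ((dco z₀ z v).1, Real.exp τ • (dco z₀ z v).2) := by
  let L : CotVec n →L[ℝ] CotVec n := (ContinuousLinearMap.fst ℝ _ _).prod
    (Real.exp τ • ContinuousLinearMap.snd ℝ _ _)
  have h1 := (hasMFDerivAt_co ((liouvilleFlow_mem_dom τ).2 hz)).comp z
    ((contMDiff_liouvilleFlow τ).mdifferentiable (by simp) z).hasMFDerivAt
  have h2 := (L.hasFDerivAt (x := co z₀ z)).hasMFDerivAt.comp z (hasMFDerivAt_co hz)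
  have h3 : co z₀ ∘ liouvilleFlow τ = L ∘ co z₀ := by
    funext y; exact co_liouvilleFlow z₀ y τ
  rw [h3] at h1
  exact DFunLike.congr_fun (hasMFDerivAt_unique h1 h2) v

theorem liouville_mfderiv_liouvilleFlow (z : Cot n M) (τ : ℝ) (v : TangentSpace (cotI n) z) :
    liouville (liouvilleFlow τ z) (mfderiv (cotI n) (cotI n) (liouvilleFlow τ) z v)
      = Real.exp τ * liouville z v := by
  have hz := mem_dom_self z
  rw [liouville_eq hz, liouville_eq ((liouvilleFlow_mem_dom τ).2 hz), dco_mfderiv_liouvilleFlow hz,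
    co_liouvilleFlow]
  rfl

theorem mfderiv_liouvilleFlow_liouvilleVF (z : Cot n M) (τ : ℝ) :
    mfderiv (cotI n) (cotI n) (liouvilleFlow τ) z (liouvilleVF z)
      = liouvilleVF (liouvilleFlow τ z) := by
  have hz := mem_dom_self z
  have hz' := (liouvilleFlow_mem_dom τ).2 hz
  apply dco_injective hz'
  rw [dco_mfderiv_liouvilleFlow hz, dco_liouvilleVF hz, dco_liouvilleVF hz', co_liouvilleFlow]

theorem exists_mfderiv_liouvilleFlow_eq (z : Cot n M) (τ : ℝ)
    (v : TangentSpace (cotI n) (liouvilleFlow τ z)) :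
    ∃ w : TangentSpace (cotI n) z, mfderiv (cotI n) (cotI n) (liouvilleFlow τ) z w = v := by
  have hz := mem_dom_self z
  obtain ⟨w, hw⟩ := dco_surjective hz ((dco z (liouvilleFlow τ z) v).1,
    (Real.exp τ)⁻¹ • (dco z (liouvilleFlow τ z) v).2)
  refine ⟨w, dco_injective ((liouvilleFlow_mem_dom τ).2 hz) ?_⟩
  rw [dco_mfderiv_liouvilleFlow hz, hw]
  refine Prod.ext rfl ?_
  exact smul_inv_smul₀ (Real.exp_pos τ).ne' _

/-- The square of the length of the Liouville vector field for the metric of `J₀`.  For a convex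
almost complex structure it is a radial coordinate outside of the region bounded by `S`. -/
def radius (J : EndField n M) (z : Cot n M) : ℝ := omega z (J 0 z (liouvilleVF z)) (liouvilleVF z)

theorem IsACS.contMDiff_radius {J : EndField n M} (hJ : IsACS J) :
    ContMDiff (cotI n) 𝓘(ℝ, ℝ) ∞ (radius J) := by
  have h : radius J = fun z => -liouville z (J 0 z (liouvilleVF z)) := by
    funext z; exact omega_left_liouvilleVF z _
  have h1 : ContMDiff (cotI n) (𝓘(ℝ, ℝ).prod (cotI n)) ∞ (fun z : Cot n M => ((0 : ℝ), z)) :=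
    contMDiff_const.prodMk contMDiff_id
  rw [h]
  exact (contDiff_neg.contMDiff).comp (hJ.contMDiff_liouville_apply.comp h1)

theorem IsACS.radius_nonneg {J : EndField n M} (hJ : IsACS J) (z : Cot n M) : 0 ≤ radius J z :=
  hJ.nonneg 0 z _

section Convex

variable {J : EndField n M} {S : Set (Cot n M)}

theorem IsConvexACS.radius_liouvilleFlow (hJ : IsConvexACS S J) {z : Cot n M} (hz : z ∈ S) {τ : ℝ}
    (hτ : 0 ≤ τ) : radius J (liouvilleFlow τ z) = Real.exp τ := by
  have h := hJ.invariant 0 z hz τ hτ (liouvilleVF z)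
  rw [mfderiv_liouvilleFlow_liouvilleVF] at h
  have h1 := hJ.normalized 0 z hz
  rw [omega_left_liouvilleVF] at h1
  rw [radius, omega_left_liouvilleVF, ← h, liouville_mfderiv_liouvilleFlow]
  linear_combination Real.exp τ * h1

theorem IsConvexACS.fibreScale_inv_radius_mem [T2Space M] [ConnectedSpace M]
    (hS : IsStarshaped S) (hJ : IsConvexACS S J) {z : Cot n M} (hz : z ∉ interior (region S)) :
    fibreScale (radius J z)⁻¹ z ∈ S := by
  obtain ⟨z', hz', τ, hτ, rfl⟩ := hS.exists_flow_eq hz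
  rw [hJ.radius_liouvilleFlow hz' hτ, liouvilleFlow, fibreScale_fibreScale,
    inv_mul_cancel₀ (Real.exp_pos τ).ne', fibreScale_one]
  exact hz'

theorem IsConvexACS.isCompact_radius_le [T2Space M] [ConnectedSpace M]
    (hS : IsStarshaped S) (hJ : IsConvexACS S J) (R : ℝ) : IsCompact {z | radius J z ≤ R} := by
  have h1 : Continuous (fun p : ℝ × Cot n M => liouvilleFlow p.1 p.2) :=
    contMDiff_fibreScale.continuous.comp
      ((Real.continuous_exp.comp continuous_fst).prodMk continuous_snd)
  have h2 : IsCompact ((fun p : ℝ × Cot n M => liouvilleFlow p.1 p.2) ''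
      (Set.Icc 0 (Real.log R) ×ˢ S)) := (isCompact_Icc.prod hS.isCompact).image h1
  refine (hS.isCompact_region.union h2).of_isClosed_subset
    (isClosed_le hJ.contMDiff_radius.continuous continuous_const) fun z hz => ?_
  by_cases hzi : z ∈ interior (region S)
  · exact Or.inl (interior_subset hzi)
  · obtain ⟨z', hz', τ, hτ, rfl⟩ := hS.exists_flow_eq hzi
    refine Or.inr ⟨(τ, z'), ⟨⟨hτ, ?_⟩, hz'⟩, rfl⟩
    have h3 : radius J (liouvilleFlow τ z') ≤ R := hz
    rw [hJ.radius_liouvilleFlow hz' hτ] at h3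
    exact (Real.le_log_iff_exp_le ((Real.exp_pos τ).trans_le h3)).2 h3

theorem IsStarshaped.exists_flow_eq_pos [T2Space M] [ConnectedSpace M]
    (hS : IsStarshaped S) {z : Cot n M} (hz : z ∉ region S) :
    ∃ z' ∈ S, ∃ τ : ℝ, 0 < τ ∧ z = liouvilleFlow τ z' := by
  obtain ⟨z', hz', τ, hτ, rfl⟩ := hS.exists_flow_eq (fun h => hz (interior_subset h))
  refine ⟨z', hz', τ, hτ.lt_of_ne ?_, rfl⟩
  rintro rfl
  rw [liouvilleFlow, Real.exp_zero, fibreScale_one] at hz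
  exact hz (Or.inl hz')

theorem dfun_radius_liouvilleVF [T2Space M] [ConnectedSpace M]
    (hS : IsStarshaped S) (hJ : IsConvexACS S J) {z : Cot n M} (hz : z ∉ region S) :
    dfun (radius J) z (liouvilleVF z) = radius J z := by
  obtain ⟨z', hz', τ, hτ, rfl⟩ := hS.exists_flow_eq_pos hz
  have h1 : HasDerivAt (fun c : ℝ => radius J (fibreScale c z'))
      (dfun (radius J) (fibreScale (Real.exp τ) z')
        (vel (cotI n) (fun c : ℝ => fibreScale c z') (Real.exp τ))) (Real.exp τ) :=
    dfun_vel (γ := fun c : ℝ => fibreScale c z') (hJ.contMDiff_radius.mdifferentiable (by simp) _)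
      ((contMDiff_fibreScale_left z').mdifferentiable (by simp) _)
  have h2 : (fun c : ℝ => radius J (fibreScale c z')) =ᶠ[𝓝 (Real.exp τ)] fun c => c := by
    filter_upwards [lt_mem_nhds (Real.one_lt_exp_iff.2 hτ)] with c hc
    have := hJ.radius_liouvilleFlow hz' (Real.log_nonneg hc.le)
    rwa [liouvilleFlow, Real.exp_log (by linarith)] at this
  have h3 := (h1.congr_of_eventuallyEq h2.symm).unique (hasDerivAt_id _)
  rw [hJ.radius_liouvilleFlow hz' hτ.le]
  refine (congrArg (dfun (radius J) (liouvilleFlow τ z')) (vel_fibreScale z').symm).trans ?_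
  refine (dfun_smul _ _ _ _).trans ?_
  rw [liouvilleFlow, h3, mul_one]

theorem dfun_comp_liouvilleFlow {F : Cot n M → ℝ} (hF : ContMDiff (cotI n) 𝓘(ℝ, ℝ) ∞ F) (τ : ℝ)
    (z : Cot n M) (v : TangentSpace (cotI n) z) :
    dfun (fun y => F (liouvilleFlow τ y)) z v
      = dfun F (liouvilleFlow τ z) (mfderiv (cotI n) (cotI n) (liouvilleFlow τ) z v) := by
  have h := (hF.mdifferentiable (by simp) (liouvilleFlow τ z)).hasMFDerivAt.comp z
    ((contMDiff_liouvilleFlow τ).mdifferentiable (by simp) z).hasMFDerivAt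
  exact DFunLike.congr_fun h.mfderiv v

/-- The level sets of the radius are the images of `S` under the Liouville flow; in particular
the flow identifies their tangent spaces. -/
theorem mem_tangentTo_of_dfun_radius_eq_zero [T2Space M] [ConnectedSpace M]
    (hS : IsStarshaped S) (hJ : IsConvexACS S J) {z : Cot n M} (hz : z ∈ S) {τ : ℝ} (hτ : 0 < τ)
    {v : TangentSpace (cotI n) z} (hreg : liouvilleFlow τ z ∉ region S)
    (hv : dfun (radius J) (liouvilleFlow τ z)
      (mfderiv (cotI n) (cotI n) (liouvilleFlow τ) z v) = 0) : v ∈ tangentTo S z := by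
  intro h hh h0
  let k : Cot n M → ℝ := fun y => radius J (liouvilleFlow τ y)
  have hk : ContMDiff (cotI n) 𝓘(ℝ, ℝ) ∞ k := hJ.contMDiff_radius.comp (contMDiff_liouvilleFlow τ)
  have hkz : k z = Real.exp τ := hJ.radius_liouvilleFlow hz hτ.le
  have hkv : dfun k z v = 0 := (dfun_comp_liouvilleFlow hJ.contMDiff_radius τ z v).trans hv
  have hdom := mem_dom_self z
  -- near `z`, rescaling `y` by `e^τ / k y` yields a point of `S`
  have hzero : ∀ᶠ y in 𝓝 z, h (fibreScale (Real.exp τ / k y) y) = 0 := by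
    have h1 := (contMDiff_liouvilleFlow τ).continuous.continuousAt.preimage_mem_nhds
      (hS.isCompact_region.isClosed.isOpen_compl.mem_nhds hreg)
    have h2 : ∀ᶠ y in 𝓝 z, liouvilleFlow τ y ∈ (region S)ᶜ := h1
    refine h2.mono fun y hy => h0 _ ?_
    have := hJ.fibreScale_inv_radius_mem hS (fun hi => hy (interior_subset hi))
    rw [liouvilleFlow, fibreScale_fibreScale] at this
    rwa [div_eq_inv_mul]
  -- differentiate this identity in coordinates along the line in direction `v`
  let w : CotVec n := dco z z v
  let q : ℝ → CotVec n := fun s => co z z + s • w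
  have hq : HasDerivAt q w 0 := by
    simpa [q] using ((hasDerivAt_id (0 : ℝ)).smul_const w).const_add (co z z)
  have hq0 : q 0 = co z z := by simp [q]
  have hkd : HasDerivAt (fun s => k (coInv z (q s))) 0 0 := by
    have h1 : HasFDerivAt (fun y => k (coInv z y)) (fderiv ℝ (fun y => k (coInv z y)) (co z z))
        (q 0) := by
      rw [hq0]
      exact (((contMDiffAt_comp_coInv hdom (hk _)).differentiableAt (by simp))).hasFDerivAt
    have h2 := h1.comp_hasDerivAt (0 : ℝ) hq
    refine h2.congr_deriv ?_
    exact (mfderiv_eq_fderiv_coInv hdom (hk.mdifferentiable (by simp) z) v).symm.trans hkv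
  have hck : k (coInv z (q 0)) = Real.exp τ := by rw [hq0, coInv_co hdom, hkz]
  have hc : HasDerivAt (fun s => Real.exp τ / k (coInv z (q s))) 0 0 := by
    have := (hasDerivAt_const (0 : ℝ) (Real.exp τ)).div hkd (by rw [hck]; exact (Real.exp_pos _).ne')
    refine this.congr_deriv ?_
    rw [zero_mul, mul_zero, sub_zero, zero_div]
  let Q : ℝ → CotVec n := fun s => ((q s).1, (Real.exp τ / k (coInv z (q s))) • (q s).2)
  have hQ0 : Q 0 = co z z := by
    change ((q 0).1, (Real.exp τ / k (coInv z (q 0))) • (q 0).2) = _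
    rw [hck, div_self (Real.exp_pos τ).ne', one_smul, hq0]
  have hQ : HasDerivAt Q w 0 := by
    have h1 : HasDerivAt (fun s => (q s).1) w.1 0 := hq.fst
    have h2 : HasDerivAt (fun s => (q s).2) w.2 0 := hq.snd
    have h3 := h1.prodMk (hc.smul h2)
    refine h3.congr_deriv ?_
    rw [hck, div_self (Real.exp_pos τ).ne', one_smul, zero_smul, add_zero]
  have hhd : HasFDerivAt (fun y => h (coInv z y)) (fderiv ℝ (fun y => h (coInv z y)) (co z z))
      (Q 0) := by
    rw [hQ0]
    exact ((contMDiffAt_comp_coInv hdom (hh _)).differentiableAt (by simp)).hasFDerivAt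
  have hD := hhd.comp_hasDerivAt (0 : ℝ) hQ
  refine (mfderiv_eq_fderiv_coInv hdom (hh.mdifferentiable (by simp) z) v).trans ?_
  refine hD.unique ((hasDerivAt_const (0 : ℝ) (0 : ℝ)).congr_of_eventuallyEq ?_)
  have hqt : ∀ᶠ s in 𝓝 (0 : ℝ), q s ∈ tgt z := by
    refine hq.continuousAt.preimage_mem_nhds ?_
    rw [hq0]; exact (isOpen_tgt z).mem_nhds (co_mem hdom)
  have hcont : ContinuousAt (fun s => coInv z (q s)) 0 := by
    have h1 : ContinuousAt (coInv z) (q 0) := by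
      rw [hq0]; exact (contMDiffAt_coInv (co_mem hdom)).continuousAt
    exact h1.comp hq.continuousAt
  have hev : ∀ᶠ s in 𝓝 (0 : ℝ), h (fibreScale (Real.exp τ / k (coInv z (q s))) (coInv z (q s))) = 0 := by
    have h1 : Filter.Tendsto (fun s => coInv z (q s)) (𝓝 0) (𝓝 z) := by
      have := hcont.tendsto
      rwa [hq0, coInv_co hdom] at this
    exact h1.eventually hzero
  filter_upwards [hqt, hev] with s hs1 hs2
  refine Eq.trans ?_ hs2
  change h (coInv z (Q s)) = _
  congr 1
  have h1 := co_fibreScale z (coInv z (q s)) (Real.exp τ / k (coInv z (q s)))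
  rw [co_coInv hs1] at h1
  change coInv z ((q s).1, _ • (q s).2) = _
  rw [← h1, coInv_co ((fibreScale_mem_dom _).2 (coInv_mem hs1))]

/-- Outside of the region bounded by `S`, a convex almost complex structure preserves the
intersection of the kernels of `λ` and of the differential of the radius. -/
theorem IsConvexACS.map_contact [T2Space M] [ConnectedSpace M]
    (hS : IsStarshaped S) (hJ : IsConvexACS S J) {z : Cot n M} (hz : z ∉ region S) (t : ℝ)
    {v : TangentSpace (cotI n) z} (hr : dfun (radius J) z v = 0) (hl : liouville z v = 0) :
    dfun (radius J) z (J t z v) = 0 ∧ liouville z (J t z v) = 0 := by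
  obtain ⟨z', hz', τ, hτ, rfl⟩ := hS.exists_flow_eq_pos hz
  obtain ⟨w, rfl⟩ := exists_mfderiv_liouvilleFlow_eq z' τ v
  rw [liouville_mfderiv_liouvilleFlow] at hl
  have hw : w ∈ contactPlane S z' :=
    ⟨mem_tangentTo_of_dfun_radius_eq_zero hS hJ hz' hτ hz hr,
      (mul_eq_zero.1 hl).resolve_left (Real.exp_pos τ).ne'⟩
  have hJw : J t z' w ∈ contactPlane S z' := by
    rw [← hJ.contact t z' hz']; exact Set.mem_image_of_mem _ hw
  rw [← hJ.invariant t z' hz' τ hτ.le, liouville_mfderiv_liouvilleFlow, hJw.2, mul_zero,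
    ← dfun_comp_liouvilleFlow hJ.contMDiff_radius]
  refine ⟨?_, rfl⟩
  -- `r ∘ φ_τ` is constant on `S`
  have hk : ContMDiff (cotI n) 𝓘(ℝ, ℝ) ∞ (fun y => radius J (liouvilleFlow τ y)) :=
    hJ.contMDiff_radius.comp (contMDiff_liouvilleFlow τ)
  have h1 := hJw.1 (fun y => radius J (liouvilleFlow τ y) - Real.exp τ)
    ((contDiff_id.sub contDiff_const).contMDiff.comp hk)
    (fun y hy => sub_eq_zero.2 (hJ.radius_liouvilleFlow hy hτ.le))
  have h2 : HasMFDerivAt (cotI n) 𝓘(ℝ, ℝ) (fun y => radius J (liouvilleFlow τ y)) z'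
    (mfderiv (cotI n) 𝓘(ℝ, ℝ) (fun y => radius J (liouvilleFlow τ y)) z') :=
    (hk.mdifferentiable (by simp) z').hasMFDerivAt
  have h3 := (((hasFDerivAt_id (𝕜 := ℝ) (radius J (liouvilleFlow τ z'))).sub_const
    (Real.exp τ)).hasMFDerivAt).comp z' h2
  exact (DFunLike.congr_fun h3.mfderiv (J t z' w)).symm.trans h1

/-- The two-form `dr ∧ λ` is compatible with a convex almost complex structure outside of the region
bounded by `S`: on complex lines it is non-negative and bounded by `r` times the metric. -/
theorem IsConvexACS.wedge_bounds [T2Space M] [ConnectedSpace M]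
    (hS : IsStarshaped S) (hJ : IsConvexACS S J) {z : Cot n M} (hz : z ∉ region S) (t : ℝ)
    (v : TangentSpace (cotI n) z) :
    0 ≤ dfun (radius J) z (J t z v) * liouville z v - dfun (radius J) z v * liouville z (J t z v) ∧
    dfun (radius J) z (J t z v) * liouville z v - dfun (radius J) z v * liouville z (J t z v)
      ≤ radius J z * omega z (J t z v) v := by
  have hr : 0 < radius J z := by
    obtain ⟨z', hz', τ, hτ, rfl⟩ := hS.exists_flow_eq_pos hz
    rw [hJ.radius_liouvilleFlow hz' hτ.le]; exact Real.exp_pos τ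
  have hJt : J t z = J 0 z := hJ.indep t 0 z fun h => hz (interior_subset h)
  set r := radius J z with hrdef
  set Y := liouvilleVF z with hY
  set s := dfun (radius J) z (J t z Y) with hs
  have hrY : dfun (radius J) z Y = r := dfun_radius_liouvilleVF hS hJ hz
  have hlY : liouville z Y = 0 := liouville_liouvilleVF z
  have hgY : omega z (J t z Y) Y = r := by rw [hJt]; rfl
  have hlJY : liouville z (J t z Y) = -r := by
    rw [omega_left_liouvilleVF] at hgY; linarith
  -- decompose `v` along `Y`, `J Y` and the common kernel of `dr` and `λ`
  let d : ℝ := -liouville z v / r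
  let c : ℝ := (dfun (radius J) z v - d * s) / r
  obtain ⟨ξ, hξ⟩ : ∃ ξ : TangentSpace (cotI n) z, v = c • Y + (d • J t z Y + ξ) :=
    ⟨v - c • Y - d • J t z Y, by abel⟩
  have hd : d * r = -liouville z v := div_mul_cancel₀ _ hr.ne'
  have hc : c * r = dfun (radius J) z v - d * s := div_mul_cancel₀ _ hr.ne'
  have hlv : liouville z v = -(d * r) := by linarith
  have hrv : dfun (radius J) z v = c * r + d * s := by linarith
  have hlξ : liouville z ξ = 0 := by
    have h := hlv
    rw [hξ, liouville_add, liouville_add, liouville_smul, liouville_smul, hlY, hlJY] at h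
    linarith
  have hrξ : dfun (radius J) z ξ = 0 := by
    have h := hrv
    rw [hξ, dfun_add, dfun_add, dfun_smul, dfun_smul, hrY] at h
    linarith
  obtain ⟨hrJξ, hlJξ⟩ := hJ.map_contact hS hz t hrξ hlξ
  have hJv : J t z v = c • J t z Y + (d • (-Y) + J t z ξ) := by
    rw [hξ, J.map_add, J.map_add, J.map_smul, J.map_smul, hJ.sq]
  have hlJv : liouville z (J t z v) = -(c * r) := by
    rw [hJv, liouville_add, liouville_add, liouville_smul, liouville_smul, liouville_neg, hlY,
      hlJY, hlJξ]
    ring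
  have hrJv : dfun (radius J) z (J t z v) = c * s - d * r := by
    rw [hJv, dfun_add, dfun_add, dfun_smul, dfun_smul, dfun_neg, hrY, hrJξ]
    ring
  have hQ : dfun (radius J) z (J t z v) * liouville z v
      - dfun (radius J) z v * liouville z (J t z v) = r * (r * (c ^ 2 + d ^ 2)) := by
    rw [hlJv, hrJv, hlv, hrv]; ring
  have hg : omega z (J t z v) v = r * (c ^ 2 + d ^ 2) + omega z (J t z ξ) ξ := by
    have e1 : omega z Y ξ = 0 := by rw [omega_liouvilleVF, hlξ]
    have e2 : omega z (J t z ξ) Y = 0 := by rw [omega_left_liouvilleVF, hlJξ, neg_zero]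
    have e3 : omega z (J t z Y) ξ = 0 := by rw [hJ.symm, e2]
    have e4 : omega z (J t z ξ) (J t z Y) = 0 := by
      rw [hJ.omega_map_map, omega_left_liouvilleVF, hlξ, neg_zero]
    have e5 : omega z Y (J t z Y) = -r := by rw [omega_antisymm, hgY]
    have e6 : omega z (-Y) ξ = 0 := by rw [omega_neg_left, e1, neg_zero]
    have e7 : omega z (-Y) Y = 0 := by rw [omega_neg_left, omega_self, neg_zero]
    have e8 : omega z (-Y) (J t z Y) = r := by rw [omega_neg_left, e5, neg_neg]
    rw [hJv]
    conv_lhs => rw [hξ]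
    simp only [omega_add_left, omega_add_right, omega_smul_left, omega_smul_right, omega_self, e2,
      e3, e4, e6, e7, e8, hgY]
    ring
  have h0 : 0 ≤ omega z (J t z ξ) ξ := hJ.nonneg t z ξ
  rw [hQ, hg]
  refine ⟨by positivity, mul_le_mul_of_nonneg_left (by linarith) hr.le⟩

end Convex

/-! ### Energy along gradient flow lines -/

/-- A function with values in a bounded interval decreases slowly somewhere in every long
interval. -/
theorem exists_neg_deriv_lt {A A' : ℝ → ℝ} {a b : ℝ} (hA : ∀ s, HasDerivAt A (A' s) s)
    (hab : ∀ s, A s ∈ Set.Ioo a b) {ε : ℝ} (hε : 0 < ε) (s : ℝ) :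
    ∃ s' ∈ Set.Ioo s (s + (b - a) / ε), -A' s' < ε := by
  have hba : 0 < b - a := by have := hab 0; linarith [this.1, this.2]
  have hL : 0 < (b - a) / ε := div_pos hba hε
  obtain ⟨c, hc, hc'⟩ := exists_hasDerivAt_eq_slope A A' (by linarith : s < s + (b - a) / ε)
    (fun x _ => (hA x).continuousAt.continuousWithinAt) (fun x _ => hA x)
  refine ⟨c, hc, ?_⟩
  rw [hc', add_sub_cancel_left, ← neg_div, div_lt_iff₀ hL, mul_div_cancel₀ _ hε.ne']
  have h1 := (hab s).2
  have h2 := (hab (s + (b - a) / ε)).1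
  linarith

/-- A monotone quantity whose square is dominated by the energy vanishes identically. -/
theorem eq_zero_of_sq_le_neg_deriv {A A' G : ℝ → ℝ} {a b : ℝ} (hA : ∀ s, HasDerivAt A (A' s) s)
    (hab : ∀ s, A s ∈ Set.Ioo a b) (hG : Monotone G) (h : ∀ s, G s ^ 2 ≤ -A' s) (s : ℝ) :
    G s = 0 := by
  by_contra hne
  have hpos : 0 < G s ^ 2 := by positivity
  rcases lt_or_gt_of_ne hne with hlt | hlt
  · obtain ⟨s', hs', hs''⟩ := exists_neg_deriv_lt hA hab hpos (s - (b - a) / G s ^ 2)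
    have h1 : G s' ≤ G s := hG (by linarith [hs'.2])
    nlinarith [h s']
  · obtain ⟨s', hs', hs''⟩ := exists_neg_deriv_lt hA hab hpos s
    have h1 : G s ≤ G s' := hG hs'.1.le
    nlinarith [h s']

/-- The energy density `|∂ₛx|²` of a family of loops. -/
def energyDensity (J : EndField n M) (X : ℝ → ℝ → Cot n M) (s t : ℝ) : ℝ :=
  omega (X s t) (J t (X s t) (vel (cotI n) (fun σ => X σ t) s)) (vel (cotI n) (fun σ => X σ t) s)

section FlowLine

variable {𝔣 : Data n M} {J : EndField n M} {u : ℝ → SmoothLoop (cotI n) (Cot n M) × ℝ}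

theorem IsFlowLine.map_vel_eq_defect (hJ : IsACS J) (hu : IsFlowLine 𝔣 J u) (s t : ℝ) :
    J t ((u s).1 t) (vel (cotI n) (fun σ => (u σ).1 t) s) = defect 𝔣 (u s).1 (u s).2 t := by
  have h := hu.loop_eq s t
  rw [eq_neg_of_add_eq_zero_left h, J.map_neg, hJ.sq, neg_neg]
  rfl

theorem IsFlowLine.omega_vel_defect_eq (hJ : IsACS J) (hu : IsFlowLine 𝔣 J u) (s t : ℝ) :
    omega ((u s).1 t) (vel (cotI n) (fun σ => (u σ).1 t) s) (defect 𝔣 (u s).1 (u s).2 t)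
      = -energyDensity J (fun s t => (u s).1 t) s t := by
  rw [← hu.map_vel_eq_defect hJ, omega_antisymm]
  rfl

theorem IsFlowLine.continuous_energyDensity (h𝔣 : IsSmoothData 𝔣) (hJ : IsACS J)
    (hu : IsFlowLine 𝔣 J u) :
    Continuous (fun p : ℝ × ℝ => energyDensity J (fun s t => (u s).1 t) p.1 p.2) := by
  have h := (continuous_omega_vel_defect (X := fun s t => (u s).1 t) h𝔣 hu.smooth hu.smooth_η.continuous).neg
  refine h.congr fun p => ?_
  exact neg_eq_iff_eq_neg.2 (hu.omega_vel_defect_eq hJ p.1 p.2)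

theorem IsFlowLine.deriv_mult (hu : IsFlowLine 𝔣 J u) (s : ℝ) :
    deriv (fun s => (u s).2) s
      = deriv 𝔣.f (u s).2 * ∫ t in (0 : ℝ)..1, 𝔣.χ t * 𝔣.F ((u s).1 t) :=
  sub_eq_zero.1 (hu.mult_eq s)

/-- The energy identity. -/
theorem IsFlowLine.hasDerivAt_action (h𝔣 : IsSmoothData 𝔣) (hJ : IsACS J)
    (hu : IsFlowLine 𝔣 J u) (s : ℝ) :
    HasDerivAt (fun s => action 𝔣 (u s).1 (u s).2)
      (-((∫ t in (0 : ℝ)..1, energyDensity J (fun s t => (u s).1 t) s t)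
        + deriv (fun s => (u s).2) s ^ 2)) s := by
  have h := RFH.hasDerivAt_action h𝔣 hu.smooth (fun s => (u s).1.periodic) hu.smooth_η s
  refine h.congr_deriv ?_
  simp only [hu.omega_vel_defect_eq hJ]
  rw [intervalIntegral.integral_neg]
  linear_combination (deriv (fun s => (u s).2) s) * hu.deriv_mult s

theorem IsACS.integral_energyDensity_nonneg (hJ : IsACS J) (X : ℝ → ℝ → Cot n M) (s : ℝ) :
    0 ≤ ∫ t in (0 : ℝ)..1, energyDensity J X s t :=
  intervalIntegral.integral_nonneg zero_le_one fun t _ => hJ.nonneg t _ _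

end FlowLine

/-! ### The uniform bound on the loops -/

/-- The derivative of the integral of `Φ λ` along a family of loops. -/
theorem hasDerivAt_integral_mul_liouville {X : ℝ → ℝ → Cot n M}
    (hX : ContMDiff 𝓘(ℝ, ℝ × ℝ) (cotI n) ∞ (fun p : ℝ × ℝ => X p.1 p.2))
    (hper : ∀ s, Function.Periodic (X s) 1) {Φ : Cot n M → ℝ}
    (hΦ : ContMDiff (cotI n) 𝓘(ℝ, ℝ) ∞ Φ) (s : ℝ) :
    Continuous (fun t => dfun Φ (X s t) (vel (cotI n) (fun σ => X σ t) s)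
          * liouville (X s t) (vel (cotI n) (X s) t)
        - dfun Φ (X s t) (vel (cotI n) (X s) t)
          * liouville (X s t) (vel (cotI n) (fun σ => X σ t) s)
        + Φ (X s t) * omega (X s t) (vel (cotI n) (fun σ => X σ t) s) (vel (cotI n) (X s) t)) ∧
    HasDerivAt (fun s => ∫ t in (0 : ℝ)..1, Φ (X s t) * liouville (X s t) (vel (cotI n) (X s) t))
      (∫ t in (0 : ℝ)..1, (dfun Φ (X s t) (vel (cotI n) (fun σ => X σ t) s)
          * liouville (X s t) (vel (cotI n) (X s) t)
        - dfun Φ (X s t) (vel (cotI n) (X s) t)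
          * liouville (X s t) (vel (cotI n) (fun σ => X σ t) s)
        + Φ (X s t) * omega (X s t) (vel (cotI n) (fun σ => X σ t) s) (vel (cotI n) (X s) t))) s := by
  let l : ℝ × ℝ → ℝ := fun p => liouville (X p.1 p.2) (vel (cotI n) (X p.1) p.2)
  let m : ℝ × ℝ → ℝ := fun p => liouville (X p.1 p.2) (vel (cotI n) (fun σ => X σ p.2) p.1)
  let φ : ℝ × ℝ → ℝ := fun p => Φ (X p.1 p.2)
  have hl : ContDiff ℝ ∞ l := contDiff_liouville_vel_snd hX
  have hm : ContDiff ℝ ∞ m := contDiff_liouville_vel_fst hX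
  have hφ : ContDiff ℝ ∞ φ := (hΦ.comp hX).contDiff
  have hL := hφ.mul hl
  have hM := hφ.mul hm
  have d1 (t : ℝ) : fderiv ℝ (fun p => φ p * l p) (s, t) (1, 0)
      = dfun Φ (X s t) (vel (cotI n) (fun σ => X σ t) s) * l (s, t)
        + φ (s, t) * fderiv ℝ l (s, t) (1, 0) := by
    refine (hasDerivAt_fst hL s t).unique ?_
    have h1 : HasDerivAt (fun σ => φ (σ, t)) (dfun Φ (X s t) (vel (cotI n) (fun σ => X σ t) s)) s :=
      dfun_vel (γ := fun σ => X σ t) (hΦ.mdifferentiable (by simp) _) (mdifferentiable_fst hX t s)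
    exact h1.mul (hasDerivAt_fst hl s t)
  have d2 (t : ℝ) : fderiv ℝ (fun p => φ p * m p) (s, t) (0, 1)
      = dfun Φ (X s t) (vel (cotI n) (X s) t) * m (s, t)
        + φ (s, t) * fderiv ℝ m (s, t) (0, 1) := by
    refine (hasDerivAt_snd hM s t).unique ?_
    have h1 : HasDerivAt (fun τ => φ (s, τ)) (dfun Φ (X s t) (vel (cotI n) (X s) t)) t :=
      dfun_vel (γ := X s) (hΦ.mdifferentiable (by simp) _) (mdifferentiable_snd hX s t)
    exact h1.mul (hasDerivAt_snd hm s t)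
  have hint (t : ℝ) : dfun Φ (X s t) (vel (cotI n) (fun σ => X σ t) s)
          * liouville (X s t) (vel (cotI n) (X s) t)
        - dfun Φ (X s t) (vel (cotI n) (X s) t)
          * liouville (X s t) (vel (cotI n) (fun σ => X σ t) s)
        + Φ (X s t) * omega (X s t) (vel (cotI n) (fun σ => X σ t) s) (vel (cotI n) (X s) t)
      = fderiv ℝ (fun p => φ p * l p) (s, t) (1, 0)
        - fderiv ℝ (fun p => φ p * m p) (s, t) (0, 1) := by
    have h := curl_liouville (X := fun p : ℝ × ℝ => X p.1 p.2) (s := s) (t := t) (hX _)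
    rw [d1, d2]
    have h' : fderiv ℝ l (s, t) (1, 0) - fderiv ℝ m (s, t) (0, 1)
      = omega (X s t) (vel (cotI n) (fun σ => X σ t) s) (vel (cotI n) (X s) t) := h
    rw [← h']
    change _ * l (s, t) - _ * m (s, t) + φ (s, t) * _ = _
    ring
  have c1 := continuous_slice (continuous_fderiv_apply hL (1, 0)) s
  have c2 := continuous_slice (continuous_fderiv_apply hM (0, 1)) s
  simp only [hint]
  refine ⟨c1.sub c2, ?_⟩
  rw [intervalIntegral.integral_sub (c1.intervalIntegrable _ _) (c2.intervalIntegrable _ _)]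
  have hb : ∫ t in (0 : ℝ)..1, fderiv ℝ (fun p => φ p * m p) (s, t) (0, 1) = 0 := by
    rw [intervalIntegral.integral_eq_sub_of_hasDerivAt (fun t _ => hasDerivAt_snd hM s t)
      (c2.intervalIntegrable _ _)]
    have h01 : (fun σ => X σ 1) = fun σ => X σ 0 := by
      funext σ; simpa using hper σ 0
    have hgen : ∀ γ γ' : ℝ → Cot n M, γ = γ' →
        Φ (γ s) * liouville (γ s) (vel (cotI n) γ s)
          = Φ (γ' s) * liouville (γ' s) (vel (cotI n) γ' s) := by
      rintro γ _ rfl; rfl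
    exact sub_eq_zero.2 (hgen _ _ h01)
  rw [hb, sub_zero]
  exact hasDerivAt_integral_slice hL s

theorem vel_add_const {N E H : Type*} [NormedAddCommGroup E] [NormedSpace ℝ E] [TopologicalSpace H]
    {I : ModelWithCorners ℝ E H} [TopologicalSpace N] [ChartedSpace H N] {γ : ℝ → N} {t : ℝ} (c : ℝ)
    (hγ : MDifferentiableAt 𝓘(ℝ, ℝ) I γ (t + c)) :
    vel I (fun τ => γ (τ + c)) t = vel I γ (t + c) := by
  have h1 : HasMFDerivAt 𝓘(ℝ, ℝ) 𝓘(ℝ, ℝ) (fun τ : ℝ => τ + c) t (ContinuousLinearMap.id ℝ ℝ) :=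
    ((hasFDerivAt_id (𝕜 := ℝ) t).add_const c).hasMFDerivAt
  exact DFunLike.congr_fun (hγ.hasMFDerivAt.comp t h1).mfderiv (1 : ℝ)

/-- The velocity of a loop is periodic. -/
theorem velT_periodic {N E H : Type*} [NormedAddCommGroup E] [NormedSpace ℝ E] [TopologicalSpace H]
    {I : ModelWithCorners ℝ E H} [TopologicalSpace N] [ChartedSpace H N] {γ : ℝ → N} {c : ℝ}
    (hγ : MDifferentiable 𝓘(ℝ, ℝ) I γ) (hp : Function.Periodic γ c) :
    Function.Periodic (velT I γ) c := by
  intro t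
  have h1 : velT I (fun τ => γ (τ + c)) t = velT I γ t :=
    congrArg (fun γ' : ℝ → N => velT I γ' t) (funext hp)
  refine Eq.trans ?_ h1
  exact congrArg (fun v => (⟨γ (t + c), v⟩ : TangentBundle I N)) (vel_add_const c (hγ _)).symm

/-- The radial cut-off `β(r - R) / (1 + r)`. -/
def radialCutoff (J : EndField n M) (R : ℝ) (z : Cot n M) : ℝ :=
  Real.smoothTransition (radius J z - R) / (1 + radius J z)

theorem IsACS.contMDiff_radialCutoff {J : EndField n M} (hJ : IsACS J) (R : ℝ) :
    ContMDiff (cotI n) 𝓘(ℝ, ℝ) ∞ (radialCutoff J R) := by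
  intro z
  have h : ContDiffAt ℝ ∞ (fun r : ℝ => Real.smoothTransition (r - R) / (1 + r)) (radius J z) := by
    refine ContDiffAt.div ?_ (by fun_prop) (by linarith [hJ.radius_nonneg z])
    exact (Real.smoothTransition.contDiff (n := ⊤)).contDiffAt.comp _ (by fun_prop)
  exact ContMDiffAt.comp z h.contMDiffAt (hJ.contMDiff_radius z)

theorem IsACS.dfun_radialCutoff {J : EndField n M} (hJ : IsACS J) (R : ℝ) (z : Cot n M)
    (v : TangentSpace (cotI n) z) :
    dfun (radialCutoff J R) z v
      = (deriv Real.smoothTransition (radius J z - R) / (1 + radius J z)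
        - Real.smoothTransition (radius J z - R) / (1 + radius J z) ^ 2) * dfun (radius J) z v := by
  have hr := hJ.radius_nonneg z
  have h1 : HasDerivAt (fun r : ℝ => Real.smoothTransition (r - R) / (1 + r))
      (deriv Real.smoothTransition (radius J z - R) / (1 + radius J z)
        - Real.smoothTransition (radius J z - R) / (1 + radius J z) ^ 2) (radius J z) := by
    have h2 : HasDerivAt Real.smoothTransition (deriv Real.smoothTransition (radius J z - R))
        (radius J z - R) :=
      (((Real.smoothTransition.contDiff (n := ⊤)).differentiable (by simp)) _).hasDerivAt
    have h3 := (h2.comp_sub_const (radius J z) R).div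
      ((hasDerivAt_id (radius J z)).const_add 1) (by simp only [id]; linarith)
    refine h3.congr_deriv ?_
    simp only [id]
    field_simp
  have h4 := h1.hasFDerivAt.hasMFDerivAt.comp z
    (hJ.contMDiff_radius.mdifferentiable (by simp) z).hasMFDerivAt
  refine (DFunLike.congr_fun h4.mfderiv v).trans ?_
  exact mul_comm (dfun (radius J) z v) _

theorem deriv_smoothTransition_eq_zero {x : ℝ} (hx : x ≤ 0) :
    deriv Real.smoothTransition x = 0 := by
  refine IsLocalMin.deriv_eq_zero (Filter.Eventually.of_forall fun y => ?_)
  rw [Real.smoothTransition.zero_of_nonpos hx]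
  exact Real.smoothTransition.nonneg y

/-- On complex lines the form `-d(Ψλ)`, where `Ψ` is the radial cut-off, dominates a positive
multiple of the metric. -/
theorem IsConvexACS.cutoff_estimate [T2Space M] [ConnectedSpace M] {J : EndField n M}
    {S : Set (Cot n M)} (hS : IsStarshaped S) (hJ : IsConvexACS S J) {R : ℝ}
    (hR : ∀ z ∈ region S, radius J z ≤ R) (t : ℝ) (z : Cot n M) (v w : TangentSpace (cotI n) z)
    (hw : R < radius J z → w = J t z v) :
    Real.smoothTransition (radius J z - R) / (1 + radius J z) ^ 2 * omega z (J t z v) v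
      ≤ -(dfun (radialCutoff J R) z v * liouville z w - dfun (radialCutoff J R) z w * liouville z v
        + radialCutoff J R z * omega z v w) := by
  have hr := hJ.radius_nonneg z
  rw [hJ.dfun_radialCutoff, hJ.dfun_radialCutoff, radialCutoff]
  rcases le_or_gt (radius J z) R with hle | hlt
  · rw [deriv_smoothTransition_eq_zero (sub_nonpos.2 hle),
      Real.smoothTransition.zero_of_nonpos (sub_nonpos.2 hle)]
    simp
  · have hz : z ∉ region S := fun h => absurd (hR z h) (not_le.2 hlt)
    obtain ⟨h0, h1⟩ := hJ.wedge_bounds hS hz t v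
    rw [hw hlt, omega_antisymm z v]
    have hβ := Real.smoothTransition.nonneg (radius J z - R)
    have hβ' : 0 ≤ deriv Real.smoothTransition (radius J z - R) :=
      Real.smoothTransition.monotone.deriv_nonneg
    generalize Real.smoothTransition (radius J z - R) = β at *
    generalize deriv Real.smoothTransition (radius J z - R) = β' at *
    generalize omega z (J t z v) v = e at *
    set Q := dfun (radius J) z (J t z v) * liouville z v
      - dfun (radius J) z v * liouville z (J t z v) with hQ
    set r := radius J z
    have h2 : -((β' / (1 + r) - β / (1 + r) ^ 2) * dfun (radius J) z v * liouville z (J t z v)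
        - (β' / (1 + r) - β / (1 + r) ^ 2) * dfun (radius J) z (J t z v) * liouville z v
        + β / (1 + r) * -e)
        = β / (1 + r) ^ 2 * e + (β' / (1 + r) * Q + β / (1 + r) ^ 2 * (r * e - Q)) := by
      rw [hQ]; field_simp; ring
    rw [h2]
    have h3 : 0 ≤ β' / (1 + r) * Q := by positivity
    have h4 : 0 ≤ β / (1 + r) ^ 2 * (r * e - Q) := mul_nonneg (by positivity) (by linarith)
    linarith

/-- At the point `z` the Hamiltonian vector fields of `F` and of all `H_t`, as well as the values
of `H_t`, vanish.  (The value of `F` need not vanish.) -/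
structure IsTrivialAt (𝔣 : Data n M) (z : Cot n M) : Prop where
  hamVF_F : hamVF 𝔣.F z = 0
  hamVF_H : ∀ t, hamVF (𝔣.H t) z = 0
  H : ∀ t, 𝔣.H t z = 0

theorem IsTrivialAt.defect_eq {𝔣 : Data n M} {x : ℝ → Cot n M} {t : ℝ}
    (h : IsTrivialAt 𝔣 (x t)) (η : ℝ) : defect 𝔣 x η t = vel (cotI n) x t := by
  rw [defect, h.hamVF_F, h.hamVF_H, smul_zero, sub_zero, sub_zero]

theorem eq_zero_of_integral_eq_zero {h : ℝ → ℝ} (hc : Continuous h) (h0 : ∀ t, 0 ≤ h t)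
    (hi : ∫ t in (0 : ℝ)..1, h t = 0) {t : ℝ} (ht : t ∈ Set.Icc (0 : ℝ) 1) : h t = 0 := by
  by_contra hne
  have hpos : 0 < h t := (h0 t).lt_of_ne (Ne.symm hne)
  have := intervalIntegral.integral_pos zero_lt_one hc.continuousOn (fun x _ => h0 x)
    ⟨t, ht, hpos⟩
  exact this.ne' hi

/-- Jensen's inequality for the square on intervals of length at most one. -/
theorem sq_integral_le {h : ℝ → ℝ} (hc : Continuous h) {t₁ t₂ : ℝ} (h12 : t₁ ≤ t₂)
    (hle : t₂ - t₁ ≤ 1) : (∫ t in t₁..t₂, h t) ^ 2 ≤ ∫ t in t₁..t₂, h t ^ 2 := by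
  set m := ∫ t in t₁..t₂, h t with hm
  have h1 : 0 ≤ ∫ t in t₁..t₂, (h t - m) ^ 2 :=
    intervalIntegral.integral_nonneg h12 fun t _ => sq_nonneg _
  have h2 : ∫ t in t₁..t₂, (h t - m) ^ 2
      = (∫ t in t₁..t₂, h t ^ 2) - 2 * m * (∫ t in t₁..t₂, h t) + (t₂ - t₁) * m ^ 2 := by
    have e : ∀ t, (h t - m) ^ 2 = h t ^ 2 - 2 * m * h t + m ^ 2 := fun t => by ring
    simp only [e]
    rw [intervalIntegral.integral_add, intervalIntegral.integral_sub,
      intervalIntegral.integral_const_mul, intervalIntegral.integral_const, smul_eq_mul]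
    all_goals exact Continuous.intervalIntegrable (by fun_prop) _ _
  rw [h2, ← hm] at h1
  nlinarith [mul_le_mul_of_nonneg_right hle (sq_nonneg m)]

section LoopBound

variable [T2Space M] [ConnectedSpace M] {𝔣 : Data n M} {J : EndField n M} {S : Set (Cot n M)}
  {u : ℝ → SmoothLoop (cotI n) (Cot n M) × ℝ} {R a b : ℝ}

/-- Along a gradient flow line with bounded action both partial derivatives vanish at the points
where the radius is large: the integral of `Ψ λ` over the loops is monotone in `s`, and its square is
bounded by the energy density, so it vanishes together with its derivative. -/
theorem IsFlowLine.vel_eq_zero_of_far (h𝔣 : IsSmoothData 𝔣) (hS : IsStarshaped S)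
    (hJ : IsConvexACS S J) (hu : IsFlowLine 𝔣 J u)
    (hA : ∀ s, action 𝔣 (u s).1 (u s).2 ∈ Set.Ioo a b)
    (hR : ∀ z ∈ region S, radius J z ≤ R) (hfar : ∀ z, R < radius J z → IsTrivialAt 𝔣 z)
    (s : ℝ) {t : ℝ} (ht : t ∈ Set.Icc (0 : ℝ) 1) (hz : R < radius J ((u s).1 t)) :
    vel (cotI n) (fun σ => (u σ).1 t) s = 0 ∧ vel (cotI n) (u s).1 t = 0 := by
  let X : ℝ → ℝ → Cot n M := fun s t => (u s).1 t
  have hXt (s t : ℝ) (h : R < radius J (X s t)) :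
      vel (cotI n) (X s) t = J t (X s t) (vel (cotI n) (fun σ => X σ t) s) := by
    refine Eq.trans ?_ (hu.map_vel_eq_defect hJ.toIsACS s t).symm
    exact ((hfar _ h).defect_eq _).symm
  let Φ := radialCutoff J R
  have hΦ : ContMDiff (cotI n) 𝓘(ℝ, ℝ) ∞ Φ := hJ.contMDiff_radialCutoff R
  let G : ℝ → ℝ := fun s => ∫ t in (0 : ℝ)..1, Φ (X s t) * liouville (X s t) (vel (cotI n) (X s) t)
  have hD (s : ℝ) := hasDerivAt_integral_mul_liouville (X := X) hu.smooth
    (fun s => (u s).1.periodic) hΦ s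
  have hest (s t : ℝ) := hJ.cutoff_estimate hS hR t (X s t) (vel (cotI n) (fun σ => X σ t) s)
    (vel (cotI n) (X s) t) (hXt s t)
  have hnn (s t : ℝ) : 0 ≤ Real.smoothTransition (radius J (X s t) - R) / (1 + radius J (X s t)) ^ 2
      * omega (X s t) (J t (X s t) (vel (cotI n) (fun σ => X σ t) s))
        (vel (cotI n) (fun σ => X σ t) s) :=
    mul_nonneg (div_nonneg (Real.smoothTransition.nonneg _) (sq_nonneg _)) (hJ.nonneg t _ _)
  -- `-G` is monotone because `-d(Ψλ)` is non-negative on complex lines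
  have hmono : Monotone fun s => -G s := by
    refine monotone_of_hasDerivAt_nonneg (fun s => (hD s).2.neg) fun s => ?_
    change 0 ≤ -∫ t in (0 : ℝ)..1, _
    rw [← intervalIntegral.integral_neg]
    exact intervalIntegral.integral_nonneg zero_le_one fun t _ => (hnn s t).trans (hest s t)
  -- `G²` is at most the energy density as `Ψ² |λ|² ≤ Ψ² r |∂ₜx|² ≤ |∂ₜx|²`
  have hsq (s : ℝ) : (-G s) ^ 2 ≤ -(-((∫ t in (0 : ℝ)..1, energyDensity J X s t)
        + deriv (fun s => (u s).2) s ^ 2)) := by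
    have hc : Continuous fun t => Φ (X s t) * liouville (X s t) (vel (cotI n) (X s) t) :=
      continuous_slice (((hΦ.comp hu.smooth).continuous).mul
        (contDiff_liouville_vel_snd (X := X) hu.smooth).continuous) s
    have he : Continuous fun t => energyDensity J X s t :=
      continuous_slice (hu.continuous_energyDensity h𝔣 hJ.toIsACS) s
    have h1 : ∫ t in (0 : ℝ)..1, (Φ (X s t) * liouville (X s t) (vel (cotI n) (X s) t)) ^ 2
        ≤ ∫ t in (0 : ℝ)..1, energyDensity J X s t := by
      refine intervalIntegral.integral_mono_on zero_le_one ((hc.pow 2).intervalIntegrable _ _)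
        (he.intervalIntegrable _ _) fun t _ => ?_
      have hr := hJ.radius_nonneg (X s t)
      rcases le_or_gt (radius J (X s t)) R with hle | hlt
      · have h0 : Φ (X s t) = 0 := by
          change radialCutoff J R (X s t) = 0
          rw [radialCutoff, Real.smoothTransition.zero_of_nonpos (sub_nonpos.2 hle), zero_div]
        rw [h0, zero_mul, zero_pow two_ne_zero]
        exact hJ.nonneg t _ _
      · have h2 := hJ.liouville_sq_le t (X s t) (vel (cotI n) (X s) t)
        have hz : X s t ∉ region S := fun h => absurd (hR _ h) (not_le.2 hlt)
        rw [hXt s t hlt, hJ.omega_map_map] at h2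
        have h3 : omega (X s t) (J t (X s t) (liouvilleVF (X s t))) (liouvilleVF (X s t))
            = radius J (X s t) := by
          rw [hJ.indep t 0 _ fun h => hz (interior_subset h)]; rfl
        rw [h3] at h2
        rw [hXt s t hlt, mul_pow]
        have hβ0 := Real.smoothTransition.nonneg (radius J (X s t) - R)
        have hβ1 := Real.smoothTransition.le_one (radius J (X s t) - R)
        have hΦr : Φ (X s t) ^ 2 * radius J (X s t) ≤ 1 := by
          change (Real.smoothTransition (radius J (X s t) - R) / (1 + radius J (X s t))) ^ 2
            * radius J (X s t) ≤ 1
          rw [div_pow, div_mul_eq_mul_div, div_le_one (by positivity)]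
          nlinarith [pow_le_one₀ hβ0 hβ1 (n := 2)]
        have he0 : 0 ≤ energyDensity J X s t := hJ.nonneg t _ _
        calc _ ≤ Φ (X s t) ^ 2 * (radius J (X s t) * energyDensity J X s t) :=
              mul_le_mul_of_nonneg_left h2 (sq_nonneg _)
          _ = Φ (X s t) ^ 2 * radius J (X s t) * energyDensity J X s t := by ring
          _ ≤ 1 * energyDensity J X s t := mul_le_mul_of_nonneg_right hΦr he0
          _ = _ := one_mul _
    have h2 := sq_integral_le hc zero_le_one (by norm_num)
    have h3 := sq_nonneg (deriv (fun s => (u s).2) s)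
    rw [neg_sq, neg_neg]
    have h4 : G s ^ 2 ≤ _ := h2
    linarith
  have hG := eq_zero_of_sq_le_neg_deriv (hu.hasDerivAt_action h𝔣 hJ.toIsACS) hA hmono hsq
  have hG' : (fun s => -G s) = fun _ => 0 := funext hG
  -- hence the integrand of `G'` vanishes, and it dominates the energy density where `Ψ > 0`
  have hd := (hD s).2.neg
  have hd0 : HasDerivAt (fun s => -G s) 0 s := by rw [hG']; exact hasDerivAt_const s 0
  have hi := hd.unique hd0
  rw [← intervalIntegral.integral_neg] at hi
  have h0 := eq_zero_of_integral_eq_zero (hD s).1.neg (fun t => (hnn s t).trans (hest s t)) hi ht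
  have h1 := (hest s t).trans h0.le
  have hβ := Real.smoothTransition.pos_of_pos (sub_pos.2 hz)
  have hr := hJ.radius_nonneg (X s t)
  have h2 : vel (cotI n) (fun σ => X σ t) s = 0 := by
    refine hJ.eq_zero (t := t) ?_
    by_contra hcon
    exact absurd h1 (not_le.2 (mul_pos (div_pos hβ (by positivity)) (not_le.1 hcon)))
  refine ⟨h2, (hXt s t hz).trans ?_⟩
  rw [h2]
  exact ContinuousLinearMap.map_zero _

end LoopBound

section LoopBound

variable {𝔣 : Data n M} {J : EndField n M} {S : Set (Cot n M)}
  {u : ℝ → SmoothLoop (cotI n) (Cot n M) × ℝ} {R a b : ℝ}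

theorem vel_const {N E H : Type*} [NormedAddCommGroup E] [NormedSpace ℝ E] [TopologicalSpace H]
    {I : ModelWithCorners ℝ E H} [TopologicalSpace N] [ChartedSpace H N] (z : N) (t : ℝ) :
    vel I (fun _ : ℝ => z) t = 0 := by
  rw [vel, mfderiv_const]; rfl

/-- A gradient flow line that consists of constant loops at one point where the Hamiltonians are
trivial has unbounded action: the multiplier has to decrease at a rate bounded away from zero. -/
theorem IsFlowLine.false_of_const (h𝔣 : IsSmoothData 𝔣) (hf : IsF 𝔣.f)
    (hχ : ∫ t in (0 : ℝ)..1, 𝔣.χ t = 1) (hu : IsFlowLine 𝔣 J u) (ha : 0 < a)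
    (hA : ∀ s, action 𝔣 (u s).1 (u s).2 ∈ Set.Ioo a b) {z : Cot n M} (hz : IsTrivialAt 𝔣 z)
    (hc : ∀ s t, (u s).1 t = z) : False := by
  have hx (s : ℝ) : (u s).1.toFun = fun _ => z := funext (hc s)
  have hFz : ∫ t in (0 : ℝ)..1, 𝔣.χ t * 𝔣.F z = 𝔣.F z := by
    rw [intervalIntegral.integral_mul_const, hχ, one_mul]
  have hact (s : ℝ) : action 𝔣 (u s).1 (u s).2 = -(𝔣.f (u s).2 * 𝔣.F z) := by
    rw [hx s, action]
    simp only [hz.H, vel_const, liouville_zero, hFz]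
    simp
  have hmult (s : ℝ) : deriv (fun s => (u s).2) s = deriv 𝔣.f (u s).2 * 𝔣.F z := by
    rw [hu.deriv_mult, hx s, hFz]
  have hFneg : 𝔣.F z < 0 := by
    have h1 := (hA 0).1
    rw [hact 0] at h1
    by_contra hcon
    have := mul_nonneg (hf.pos (u 0).2).le (not_lt.1 hcon)
    linarith
  set η : ℝ → ℝ := fun s => (u s).2 with hη
  have hηd : Differentiable ℝ η := hu.smooth_η.differentiable (by simp)
  have hanti : Antitone η := by
    refine antitone_of_deriv_nonpos hηd fun s => ?_
    rw [hmult]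
    exact mul_nonpos_of_nonneg_of_nonpos (hf.deriv_pos _).le hFneg.le
  -- the multiplier is bounded below because the action is
  obtain ⟨B, hB⟩ : ∃ B, ∀ s, B < η s := by
    have h1 : ∀ᶠ y in Filter.atBot, 𝔣.f y < a / -𝔣.F z :=
      hf.limit.eventually (gt_mem_nhds (div_pos ha (neg_pos.2 hFneg)))
    obtain ⟨B, hB⟩ := h1.exists
    refine ⟨B, fun s => hf.strictMono.lt_iff_lt.1 (hB.trans ?_)⟩
    rw [div_lt_iff₀ (neg_pos.2 hFneg)]
    have h2 := (hA s).1
    rw [hact s] at h2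
    change a < 𝔣.f (u s).2 * _
    linarith
  have hcf : Continuous (deriv 𝔣.f) := h𝔣.f.continuous_deriv (by simp)
  have hne : (Set.Icc B (η 0)).Nonempty := Set.nonempty_Icc.2 (hB 0).le
  obtain ⟨y, -, hy⟩ := isCompact_Icc.exists_isMinOn hne hcf.continuousOn
  have hm : 0 < deriv 𝔣.f y * -𝔣.F z := mul_pos (hf.deriv_pos y) (neg_pos.2 hFneg)
  have hle (s : ℝ) (hs : 0 ≤ s) : deriv η s ≤ -(deriv 𝔣.f y * -𝔣.F z) := by
    have h1 : deriv 𝔣.f y ≤ deriv 𝔣.f (η s) := hy ⟨(hB s).le, hanti hs⟩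
    rw [hmult]
    change deriv 𝔣.f (η s) * _ ≤ _
    nlinarith
  set m := deriv 𝔣.f y * -𝔣.F z
  have hL : 0 ≤ (η 0 - B) / m := div_nonneg (by linarith [hB 0]) hm.le
  have h1 := (convex_Ici (0 : ℝ)).image_sub_le_mul_sub_of_deriv_le hηd.continuous.continuousOn
    hηd.differentiableOn (C := -m) (fun s hs => hle s (interior_subset hs)) 0 Set.self_mem_Ici
    ((η 0 - B) / m) hL hL
  have h2 : -m * ((η 0 - B) / m - 0) = -(η 0 - B) := by field_simp; ring
  have := hB ((η 0 - B) / m)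
  linarith

/-- The loops of a gradient flow line with bounded action stay in the region where the radius is
at most `R`, as soon as the Hamiltonians are trivial outside of this region. -/
theorem IsFlowLine.radius_le [T2Space M] [ConnectedSpace M] (h𝔣 : IsSmoothData 𝔣) (hf : IsF 𝔣.f)
    (hχ : ∫ t in (0 : ℝ)..1, 𝔣.χ t = 1) (hS : IsStarshaped S)
    (hJ : IsConvexACS S J) (hu : IsFlowLine 𝔣 J u) (ha : 0 < a)
    (hA : ∀ s, action 𝔣 (u s).1 (u s).2 ∈ Set.Ioo a b)
    (hR : ∀ z ∈ region S, radius J z ≤ R) (hfar : ∀ z, R < radius J z → IsTrivialAt 𝔣 z)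
    (s t : ℝ) : radius J ((u s).1 t) ≤ R := by
  by_contra hcon
  obtain ⟨t₀, ht₀, htt⟩ := (u s).1.periodic.exists_mem_Ico₀ one_pos t
  have hz₀ : R < radius J ((u s).1 t₀) := by rw [← htt]; exact not_le.1 hcon
  have hO : IsOpen {z | R < radius J z} := isOpen_lt continuous_const hJ.contMDiff_radius.continuous
  have hvel (s t : ℝ) (h : R < radius J ((u s).1 t)) : vel (cotI n) (u s).1 t = 0 := by
    have hper : Function.Periodic (fun t => R < radius J (velT (cotI n) (u s).1 t).1 →
        (velT (cotI n) (u s).1 t).2 = 0) 1 := fun t => by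
      exact congrArg (fun p : TangentBundle (cotI n) (Cot n M) => R < radius J p.1 → p.2 = 0)
        (velT_periodic ((u s).1.smooth.mdifferentiable (by simp)) (u s).1.periodic t)
    obtain ⟨t₁, ht₁, h₁⟩ := hper.exists_mem_Ico₀ one_pos t
    have h2 : R < radius J (velT (cotI n) (u s).1 t₁).1 → (velT (cotI n) (u s).1 t₁).2 = 0 :=
      fun h' => (hu.vel_eq_zero_of_far h𝔣 hS hJ hA hR hfar s ⟨ht₁.1, ht₁.2.le⟩ h').2
    rw [← h₁] at h2
    exact h2 h
  have hconst_s (s' : ℝ) : (u s').1 t₀ = (u s).1 t₀ :=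
    curve_const_of_vel_eq_zero (γ := fun σ => (u σ).1 t₀)
      (mdifferentiable_fst (X := fun s t => (u s).1 t) hu.smooth t₀) hO
      (fun s' h => (hu.vel_eq_zero_of_far h𝔣 hS hJ hA hR hfar s' ⟨ht₀.1, ht₀.2.le⟩ h).1) hz₀ s'
  have hconst (s' t' : ℝ) : (u s').1 t' = (u s).1 t₀ := by
    rw [← hconst_s s']
    refine curve_const_of_vel_eq_zero ((u s').1.smooth.mdifferentiable (by simp)) hO
      (fun t h => hvel s' t h) (t₀ := t₀) ?_ t'
    rw [hconst_s s']
    exact hz₀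
  exact hu.false_of_const h𝔣 hf hχ ha hA (hfar _ hz₀) hconst

end LoopBound

/-! ### The uniform bound on the multipliers -/

section Multiplier

variable {𝔣 : Data n M} {J : EndField n M}

theorem IsChi.integral_eq_one {χ : ℝ → ℝ} {t₀ : ℝ} (hχ : IsChi χ t₀) :
    ∫ t in (0 : ℝ)..1, χ t = 1 :=
  hχ.eq_one 1 ⟨hχ.t₀_le, le_rfl⟩

theorem IsChi.eq_zero {χ : ℝ → ℝ} {t₀ : ℝ} (hχ : IsChi χ t₀) {t : ℝ} (ht : t₀ < t) (ht1 : t ≤ 1) :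
    χ t = 0 := by
  by_contra hne
  have hc := hχ.smooth.continuous
  have hpos := (hχ.nonneg t).lt_of_ne (Ne.symm hne)
  have h1 := intervalIntegral.integral_pos (ht.trans_le ht1) hc.continuousOn
    (fun x _ => hχ.nonneg x) ⟨t, ⟨ht.le, ht1⟩, hpos⟩
  have h2 := intervalIntegral.integral_add_adjacent_intervals
    (hc.intervalIntegrable (μ := MeasureTheory.volume) 0 t₀) (hc.intervalIntegrable t₀ 1)
  rw [hχ.integral_eq_one, hχ.eq_one t₀ ⟨le_rfl, hχ.t₀_le⟩] at h2
  linarith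

/-- The support of `χ` in the period interval lies in `[0, t₀]`, where `H` vanishes. -/
theorem IsData₀.exists_isChi (h𝔣 : IsData₀ 𝔣) :
    ∃ t₀, IsChi 𝔣.χ t₀ ∧ ∀ t ∈ Set.Icc 0 t₀, ∀ z, hamVF (𝔣.H t) z = 0 := by
  rcases h𝔣.split with h | ⟨t₀, h, ht₀⟩
  · obtain ⟨t₀, ht₀⟩ := h𝔣.χ_mem
    refine ⟨t₀, ht₀, fun t _ z => hamVF_eq_zero_of_eventually (Filter.Eventually.of_forall ?_)⟩
    intro y; rw [h]; rfl
  · refine ⟨t₀, h, fun t ht z => hamVF_eq_zero_of_eventually (Filter.Eventually.of_forall ?_)⟩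
    exact h𝔣.H_mem.zero t ⟨ht.1, ht.2.trans ht₀.le⟩

theorem IsData₀.isSmoothData (h𝔣 : IsData₀ 𝔣) : IsSmoothData 𝔣 where
  F := h𝔣.F_mem.choose_spec.2.smooth
  f := h𝔣.f_mem.smooth
  χ := h𝔣.χ_mem.choose_spec.smooth
  H := h𝔣.H_mem.smooth

theorem abs_integral_le_of_kappa_le {H : ℝ → Cot n M → ℝ} {c : ℝ} (hc : 0 ≤ c)
    (hH : kappa H ≤ ENNReal.ofReal c) (x : SmoothLoop (cotI n) (Cot n M)) :
    |∫ t in (0 : ℝ)..1, (liouville (x t) (hamVF (H t) (x t)) - H t (x t))| ≤ c :=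
  (ENNReal.ofReal_le_ofReal_iff hc).1 ((le_iSup (fun x : SmoothLoop (cotI n) (Cot n M) =>
    ENNReal.ofReal |∫ t in (0 : ℝ)..1, (liouville (x t) (hamVF (H t) (x t)) - H t (x t))|) x).trans
    hH)

variable {x : ℝ → Cot n M}

theorem continuous_liouville_vel (hx : ContMDiff 𝓘(ℝ, ℝ) (cotI n) ∞ x) :
    Continuous fun t => liouville (x t) (vel (cotI n) x t) :=
  (contMDiff_liouville.comp (contMDiff_vel hx)).continuous

theorem continuous_liouville_hamVF_F (h𝔣 : IsSmoothData 𝔣) :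
    Continuous fun z => liouville z (hamVF 𝔣.F z) :=
  (contMDiff_liouville.comp (contMDiff_hamVF_autonomous h𝔣.F)).continuous

theorem continuous_hamVF_H (h𝔣 : IsSmoothData 𝔣) (hx : ContMDiff 𝓘(ℝ, ℝ) (cotI n) ∞ x) :
    Continuous fun t => (⟨x t, hamVF (𝔣.H t) (x t)⟩ : TangentBundle (cotI n) (Cot n M)) := by
  have h1 : ContMDiff 𝓘(ℝ, ℝ) (𝓘(ℝ, ℝ).prod (cotI n)) ∞ (fun t : ℝ => (t, x t)) :=
    contMDiff_id.prodMk hx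
  exact ((contMDiff_hamVF h𝔣.H).comp h1).continuous

theorem continuous_H_curve (h𝔣 : IsSmoothData 𝔣) (hx : ContMDiff 𝓘(ℝ, ℝ) (cotI n) ∞ x) :
    Continuous fun t => 𝔣.H t (x t) := by
  have h1 : ContMDiff 𝓘(ℝ, ℝ) (𝓘(ℝ, ℝ).prod (cotI n)) ∞ (fun t : ℝ => (t, x t)) :=
    contMDiff_id.prodMk hx
  exact (h𝔣.H.comp h1).continuous

theorem liouville_defect (𝔣 : Data n M) (x : ℝ → Cot n M) (η t : ℝ) :
    liouville (x t) (defect 𝔣 x η t) = liouville (x t) (vel (cotI n) x t)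
      - 𝔣.f η * 𝔣.χ t * liouville (x t) (hamVF 𝔣.F (x t))
      - liouville (x t) (hamVF (𝔣.H t) (x t)) := by
  rw [defect, liouville_sub, liouville_sub, liouville_smul]

theorem continuous_liouville_defect (h𝔣 : IsSmoothData 𝔣) (hx : ContMDiff 𝓘(ℝ, ℝ) (cotI n) ∞ x)
    (η : ℝ) : Continuous fun t => liouville (x t) (defect 𝔣 x η t) := by
  simp only [liouville_defect]
  have h1 := continuous_liouville_vel hx
  have h2 : Continuous fun t => liouville (x t) (hamVF 𝔣.F (x t)) :=
    (continuous_liouville_hamVF_F h𝔣).comp hx.continuous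
  have h3 : Continuous fun t => liouville (x t) (hamVF (𝔣.H t) (x t)) :=
    contMDiff_liouville.continuous.comp (continuous_hamVF_H h𝔣 hx)
  exact (h1.sub ((continuous_const.mul h𝔣.χ.continuous).mul h2)).sub h3

/-- The action in terms of the defect of the equation for critical points. -/
theorem action_eq (h𝔣 : IsSmoothData 𝔣) (hx : ContMDiff 𝓘(ℝ, ℝ) (cotI n) ∞ x) (η : ℝ) :
    action 𝔣 x η = (∫ t in (0 : ℝ)..1, liouville (x t) (defect 𝔣 x η t))
      + 𝔣.f η * (∫ t in (0 : ℝ)..1, 𝔣.χ t * (liouville (x t) (hamVF 𝔣.F (x t)) - 𝔣.F (x t)))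
      + ∫ t in (0 : ℝ)..1, (liouville (x t) (hamVF (𝔣.H t) (x t)) - 𝔣.H t (x t)) := by
  have h1 := continuous_liouville_defect h𝔣 hx η
  have h2 : Continuous fun t => liouville (x t) (hamVF 𝔣.F (x t)) :=
    (continuous_liouville_hamVF_F h𝔣).comp hx.continuous
  have h3 : Continuous fun t => liouville (x t) (hamVF (𝔣.H t) (x t)) :=
    contMDiff_liouville.continuous.comp (continuous_hamVF_H h𝔣 hx)
  have h4 := continuous_H_curve h𝔣 hx
  have h5 : Continuous fun t => 𝔣.F (x t) := h𝔣.F.continuous.comp hx.continuous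
  have hχ := h𝔣.χ.continuous
  have e : ∀ t, liouville (x t) (vel (cotI n) x t) = liouville (x t) (defect 𝔣 x η t)
      + 𝔣.f η * (𝔣.χ t * liouville (x t) (hamVF 𝔣.F (x t)))
      + liouville (x t) (hamVF (𝔣.H t) (x t)) := fun t => by rw [liouville_defect]; ring
  have i1 := h1.intervalIntegrable (μ := MeasureTheory.volume) 0 1
  have i2 : IntervalIntegrable (fun t => 𝔣.χ t * liouville (x t) (hamVF 𝔣.F (x t)))
    MeasureTheory.volume 0 1 := (hχ.mul h2).intervalIntegrable 0 1
  have i3 := h3.intervalIntegrable (μ := MeasureTheory.volume) 0 1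
  have i4 := h4.intervalIntegrable (μ := MeasureTheory.volume) 0 1
  have i5 : IntervalIntegrable (fun t => 𝔣.χ t * 𝔣.F (x t)) MeasureTheory.volume 0 1 :=
    (hχ.mul h5).intervalIntegrable 0 1
  simp only [action, e, mul_sub]
  rw [intervalIntegral.integral_add (i1.add (i2.const_mul _)) i3,
    intervalIntegral.integral_add i1 (i2.const_mul _), intervalIntegral.integral_const_mul,
    intervalIntegral.integral_sub i2 i5, intervalIntegral.integral_sub i3 i4]
  ring

/-- Along a curve the derivative of `F` only sees the defect where `X_H` vanishes. -/
theorem hasDerivAt_F_curve (h𝔣 : IsSmoothData 𝔣) (hx : ContMDiff 𝓘(ℝ, ℝ) (cotI n) ∞ x) (η : ℝ)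
    {t : ℝ} (hH : hamVF (𝔣.H t) (x t) = 0) :
    HasDerivAt (fun τ => 𝔣.F (x τ)) (dfun 𝔣.F (x t) (defect 𝔣 x η t)) t := by
  have h1 : HasDerivAt (fun τ => 𝔣.F (x τ)) (dfun 𝔣.F (x t) (vel (cotI n) x t)) t :=
    dfun_vel (h𝔣.F.mdifferentiable (by simp) _) (hx.mdifferentiable (by simp) t)
  refine h1.congr_deriv ?_
  have h2 : vel (cotI n) x t = defect 𝔣 x η t + (𝔣.f η * 𝔣.χ t) • hamVF 𝔣.F (x t) := by
    rw [defect, hH]; abel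
  rw [h2, dfun_add, dfun_smul, dfun_hamVF_self, mul_zero, add_zero]

/-- The integral of a function against the probability density `χ`. -/
theorem abs_integral_chi_mul_le {χ h : ℝ → ℝ} {t₀ D : ℝ} (hχ : IsChi χ t₀) (hh : Continuous h)
    (hD : ∀ t ∈ Set.Icc 0 t₀, |h t| ≤ D) : |∫ t in (0 : ℝ)..1, χ t * h t| ≤ D := by
  have hc := hχ.smooth.continuous
  have hle : ∀ t ∈ Set.Icc (0 : ℝ) 1, |χ t * h t| ≤ χ t * D := by
    intro t ht
    rw [abs_mul, abs_of_nonneg (hχ.nonneg t)]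
    rcases le_or_gt t t₀ with h1 | h1
    · exact mul_le_mul_of_nonneg_left (hD t ⟨ht.1, h1⟩) (hχ.nonneg t)
    · rw [hχ.eq_zero h1 ht.2, zero_mul, zero_mul]
  refine (intervalIntegral.abs_integral_le_integral_abs zero_le_one).trans ?_
  refine (intervalIntegral.integral_mono_on zero_le_one ((hc.mul hh).abs.intervalIntegrable _ _)
    ((hc.mul continuous_const).intervalIntegrable _ _) hle).trans ?_
  refine (intervalIntegral.integral_mul_const D χ).trans_le ?_
  rw [hχ.integral_eq_one, one_mul]

theorem le_integral_chi_mul {χ h : ℝ → ℝ} {t₀ D : ℝ} (hχ : IsChi χ t₀) (hh : Continuous h)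
    (hD : ∀ t ∈ Set.Icc 0 t₀, D ≤ h t) : D ≤ ∫ t in (0 : ℝ)..1, χ t * h t := by
  have hc := hχ.smooth.continuous
  have hle : ∀ t ∈ Set.Icc (0 : ℝ) 1, χ t * D ≤ χ t * h t := by
    intro t ht
    rcases le_or_gt t t₀ with h1 | h1
    · exact mul_le_mul_of_nonneg_left (hD t ⟨ht.1, h1⟩) (hχ.nonneg t)
    · rw [hχ.eq_zero h1 ht.2, zero_mul, zero_mul]
  have h1 := intervalIntegral.integral_mono_on zero_le_one
    ((hc.mul continuous_const).intervalIntegrable (μ := MeasureTheory.volume) _ _)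
    ((hc.mul hh).intervalIntegrable _ _) hle
  refine le_of_eq_of_le ?_ h1
  refine Eq.trans ?_ (intervalIntegral.integral_mul_const D χ).symm
  rw [hχ.integral_eq_one, one_mul]

/-- If the energy of the defect is small, then `F` is almost constant on the support of `χ`. -/
theorem sq_sub_F_le (h𝔣 : IsSmoothData 𝔣) (hx : ContMDiff 𝓘(ℝ, ℝ) (cotI n) ∞ x) {η t₀ : ℝ}
    (ht₀ : t₀ ≤ 1) (hH : ∀ t ∈ Set.Icc 0 t₀, ∀ z, hamVF (𝔣.H t) z = 0) {C : ℝ} {e : ℝ → ℝ}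
    (he : Continuous e) (hC : ∀ t ∈ Set.Icc (0 : ℝ) 1, dfun 𝔣.F (x t) (defect 𝔣 x η t) ^ 2 ≤ C * e t)
    {t₁ t₂ : ℝ} (h₁ : t₁ ∈ Set.Icc 0 t₀) (h₂ : t₂ ∈ Set.Icc 0 t₀) :
    (𝔣.F (x t₂) - 𝔣.F (x t₁)) ^ 2 ≤ C * ∫ t in (0 : ℝ)..1, e t := by
  wlog h12 : t₁ ≤ t₂ generalizing t₁ t₂
  · rw [← neg_sq, neg_sub]; exact this h₂ h₁ (not_le.1 h12).le
  have hF : ContDiff ℝ ∞ fun t => 𝔣.F (x t) := (h𝔣.F.comp hx).contDiff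
  have hc : Continuous (deriv fun t => 𝔣.F (x t)) := hF.continuous_deriv (by simp)
  have hsub : Set.Icc t₁ t₂ ⊆ Set.Icc 0 t₀ := Set.Icc_subset_Icc h₁.1 h₂.2
  rw [← intervalIntegral.integral_deriv_eq_sub (fun t _ => (hF.differentiable (by simp)) t)
    (hc.intervalIntegrable _ _), ← intervalIntegral.integral_const_mul]
  refine (sq_integral_le hc h12 (by linarith [h₁.1, h₂.2])).trans ?_
  have hCe : Continuous fun t => C * e t := by fun_prop
  refine (intervalIntegral.integral_mono_on h12 ((hc.pow 2).intervalIntegrable _ _)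
    (hCe.intervalIntegrable _ _) fun t ht => ?_).trans
    (intervalIntegral.integral_mono_interval h₁.1 h12 (h₂.2.trans ht₀) ?_
      (hCe.intervalIntegrable _ _))
  · have ht' := hsub ht
    rw [Pi.pow_apply, (hasDerivAt_F_curve h𝔣 hx η (hH t ht' _)).deriv]
    exact hC t ⟨ht'.1, ht'.2.trans ht₀⟩
  · exact (MeasureTheory.ae_restrict_iff' measurableSet_Ioc).2 (Filter.Eventually.of_forall
      fun t ht => (sq_nonneg _).trans (hC t ⟨ht.1.le, ht.2⟩))

/-- Almost critical points with action in `(a, b)` and loops in a compact set have bounded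
multipliers: if `η` is very negative, then `f(η)` is small and the action is less than `a`; if `η`
is large, then `x` is close to the hypersurface on the support of `χ`, and the action grows with
`f(η) = η`. -/
theorem exists_mult_bound (h𝔣 : IsData₀ 𝔣) (hJ : IsACS J) {a b k : ℝ} (ha : 0 < a) (hk : 0 < k)
    (hkF : ∀ z, |𝔣.F z| < k → 1 / 2 + k ≤ liouville z (hamVF 𝔣.F z))
    (hf : ∀ η, a / 6 ≤ η → 𝔣.f η = η) (hH : kappa 𝔣.H ≤ ENNReal.ofReal (a / 2))
    {K : Set (Cot n M)} (hK : IsCompact K) :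
    ∃ E L : ℝ, 0 < E ∧ ∀ (x : SmoothLoop (cotI n) (Cot n M)) (η : ℝ) (e : ℝ → ℝ),
      (∀ t, x t ∈ K) → Continuous e →
      (∀ t ∈ Set.Icc (0 : ℝ) 1, omega (x t) (J t (x t) (defect 𝔣 x η t)) (defect 𝔣 x η t) ≤ e t) →
      ∫ t in (0 : ℝ)..1, e t ≤ E →
      (deriv 𝔣.f η * ∫ t in (0 : ℝ)..1, 𝔣.χ t * 𝔣.F (x t)) ^ 2 ≤ E →
      action 𝔣 x η ∈ Set.Ioo a b → |η| ≤ L := by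
  have hs := h𝔣.isSmoothData
  obtain ⟨t₀, hχ, hH0⟩ := h𝔣.exists_isChi
  obtain ⟨C, hC0, hC⟩ := hJ.exists_liouville_bound hK
  obtain ⟨C', hC'0, hC'⟩ := hJ.exists_dfun_bound hs.F hK
  obtain ⟨D, hD⟩ := hK.exists_bound_of_continuousOn
    ((continuous_liouville_hamVF_F hs).sub hs.F.continuous).continuousOn
  have hD1 : 0 < max D 1 := lt_max_of_lt_right one_pos
  obtain ⟨B, hB⟩ : ∃ B, 𝔣.f B < 3 * a / 8 / max D 1 :=
    (h𝔣.f_mem.limit.eventually (gt_mem_nhds (by positivity))).exists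
  refine ⟨min (k ^ 2 / 16) (min (k ^ 2 / 16 / C') (a ^ 2 / 64 / C)),
    max (max (a / 6) (2 * b + 5 * a / 4)) (-B), by positivity, ?_⟩
  intro x η e hxK he hle hE hm hA
  set E := min (k ^ 2 / 16) (min (k ^ 2 / 16 / C') (a ^ 2 / 64 / C))
  have hE1 : E ≤ (k / 4) ^ 2 := (min_le_left _ _).trans (by rw [div_pow]; norm_num)
  have hE2 : C' * E ≤ (k / 4) ^ 2 := by
    have h1 : E ≤ k ^ 2 / 16 / C' := (min_le_right _ _).trans (min_le_left _ _)
    rw [le_div_iff₀ hC'0] at h1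
    rw [div_pow]; linarith
  have hE3 : C * E ≤ (a / 8) ^ 2 := by
    have h1 : E ≤ a ^ 2 / 64 / C := (min_le_right _ _).trans (min_le_right _ _)
    rw [le_div_iff₀ hC0] at h1
    rw [div_pow]; linarith
  have hF : Continuous fun t => 𝔣.F (x t) := hs.F.continuous.comp x.smooth.continuous
  have hlF : Continuous fun t => liouville (x t) (hamVF 𝔣.F (x t)) :=
    (continuous_liouville_hamVF_F hs).comp x.smooth.continuous
  -- the contribution of the defect to the action
  have hV : |∫ t in (0 : ℝ)..1, liouville (x t) (defect 𝔣 x η t)| ≤ a / 8 := by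
    have hc := continuous_liouville_defect hs x.smooth η
    refine abs_le_of_sq_le_sq ((sq_integral_le hc zero_le_one (by norm_num)).trans ?_)
      (by positivity)
    refine le_trans ?_ hE3
    refine le_trans ?_ (mul_le_mul_of_nonneg_left hE hC0.le)
    rw [← intervalIntegral.integral_const_mul]
    exact intervalIntegral.integral_mono_on zero_le_one ((hc.pow 2).intervalIntegrable _ _)
      ((continuous_const.mul he).intervalIntegrable _ _) fun t ht =>
        (hC t _ (hxK t) _).trans (mul_le_mul_of_nonneg_left (hle t ht) hC0.le)
  have hκ := abs_integral_le_of_kappa_le (by positivity) hH x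
  have hact := action_eq hs x.smooth η
  have hfpos := h𝔣.f_mem.pos η
  rw [abs_le] at hV hκ
  rw [abs_le]
  constructor
  · -- the lower bound
    refine (neg_le_neg (le_max_right _ _)).trans ?_
    rw [neg_neg]
    by_contra hcon
    have h1 : 𝔣.f η < 3 * a / 8 / max D 1 := (h𝔣.f_mem.strictMono (not_le.1 hcon)).trans hB
    rw [lt_div_iff₀ hD1] at h1
    have h2 := (le_abs_self _).trans (abs_integral_chi_mul_le hχ (hlF.sub hF)
      fun t _ => (hD _ (hxK t)).trans (le_max_left D 1))
    have h3 := mul_le_mul_of_nonneg_left h2 hfpos.le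
    have h4 := hA.1
    rw [hact] at h4
    simp only [Pi.sub_apply] at h3
    linarith [hV.2, hκ.2]
  · -- the upper bound
    refine le_trans ?_ (le_max_left _ _)
    rcases le_or_gt η (a / 6) with h6 | h6
    · exact h6.trans (le_max_left _ _)
    refine le_trans ?_ (le_max_right _ _)
    have hfη : 𝔣.f η = η := hf η h6.le
    have hf' : deriv 𝔣.f η = 1 := by
      have h1 : 𝔣.f =ᶠ[𝓝 η] id := by
        filter_upwards [lt_mem_nhds h6] with y hy using hf y hy.le
      rw [h1.deriv_eq, deriv_id]
    have hmean : |∫ t in (0 : ℝ)..1, 𝔣.χ t * 𝔣.F (x t)| ≤ k / 4 := by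
      rw [hf', one_mul] at hm
      exact abs_le_of_sq_le_sq (hm.trans hE1) (by positivity)
    have hFx (t : ℝ) (ht : t ∈ Set.Icc 0 t₀) : |𝔣.F (x t)| ≤ k / 2 := by
      have h1 : |∫ τ in (0 : ℝ)..1, 𝔣.χ τ * (𝔣.F (x t) - 𝔣.F (x τ))| ≤ k / 4 := by
        refine abs_integral_chi_mul_le hχ (continuous_const.sub hF) fun τ hτ => ?_
        refine abs_le_of_sq_le_sq (le_trans ?_ hE2) (by positivity)
        refine (sq_sub_F_le hs x.smooth hχ.t₀_le hH0 he (C := C') (η := η) (fun τ hτ => ?_) hτ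
          ht).trans (mul_le_mul_of_nonneg_left hE hC'0.le)
        exact (hC' τ _ (hxK τ) _).trans (mul_le_mul_of_nonneg_left (hle τ hτ) hC'0.le)
      have hc := hs.χ.continuous
      have h2 : ∫ τ in (0 : ℝ)..1, 𝔣.χ τ * (𝔣.F (x t) - 𝔣.F (x τ))
          = 𝔣.F (x t) - ∫ τ in (0 : ℝ)..1, 𝔣.χ τ * 𝔣.F (x τ) := by
        simp only [mul_sub]
        rw [intervalIntegral.integral_sub, intervalIntegral.integral_mul_const,
          hχ.integral_eq_one, one_mul]
        · exact Continuous.intervalIntegrable (by fun_prop) _ _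
        · exact Continuous.intervalIntegrable (by fun_prop) _ _
      rw [h2] at h1
      rw [abs_le] at h1 hmean ⊢
      constructor <;> linarith [h1.1, h1.2, hmean.1, hmean.2]
    have h1 : 1 / 2 ≤ ∫ t in (0 : ℝ)..1, 𝔣.χ t * (liouville (x t) (hamVF 𝔣.F (x t)) - 𝔣.F (x t)) := by
      refine le_integral_chi_mul hχ (hlF.sub hF) fun t ht => ?_
      have h2 := hFx t ht
      have h3 := hkF (x t) (by linarith)
      linarith [(abs_le.1 h2).2]
    have h2 := mul_le_mul_of_nonneg_left h1 hfpos.le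
    have h3 := hA.2
    rw [hact] at h3
    rw [hfη] at h2 h3
    linarith [hV.1, hκ.1]

end Multiplier

/-- The multipliers of gradient flow lines with action in `(a, b)` and loops in a compact set are
uniformly bounded: the multiplier changes with bounded speed, and almost critical points occur
in every time interval of a certain length. -/
theorem exists_mult_bound_flowLine {𝔣 : Data n M} {J : EndField n M} (h𝔣 : IsData₀ 𝔣)
    (hJ : IsACS J) {a b k : ℝ} (ha : 0 < a) (hk : 0 < k)
    (hkF : ∀ z, |𝔣.F z| < k → 1 / 2 + k ≤ liouville z (hamVF 𝔣.F z))
    (hf : ∀ η, a / 6 ≤ η → 𝔣.f η = η) (hH : kappa 𝔣.H ≤ ENNReal.ofReal (a / 2))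
    {K : Set (Cot n M)} (hK : IsCompact K) :
    ∃ L : ℝ, ∀ u : ℝ → SmoothLoop (cotI n) (Cot n M) × ℝ, IsFlowLine 𝔣 J u →
      (∀ s, action 𝔣 (u s).1 (u s).2 ∈ Set.Ioo a b) → (∀ s t, (u s).1 t ∈ K) →
      ∀ s, |(u s).2| ≤ L := by
  have hs := h𝔣.isSmoothData
  obtain ⟨t₀, hχ, -⟩ := h𝔣.exists_isChi
  obtain ⟨E, L, hE, hL⟩ := exists_mult_bound h𝔣 hJ ha hk hkF hf hH hK (b := b)
  obtain ⟨D, hD⟩ := hK.exists_bound_of_continuousOn hs.F.continuous.continuousOn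
  refine ⟨L + D * ((b - a) / E), fun u hu hA huK s => ?_⟩
  obtain ⟨s', hs', hlt⟩ := exists_neg_deriv_lt (hu.hasDerivAt_action hs hJ) hA hE s
  rw [neg_neg] at hlt
  have h0 := hJ.integral_energyDensity_nonneg (fun s t => (u s).1 t) s'
  have h1 : |(u s').2| ≤ L := by
    refine hL (u s').1 (u s').2 (fun t => energyDensity J (fun s t => (u s).1 t) s' t) (huK s')
      (continuous_slice (hu.continuous_energyDensity hs hJ) s') (fun t _ => ?_) ?_ ?_ (hA s')
    · rw [← hu.map_vel_eq_defect hJ, hJ.omega_map_map]; rfl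
    · linarith [sq_nonneg (deriv (fun s => (u s).2) s')]
    · rw [← hu.deriv_mult]; linarith
  have hD0 : 0 ≤ D := (norm_nonneg _).trans (hD _ (huK 0 0))
  have h2 : |(u s').2 - (u s).2| ≤ D * |s' - s| := by
    refine convex_univ.norm_image_sub_le_of_norm_deriv_le (f := fun s => (u s).2)
      (fun x _ => (hu.smooth_η.differentiable (by simp)) x) (fun x _ => ?_) (Set.mem_univ s)
      (Set.mem_univ s')
    rw [hu.deriv_mult, Real.norm_eq_abs, abs_mul, abs_of_pos (h𝔣.f_mem.deriv_pos _)]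
    have h3 := abs_integral_chi_mul_le hχ (hs.F.continuous.comp (u x).1.smooth.continuous)
      fun t _ => hD _ (huK x t)
    calc _ ≤ 1 * D := mul_le_mul (h𝔣.f_mem.deriv_le _) h3 (abs_nonneg _) zero_le_one
      _ = D := one_mul D
  have h3 : |s' - s| ≤ (b - a) / E := by
    rw [abs_of_pos (by linarith [hs'.1])]; linarith [hs'.2]
  have h4 := mul_le_mul_of_nonneg_left h3 hD0
  have h5 : |(u s).2| ≤ |(u s').2| + |(u s').2 - (u s).2| := by
    have := abs_sub_abs_le_abs_sub (u s).2 (u s').2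
    rw [abs_sub_comm] at this
    linarith
  linarith

/-! ### Boundedness in the fibre norm -/

/-- Vectors in the unit balls of a continuous Riemannian metric are locally bounded in a
trivialization. -/
theorem exists_bound_continuousLinearMapAt {B : Type*} [TopologicalSpace B]
    {F : Type*} [NormedAddCommGroup F] [NormedSpace ℝ F]
    {E : B → Type*} [TopologicalSpace (TotalSpace F E)]
    [∀ b, TopologicalSpace (E b)] [∀ b, AddCommGroup (E b)] [∀ b, Module ℝ (E b)]
    [∀ b, IsTopologicalAddGroup (E b)] [∀ b, ContinuousConstSMul ℝ (E b)]
    [FiberBundle F E] [VectorBundle ℝ F E] (g : ContinuousRiemannianMetric F E) (x : B) :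
    ∃ C > 0, ∀ᶠ y in 𝓝 x, ∀ v : E y, g.inner y v v ≤ 1 →
      ‖(trivializationAt F E x).continuousLinearMapAt ℝ y v‖ ≤ C := by
  let _ : RiemannianBundle E := ⟨g.toRiemannianMetric⟩
  obtain ⟨C, hC, h⟩ := eventually_norm_trivializationAt_lt F E x
  refine ⟨C, hC, h.mono fun y hy v hv => ?_⟩
  have h1 : ‖v‖ ≤ 1 := by
    have h2 : ‖v‖ ^ 2 ≤ 1 := (real_inner_self_eq_norm_sq v).symm.trans_le hv
    nlinarith [norm_nonneg v]
  calc _ ≤ ‖(trivializationAt F E x).continuousLinearMapAt ℝ y‖ * ‖v‖ :=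
        ContinuousLinearMap.le_opNorm _ v
    _ ≤ C * 1 := mul_le_mul hy.le h1 (norm_nonneg v) hC.le
    _ = C := mul_one C

theorem snd_apply_eq {z₀ z : Cot n M} (hz : z ∈ dom z₀) (v : TangentSpace (𝓡 n) z.1) :
    z.2 v = (co z₀ z).2 ((trivializationAt (EuclideanSpace ℝ (Fin n))
      (TangentSpace (𝓡 n)) z₀.1).continuousLinearMapAt ℝ z.1 v) := by
  rw [co_snd_apply]
  refine congrArg z.2 ?_
  exact ((trivializationAt (EuclideanSpace ℝ (Fin n))
    (TangentSpace (𝓡 n)) z₀.1).symmL_continuousLinearMapAt ((mem_dom_iff _ _).1 hz) v).symm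

/-- The fibre norm is bounded on compact sets. -/
theorem exists_covectorNorm_le
    (g : ContMDiffRiemannianMetric (𝓡 n) ∞ (EuclideanSpace ℝ (Fin n))
      (fun q : M => TangentSpace (𝓡 n) q)) {K : Set (Cot n M)} (hK : IsCompact K) :
    ∃ C, 0 ≤ C ∧ ∀ z ∈ K, covectorNorm g z ≤ C := by
  suffices h : ∃ C, 0 ≤ C ∧ ∀ z ∈ K, ∀ v : TangentSpace (𝓡 n) z.1, g.inner z.1 v v ≤ 1 →
      z.2 v ≤ C by
    obtain ⟨C, hC, h⟩ := h
    refine ⟨C, hC, fun z hz => Real.sSup_le ?_ hC⟩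
    rintro r ⟨v, hv, rfl⟩
    exact h z hz v hv
  refine hK.induction_on (p := fun K => ∃ C, 0 ≤ C ∧ ∀ z ∈ K, ∀ v : TangentSpace (𝓡 n) z.1,
    g.inner z.1 v v ≤ 1 → z.2 v ≤ C) ⟨0, le_rfl, by simp⟩ ?_ ?_ ?_
  · rintro s t hst ⟨C, hC, h⟩
    exact ⟨C, hC, fun z hz => h z (hst hz)⟩
  · rintro s t ⟨C, hC, h⟩ ⟨C', hC', h'⟩
    refine ⟨max C C', hC.trans (le_max_left _ _), ?_⟩
    rintro z (hz | hz) v hv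
    · exact (h z hz v hv).trans (le_max_left _ _)
    · exact (h' z hz v hv).trans (le_max_right _ _)
  · intro z₀ _
    obtain ⟨C, hC, h⟩ := exists_bound_continuousLinearMapAt g.toContinuousRiemannianMetric z₀.1
    have h1 : ∀ᶠ z : Cot n M in 𝓝 z₀, ∀ v : TangentSpace (𝓡 n) z.1, g.inner z.1 v v ≤ 1 →
        ‖(trivializationAt (EuclideanSpace ℝ (Fin n)) (TangentSpace (𝓡 n))
          z₀.1).continuousLinearMapAt ℝ z.1 v‖ ≤ C :=
      (contMDiff_footpoint (M := M) (n := n)).continuous.continuousAt.eventually h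
    have hc : ContinuousAt (fun z => ‖(co z₀ z).2‖) z₀ :=
      ((contMDiffAt_co (mem_dom_self z₀)).continuousAt.snd).norm
    have h2 : ∀ᶠ z : Cot n M in 𝓝 z₀, ‖(co z₀ z).2‖ < ‖(co z₀ z₀).2‖ + 1 :=
      hc.eventually (gt_mem_nhds (lt_add_one _))
    have h3 : ∀ᶠ z : Cot n M in 𝓝 z₀, z ∈ dom z₀ := dom_mem_nhds (mem_dom_self z₀)
    refine ⟨_, mem_nhdsWithin_of_mem_nhds (h1.and (h2.and h3)), (‖(co z₀ z₀).2‖ + 1) * C,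
      by positivity, ?_⟩
    rintro z ⟨hz1, hz2, hz3⟩ v hv
    rw [snd_apply_eq hz3]
    refine (Real.le_norm_self _).trans ((ContinuousLinearMap.le_opNorm _ _).trans ?_)
    exact mul_le_mul hz2.le (hz1 v hv) (norm_nonneg _) (by positivity)

/-! ### Critical points -/

/-- Smooth periodic bump functions. -/
theorem exists_periodic_bump {P : ℝ → Prop} (hP : Function.Periodic P 1) {t₀ : ℝ}
    (h : ∀ᶠ t in 𝓝 t₀, P t) :
    ∃ b : ℝ → ℝ, ContDiff ℝ ∞ b ∧ Function.Periodic b 1 ∧ (∀ t, 0 ≤ b t) ∧ (∀ t, b t ≤ 1) ∧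
      0 < b t₀ ∧ ∀ t, P t ∨ ∀ᶠ τ in 𝓝 t, b τ = 0 := by
  obtain ⟨ε, hε, hball⟩ := Metric.eventually_nhds_iff.1 h
  set ε' := min (ε / 2) (1 / 4) with hε'
  have hε'0 : 0 < ε' := by positivity
  have hε'1 : ε' ≤ 1 / 4 := min_le_right _ _
  have hε'2 : ε' ≤ ε / 2 := min_le_left _ _
  set c := Real.cos (2 * Real.pi * ε') with hc
  have hπ := Real.pi_pos
  have hm : ∀ y : ℝ, 0 ≤ y → y ≤ 1 / 2 → 2 * Real.pi * y ∈ Set.Icc 0 Real.pi := fun y h0 h1 =>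
    ⟨by positivity, by nlinarith⟩
  let k : ℝ → ℝ := fun t => Real.cos (2 * Real.pi * (t - t₀))
  have hkper : Function.Periodic k 1 := fun t => by
    simp only [k]
    rw [show 2 * Real.pi * (t + 1 - t₀) = 2 * Real.pi * (t - t₀) + 2 * Real.pi by ring,
      Real.cos_add_two_pi]
  have hkc : Continuous k := by fun_prop
  have hP' : ∀ t, c ≤ k t → P t := by
    have hper : Function.Periodic (fun t => c ≤ k t → P t) 1 := fun t => by
      simp only [hkper t, hP t]
    intro t
    obtain ⟨t', ht', heq⟩ := hper.exists_mem_Ico one_pos t (t₀ - 1 / 2)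
    have h1 : c ≤ k t' → P t' := by
      intro hk
      have h2 : |t' - t₀| ≤ 1 / 2 := abs_le.2 ⟨by linarith [ht'.1], by linarith [ht'.2]⟩
      have h3 : k t' = Real.cos (2 * Real.pi * |t' - t₀|) := by
        rw [← Real.cos_abs (2 * Real.pi * |t' - t₀|), abs_mul, abs_abs, ← abs_mul, Real.cos_abs]
      rw [h3] at hk
      have h4 := (Real.strictAntiOn_cos.le_iff_ge (hm ε' hε'0.le (by linarith))
        (hm _ (abs_nonneg _) h2)).1 hk
      have h5 : |t' - t₀| ≤ ε' := le_of_mul_le_mul_left h4 (by positivity)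
      exact hball (by rw [Real.dist_eq]; linarith)
    exact heq.symm ▸ h1
  refine ⟨fun t => Real.smoothTransition (k t - c), ?_, fun t => by simp only [hkper t],
    fun t => Real.smoothTransition.nonneg _, fun t => Real.smoothTransition.le_one _,
    Real.smoothTransition.pos_of_pos ?_, fun t => ?_⟩
  · exact (Real.smoothTransition.contDiff (n := ⊤)).comp (by fun_prop)
  · have h1 : Real.cos (2 * Real.pi * ε') < Real.cos (2 * Real.pi * 0) :=
      Real.strictAntiOn_cos (hm 0 le_rfl (by norm_num)) (hm ε' hε'0.le (by linarith))
        (by nlinarith)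
    simp only [k, sub_self]
    linarith
  · rcases le_or_gt c (k t) with h1 | h1
    · exact Or.inl (hP' t h1)
    · refine Or.inr ((hkc.continuousAt.eventually (gt_mem_nhds h1)).mono fun τ hτ => ?_)
      exact Real.smoothTransition.zero_of_nonpos (by linarith)

section Crit

variable {𝔣 : Data n M}

/-- The defect of the equation for critical points as a curve in the tangent bundle. -/
def defectT (𝔣 : Data n M) (x : ℝ → Cot n M) (η t : ℝ) : TangentBundle (cotI n) (Cot n M) :=
  ⟨x t, defect 𝔣 x η t⟩

theorem defectT_periodic {χ₀ : Function.Periodic 𝔣.χ 1} {H₀ : Function.Periodic 𝔣.H 1}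
    (x : SmoothLoop (cotI n) (Cot n M)) (η : ℝ) : Function.Periodic (defectT 𝔣 x η) 1 := by
  let Ψ : ℝ → TangentBundle (cotI n) (Cot n M) → TangentBundle (cotI n) (Cot n M) := fun t p =>
    ⟨p.1, p.2 - (𝔣.f η * 𝔣.χ t) • hamVF 𝔣.F p.1 - hamVF (𝔣.H t) p.1⟩
  have hΨ (t : ℝ) : Ψ (t + 1) = Ψ t := by simp only [Ψ, χ₀ t, H₀ t]
  intro t
  change Ψ (t + 1) (velT (cotI n) x (t + 1)) = Ψ t (velT (cotI n) x t)
  rw [hΨ, velT_periodic (x.smooth.mdifferentiable (by simp)) x.periodic]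

theorem continuousAt_dco_defect (h𝔣 : IsSmoothData 𝔣) {x : ℝ → Cot n M}
    (hx : ContMDiff 𝓘(ℝ, ℝ) (cotI n) ∞ x) (η t : ℝ) :
    ContinuousAt (fun τ => dco (x t) (x τ) (defect 𝔣 x η τ)) t := by
  have h1 : ContinuousAt (fun τ => dco (x t) (x τ) (vel (cotI n) x τ)) t :=
    ContinuousAt.comp (f := fun τ => (⟨x τ, vel (cotI n) x τ⟩ : TangentBundle (cotI n) (Cot n M)))
      (contMDiffAt_dco (⟨x t, vel (cotI n) x t⟩ : TangentBundle (cotI n) (Cot n M))).continuousAt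
      (contMDiff_vel hx).continuous.continuousAt
  have h2 : ContinuousAt (fun τ => dco (x t) (x τ) (hamVF 𝔣.F (x τ))) t :=
    ContinuousAt.comp (f := fun τ => (⟨x τ, hamVF 𝔣.F (x τ)⟩ : TangentBundle (cotI n) (Cot n M)))
      (contMDiffAt_dco (⟨x t, hamVF 𝔣.F (x t)⟩ : TangentBundle (cotI n) (Cot n M))).continuousAt
      ((contMDiff_hamVF_autonomous h𝔣.F).continuous.comp hx.continuous).continuousAt
  have h3 : ContinuousAt (fun τ => dco (x t) (x τ) (hamVF (𝔣.H τ) (x τ))) t :=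
    ContinuousAt.comp (f := fun τ =>
        (⟨x τ, hamVF (𝔣.H τ) (x τ)⟩ : TangentBundle (cotI n) (Cot n M)))
      (contMDiffAt_dco (⟨x t, hamVF (𝔣.H t) (x t)⟩ : TangentBundle (cotI n) (Cot n M))).continuousAt
      (continuous_hamVF_H h𝔣 hx).continuousAt
  have h4 : ∀ τ, dco (x t) (x τ) (defect 𝔣 x η τ) = dco (x t) (x τ) (vel (cotI n) x τ)
      - (𝔣.f η * 𝔣.χ τ) • dco (x t) (x τ) (hamVF 𝔣.F (x τ))
      - dco (x t) (x τ) (hamVF (𝔣.H τ) (x τ)) := fun τ => by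
    rw [defect, ContinuousLinearMap.map_sub, ContinuousLinearMap.map_sub, dco_smul]
  simp only [h4]
  exact (h1.sub ((continuous_const.mul h𝔣.χ.continuous).continuousAt.smul h2)).sub h3

/-- A variation of the loop `x`, supported near `x t₀`, whose velocity is a multiple of a
constant vector field in coordinates. -/
theorem exists_variation {x : SmoothLoop (cotI n) (Cot n M)} {z₀ : Cot n M} {V : Set (Cot n M)}
    (hV : IsOpen V) (hVdom : V ⊆ dom z₀) {w : CotVec n} {δ : ℝ} (hδ : 0 < δ)
    (hVδ : ∀ z ∈ V, ∀ τ : ℝ, |τ| ≤ δ → co z₀ z + τ • w ∈ tgt z₀) {b : ℝ → ℝ}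
    (hb : ContDiff ℝ ∞ b) (hbper : Function.Periodic b 1) (hb0 : ∀ t, 0 ≤ b t)
    (hb1 : ∀ t, b t ≤ 1) (hbV : ∀ t, x t ∈ V ∨ ∀ᶠ τ in 𝓝 t, b τ = 0) :
    ∃ X : ℝ → ℝ → Cot n M, ContMDiff 𝓘(ℝ, ℝ × ℝ) (cotI n) ∞ (fun p : ℝ × ℝ => X p.1 p.2) ∧
      (∀ s, Function.Periodic (X s) 1) ∧ (∀ t, X 0 t = x t) ∧
      (∀ t ∈ x ⁻¹' V, dco z₀ (X 0 t) (vel (cotI n) (fun s => X s t) 0) = b t • w) ∧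
      ∀ t ∉ x ⁻¹' V, ∀ s, X s t = x t := by
  classical
  -- a bounded reparametrization of the deformation parameter
  let σ : ℝ → ℝ := fun s => δ * Real.sin (s / δ)
  have hσ : ContDiff ℝ ∞ σ := contDiff_const.mul (Real.contDiff_sin.comp (contDiff_id.div_const δ))
  have hσ0 : σ 0 = 0 := by simp [σ]
  have hσd : HasDerivAt σ 1 0 := by
    have h1 := ((Real.hasDerivAt_sin (0 / δ)).comp (0 : ℝ)
      ((hasDerivAt_id (0 : ℝ)).div_const δ)).const_mul δ
    refine h1.congr_deriv ?_
    rw [zero_div, Real.cos_zero]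
    field_simp
  have hσle (s : ℝ) : |σ s| ≤ δ := by
    rw [abs_mul, abs_of_pos hδ]
    exact mul_le_of_le_one_right hδ.le (Real.abs_sin_le_one _)
  have hmem (s t : ℝ) (ht : x t ∈ V) : co z₀ (x t) + (σ s * b t) • w ∈ tgt z₀ := by
    refine hVδ _ ht _ ?_
    rw [abs_mul, abs_of_nonneg (hb0 t)]
    exact (mul_le_of_le_one_right (abs_nonneg _) (hb1 t)).trans (hσle s)
  let X : ℝ → ℝ → Cot n M := fun s t =>
    if x t ∈ V then coInv z₀ (co z₀ (x t) + (σ s * b t) • w) else x t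
  have hXV (s t : ℝ) (ht : x t ∈ V) : X s t = coInv z₀ (co z₀ (x t) + (σ s * b t) • w) := if_pos ht
  have hXb (s t : ℝ) (ht : σ s * b t = 0) : X s t = x t := by
    by_cases h : x t ∈ V
    · rw [hXV s t h, ht, zero_smul, add_zero, coInv_co (hVdom h)]
    · exact if_neg h
  refine ⟨X, ?_, fun s t => ?_, fun t => hXb 0 t (by rw [hσ0, zero_mul]), fun t ht => ?_,
    fun t ht s => if_neg ht⟩
  · rintro ⟨s, t⟩
    have hxs : ContMDiff 𝓘(ℝ, ℝ × ℝ) (cotI n) ∞ (fun p : ℝ × ℝ => x p.2) :=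
      x.smooth.comp contDiff_snd.contMDiff
    rcases hbV t with h | h
    · have h1 : ContMDiffAt 𝓘(ℝ, ℝ × ℝ) 𝓘(ℝ, CotVec n) ∞
          (fun p : ℝ × ℝ => co z₀ (x p.2) + (σ p.1 * b p.2) • w) (s, t) := by
        have h2 : ContDiffAt ℝ ∞ (fun p : ℝ × ℝ => co z₀ (x p.2)) (s, t) :=
          (ContMDiffAt.comp (s, t) (contMDiffAt_co (hVdom h)) (hxs (s, t))).contDiffAt
        have h3 : ContDiff ℝ ∞ (fun p : ℝ × ℝ => (σ p.1 * b p.2) • w) :=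
          ((hσ.comp contDiff_fst).mul (hb.comp contDiff_snd)).smul contDiff_const
        exact (h2.add h3.contDiffAt).contMDiffAt
      have h2 : ContMDiffAt 𝓘(ℝ, ℝ × ℝ) (cotI n) ∞
          (fun p : ℝ × ℝ => coInv z₀ (co z₀ (x p.2) + (σ p.1 * b p.2) • w)) (s, t) :=
        ContMDiffAt.comp (I' := 𝓘(ℝ, CotVec n)) (s, t) (contMDiffAt_coInv (hmem s t h)) h1
      refine h2.congr_of_eventuallyEq ?_
      have h3 : ∀ᶠ p : ℝ × ℝ in 𝓝 (s, t), x p.2 ∈ V :=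
        hxs.continuous.continuousAt.preimage_mem_nhds (hV.mem_nhds h)
      exact h3.mono fun p hp => hXV p.1 p.2 hp
    · refine (hxs (s, t)).congr_of_eventuallyEq ?_
      have h1 : ∀ᶠ p : ℝ × ℝ in 𝓝 (s, t), b p.2 = 0 :=
        (continuous_snd.tendsto (s, t)).eventually h
      exact h1.mono fun p hp => hXb p.1 p.2 (by rw [hp, mul_zero])
  · simp only [X, x.periodic t, hbper t]
  · have hd : HasDerivAt (fun s => co z₀ (x t) + (σ s * b t) • w) (b t • w) 0 := by
      have := ((hσd.mul_const (b t)).smul_const w).const_add (co z₀ (x t))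
      rwa [one_mul] at this
    have hX0 : X 0 t ∈ dom z₀ := by rw [hXV 0 t ht]; exact coInv_mem (hmem 0 t ht)
    have hXd : MDifferentiableAt 𝓘(ℝ, ℝ) (cotI n) (fun s => X s t) 0 := by
      have h1 : (fun s => X s t) = coInv z₀ ∘ fun s => co z₀ (x t) + (σ s * b t) • w :=
        funext fun s => hXV s t ht
      rw [h1]
      exact (mdifferentiableAt_coInv (hmem 0 t ht)).comp (I' := 𝓘(ℝ, CotVec n)) (0 : ℝ)
        hd.differentiableAt.mdifferentiableAt
    rw [dco_vel (γ := fun s => X s t) hXd hX0, ← hd.deriv]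
    congr 1
    funext s
    rw [hXV s t ht, co_coInv (hmem s t ht)]

end Crit

section Crit

variable {𝔣 : Data n M}

theorem stdForm_smul_left (c : ℝ) (v w : CotVec n) : stdForm (c • v) w = c * stdForm v w := by
  change (c • v.2) w.1 - w.2 (c • v.1) = c * (v.2 w.1 - w.2 v.1)
  rw [ContinuousLinearMap.map_smul, _root_.smul_apply, smul_eq_mul, smul_eq_mul]
  ring

theorem omega_vel_const_left {γ : ℝ → Cot n M} {z : Cot n M} (h : γ = fun _ => z) (s : ℝ)
    (v : TangentSpace (cotI n) (γ s)) : omega (γ s) (vel (cotI n) γ s) v = 0 := by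
  subst h
  rw [vel_const]
  exact omega_zero_left _ _

/-- Critical points solve the equation `∂ₜx = f(η) χ X_F(x) + X_H(t, x)`. -/
theorem defect_eq_zero_of_mem_crit (h𝔣 : IsData₀ 𝔣) {v : SmoothLoop (cotI n) (Cot n M) × ℝ}
    (hv : v ∈ Crit 𝔣) (t : ℝ) : defect 𝔣 v.1 v.2 t = 0 := by
  have hs := h𝔣.isSmoothData
  obtain ⟨x, η⟩ := v
  have hDper : Function.Periodic (defectT 𝔣 x η) 1 :=
    defectT_periodic (χ₀ := h𝔣.χ_mem.choose_spec.periodic) (H₀ := h𝔣.H_mem.periodic) x η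
  suffices h : ∀ t ∈ Set.Icc (0 : ℝ) 1, defect 𝔣 x η t = 0 by
    have hper : Function.Periodic (fun t => (defectT 𝔣 x η t).2 = 0) 1 := fun t =>
      congrArg (fun p : TangentBundle (cotI n) (Cot n M) => p.2 = 0) (hDper t)
    obtain ⟨t₁, ht₁, h₁⟩ := hper.exists_mem_Ico₀ one_pos t
    have h2 : (defectT 𝔣 x η t₁).2 = 0 := h t₁ ⟨ht₁.1, ht₁.2.le⟩
    rw [← h₁] at h2
    exact h2
  intro t₀ ht₀
  by_contra hne
  set z₀ := x t₀ with hz₀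
  have hdom := mem_dom_self z₀
  -- a direction that pairs positively with the defect at `t₀`
  obtain ⟨w₀, hw₀⟩ : ∃ w₀, omega z₀ (defect 𝔣 x η t₀) w₀ ≠ 0 := by
    by_contra hcon
    push Not at hcon
    exact hne (omega_nondegenerate hcon)
  let w : CotVec n := dco z₀ z₀ (-(omega z₀ (defect 𝔣 x η t₀) w₀) • w₀)
  let q : ℝ → ℝ := fun t => stdForm w (dco z₀ (x t) (defect 𝔣 x η t))
  have hq₀ : 0 < q t₀ := by
    change 0 < stdForm (dco z₀ z₀ _) (dco z₀ z₀ _)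
    rw [← omega_eq hdom, omega_smul_left, omega_antisymm z₀ w₀, neg_mul_neg]
    exact mul_self_pos.2 hw₀
  have hqc : ContinuousAt q t₀ := by
    have h1 := continuousAt_dco_defect hs x.smooth η t₀
    exact ContinuousAt.comp (g := stdFlat w) (stdFlat w).continuous.continuousAt h1
  -- a neighbourhood in which the deformation in direction `w` is defined
  obtain ⟨V, δ, hV, hzV, hVdom, hδ, hVδ⟩ : ∃ (V : Set (Cot n M)) (δ : ℝ), IsOpen V ∧ z₀ ∈ V ∧
      V ⊆ dom z₀ ∧ 0 < δ ∧ ∀ z ∈ V, ∀ τ : ℝ, |τ| ≤ δ → co z₀ z + τ • w ∈ tgt z₀ := by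
    have h1 : ContinuousAt (fun p : Cot n M × ℝ => co z₀ p.1 + p.2 • w) (z₀, 0) :=
      (ContinuousAt.comp (f := Prod.fst) (x := (z₀, (0 : ℝ))) (contMDiffAt_co hdom).continuousAt
        continuousAt_fst).add (by fun_prop)
    have h2 : ∀ᶠ p : Cot n M × ℝ in 𝓝 (z₀, 0), co z₀ p.1 + p.2 • w ∈ tgt z₀ := by
      refine h1.preimage_mem_nhds ((isOpen_tgt z₀).mem_nhds ?_)
      rw [zero_smul, add_zero]
      exact co_mem hdom
    rw [nhds_prod_eq] at h2
    obtain ⟨A, hA, B, hB, hAB⟩ := Filter.eventually_prod_iff.1 h2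
    obtain ⟨V, hVA, hVo, hzV⟩ := mem_nhds_iff.1 (Filter.inter_mem hA (dom_mem_nhds hdom))
    obtain ⟨δ, hδ, hδB⟩ := Metric.eventually_nhds_iff.1 hB
    refine ⟨V, δ / 2, hVo, hzV, fun z hz => (hVA hz).2, by positivity, fun z hz τ hτ => ?_⟩
    exact hAB (hVA hz).1 (hδB (by rw [Real.dist_eq, sub_zero]; linarith))
  obtain ⟨b, hb, hbper, hb0, hb1, hbt₀, hbV⟩ := exists_periodic_bump
    (P := fun t => x t ∈ V ∧ 0 < q t) (t₀ := t₀) (fun t => by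
      have := congrArg (fun p : TangentBundle (cotI n) (Cot n M) =>
        p.1 ∈ V ∧ 0 < stdForm w (dco z₀ p.1 p.2)) (hDper t)
      exact this)
    ((x.smooth.continuous.continuousAt.eventually (hV.mem_nhds hzV)).and
      (hqc.eventually (lt_mem_nhds hq₀)))
  obtain ⟨X, hX, hXper, hX0, hXV, hXn⟩ := exists_variation (x := x) hV hVdom hδ hVδ hb hbper hb0 hb1
    (fun t => (hbV t).imp_left And.left)
  have hX0' : X 0 = x := funext hX0
  -- the integrand of the first variation is non-negative
  let I : ℝ → ℝ := fun t =>
    omega (X 0 t) (vel (cotI n) (fun σ => X σ t) 0) (defect 𝔣 (X 0) η t)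
  have hIV (t : ℝ) (ht : x t ∈ V) : I t = b t * q t := by
    have hd : X 0 t ∈ dom z₀ := by rw [hX0]; exact hVdom ht
    have h1 : dco z₀ (X 0 t) (defect 𝔣 (X 0) η t) = dco z₀ (x t) (defect 𝔣 x η t) :=
      congrArg (fun y : ℝ → Cot n M => dco z₀ (y t) (defect 𝔣 y η t)) hX0'
    change omega _ _ _ = _
    rw [omega_eq hd, hXV t ht, h1, stdForm_smul_left]
  have hI0 (t : ℝ) : 0 ≤ I t := by
    by_cases ht : x t ∈ V
    · rw [hIV t ht]
      rcases hbV t with h | h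
      · exact mul_nonneg (hb0 t) h.2.le
      · rw [h.self_of_nhds, zero_mul]
    · exact (omega_vel_const_left (γ := fun σ => X σ t) (funext fun s => hXn t ht s) 0 _).ge
  have hIc : Continuous I :=
    continuous_slice (continuous_omega_vel_defect hs hX (e := fun _ => η) continuous_const) 0
  have h1 := hasDerivAt_action hs hX hXper (e := fun _ => η) contDiff_const 0
  rw [deriv_const, mul_zero, zero_mul, sub_zero] at h1
  have h2 := h1.unique (hv X (fun _ => η) hX hXper contDiff_const hX0 rfl)
  have h3 := eq_zero_of_integral_eq_zero hIc hI0 h2 ht₀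
  rw [hIV t₀ hzV] at h3
  exact (mul_pos hbt₀ hq₀).ne' h3

theorem integral_eq_zero_of_mem_crit (h𝔣 : IsData₀ 𝔣) {v : SmoothLoop (cotI n) (Cot n M) × ℝ}
    (hv : v ∈ Crit 𝔣) : ∫ t in (0 : ℝ)..1, 𝔣.χ t * 𝔣.F (v.1 t) = 0 := by
  have hs := h𝔣.isSmoothData
  obtain ⟨x, η⟩ := v
  have hX : ContMDiff 𝓘(ℝ, ℝ × ℝ) (cotI n) ∞ (fun p : ℝ × ℝ => x p.2) :=
    x.smooth.comp contDiff_snd.contMDiff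
  have he : ContDiff ℝ ∞ (fun s : ℝ => η + s) := contDiff_const.add contDiff_id
  have h1 := hasDerivAt_action (X := fun _ => x) hs hX (fun _ => x.periodic) he 0
  have h2 := h1.unique (hv (fun _ => x) (fun s => η + s) hX (fun _ => x.periodic) he
    (fun _ => rfl) (add_zero η))
  have h3 : deriv (fun s : ℝ => η + s) 0 = 1 := ((hasDerivAt_id (0 : ℝ)).const_add η).deriv
  have h4 (t : ℝ) : omega (x t) (vel (cotI n) (fun _ => x t) 0) (defect 𝔣 x η t) = 0 :=
    omega_vel_const_left rfl 0 _
  simp only [add_zero] at h2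
  simp only [h4, h3, intervalIntegral.integral_zero, mul_one, zero_sub, neg_eq_zero] at h2
  exact (mul_eq_zero.1 h2).resolve_left (h𝔣.f_mem.deriv_pos η).ne'

/-- Solutions of the equation for critical points are critical points. -/
theorem mem_crit (h𝔣 : IsData₀ 𝔣) {x : SmoothLoop (cotI n) (Cot n M)} {η : ℝ}
    (hd : ∀ t, defect 𝔣 x η t = 0) (hF : ∫ t in (0 : ℝ)..1, 𝔣.χ t * 𝔣.F (x t) = 0) :
    (x, η) ∈ Crit 𝔣 := by
  have hs := h𝔣.isSmoothData
  intro X e hX hper he hX0 he0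
  have hX0' : X 0 = x := funext hX0
  have he0' : e 0 = η := he0
  refine (hasDerivAt_action hs hX hper he 0).congr_deriv ?_
  have h1 (t : ℝ) : omega (X 0 t) (vel (cotI n) (fun σ => X σ t) 0) (defect 𝔣 (X 0) (e 0) t) = 0 := by
    have h2 : defect 𝔣 (X 0) (e 0) t = 0 := by
      rw [he0', hX0']; exact hd t
    rw [h2, omega_zero_right]
  have h3 : ∫ t in (0 : ℝ)..1, 𝔣.χ t * 𝔣.F (X 0 t) = 0 := by rw [hX0']; exact hF
  simp only [h1, h3, intervalIntegral.integral_zero, mul_zero, sub_zero]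

end Crit

/-! ### Homotopy classes of nearby loops -/

section Homotopy

variable {X N : Type*} [TopologicalSpace X] [TopologicalSpace N]

/-- Maps to `N` that are sufficiently close to a map `y` can be deformed, within any prescribed
neighbourhood of `y` in the sense of the diagonal, to maps that agree with `y` over the set `C`,
without losing the agreement with `y` that has been achieved before. -/
def IsDeformable (X : Type*) [TopologicalSpace X] (C : Set N) : Prop :=
  ∀ O' : Set (N × N), IsOpen O' → Set.diagonal N ⊆ O' →
    ∃ O : Set (N × N), IsOpen O ∧ Set.diagonal N ⊆ O ∧ ∀ x y : C(X, N),
      (∀ t, (x t, y t) ∈ O) → ∃ x' : C(X, N), x.Homotopic x' ∧ (∀ t, (x' t, y t) ∈ O') ∧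
        ∀ t, y t ∈ C ∨ x t = y t → x' t = y t

theorem IsDeformable.union {C C' : Set N} (h : IsDeformable X C) (h' : IsDeformable X C') :
    IsDeformable X (C ∪ C') := by
  intro O' hO' hd
  obtain ⟨O₁, hO₁, hd₁, h₁⟩ := h' O' hO' hd
  obtain ⟨O, hO, hdO, h₂⟩ := h O₁ hO₁ hd₁
  refine ⟨O, hO, hdO, fun x y hxy => ?_⟩
  obtain ⟨x', hx', hx'y, hx'C⟩ := h₂ x y hxy
  obtain ⟨x'', hx'', hx''y, hx''C⟩ := h₁ x' y hx'y
  refine ⟨x'', hx'.trans hx'', hx''y, fun t ht => hx''C t ?_⟩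
  rcases ht with (ht | ht) | ht
  · exact Or.inr (hx'C t (Or.inl ht))
  · exact Or.inl ht
  · exact Or.inr (hx'C t (Or.inr ht))

/-- Locally the deformation is linear in a chart, cut off by a bump function. -/
theorem exists_isDeformable_nhds {d : ℕ} [ChartedSpace (EuclideanSpace ℝ (Fin d)) N]
    [CompactSpace N] [T2Space N] (q₀ : N) : ∃ C ∈ 𝓝 q₀, IsDeformable X C := by
  classical
  let φ := chartAt (EuclideanSpace ℝ (Fin d)) q₀
  have hq₀ : q₀ ∈ φ.source := _root_.mem_chart_source _ q₀
  obtain ⟨r, hr, hball⟩ := Metric.isOpen_iff.1 φ.open_target (φ q₀) (φ.map_source hq₀)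
  let V : Set N := φ.source ∩ φ ⁻¹' Metric.ball (φ q₀) r
  have hV : IsOpen V := φ.isOpen_inter_preimage Metric.isOpen_ball
  have hq₀V : q₀ ∈ V := ⟨hq₀, Metric.mem_ball_self hr⟩
  obtain ⟨C₂, hC₂, hC₂c, hC₂V⟩ := exists_mem_nhds_isClosed_subset (hV.mem_nhds hq₀V)
  obtain ⟨C₁, hC₁, hC₁c, hC₁C₂⟩ := exists_mem_nhds_isClosed_subset (interior_mem_nhds.2 hC₂)
  obtain ⟨β, hβ0, hβ1, hβ⟩ := exists_continuous_zero_one_of_isClosed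
    (isOpen_interior (s := C₂)).isClosed_compl hC₁c
    (Set.disjoint_left.2 fun q h h' => h (hC₁C₂ h'))
  have hβC₂ (q : N) (hq : q ∉ C₂) : β q = 0 := hβ0 fun h => hq (interior_subset h)
  let m : N → N → ℝ → N := fun p q s =>
    if p ∈ V ∧ q ∈ V then φ.symm (φ p + (s * β q) • (φ q - φ p)) else p
  have hmV (p q : N) (s : ℝ) (hp : p ∈ V) (hq : q ∈ V) :
      m p q s = φ.symm (φ p + (s * β q) • (φ q - φ p)) := if_pos ⟨hp, hq⟩
  have hm0 (p q : N) (s : ℝ) (h : (s * β q) • (φ q - φ p) = 0) : m p q s = p := by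
    by_cases hpq : p ∈ V ∧ q ∈ V
    · rw [hmV p q s hpq.1 hpq.2, h, add_zero, φ.left_inv hpq.1.1]
    · exact if_neg hpq
  have hseg (p q : N) (s : ℝ) (hp : p ∈ V) (hq : q ∈ V) (hs : s ∈ Set.Icc (0 : ℝ) 1) :
      φ p + (s * β q) • (φ q - φ p) ∈ φ.target := by
    refine hball ((convex_ball _ _).add_smul_sub_mem hp.2 hq.2 ⟨mul_nonneg hs.1 (hβ q).1, ?_⟩)
    exact mul_le_one₀ hs.2 (hβ q).1 (hβ q).2
  have hmc : ContinuousOn (fun p : N × N × ℝ => m p.1 p.2.1 p.2.2)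
      (V ×ˢ (V ×ˢ Set.Icc (0 : ℝ) 1)) := by
    have h1 : ContinuousOn (fun p : N × N × ℝ => φ.symm (φ p.1 + (p.2.2 * β p.2.1) •
        (φ p.2.1 - φ p.1))) (V ×ˢ (V ×ˢ Set.Icc (0 : ℝ) 1)) := by
      refine φ.continuousOn_symm.comp ?_ fun p hp => hseg p.1 p.2.1 p.2.2 hp.1 hp.2.1 hp.2.2
      have e1 : ContinuousOn (fun p : N × N × ℝ => φ p.1) (V ×ˢ (V ×ˢ Set.Icc (0 : ℝ) 1)) :=
        φ.continuousOn.comp continuousOn_fst fun p hp => hp.1.1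
      have e2 : ContinuousOn (fun p : N × N × ℝ => φ p.2.1) (V ×ˢ (V ×ˢ Set.Icc (0 : ℝ) 1)) :=
        φ.continuousOn.comp continuousOn_snd.fst fun p hp => hp.2.1.1
      have e3 : Continuous (fun p : N × N × ℝ => p.2.2 * β p.2.1) := by fun_prop
      exact e1.add (e3.continuousOn.smul (e2.sub e1))
    exact h1.congr fun p hp => hmV _ _ _ hp.1 hp.2.1
  refine ⟨C₁, hC₁, fun O' hO' hd => ?_⟩
  let O₁ : Set (N × N) := O' ∩ Prod.snd ⁻¹' C₂ᶜ
  let O₂ : Set (N × N) := (V ×ˢ V) ∩ (fun p : N × N => (m p.1 p.2 1, p.2)) ⁻¹' O'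
  have hO₂ : IsOpen O₂ := by
    refine ContinuousOn.isOpen_inter_preimage ?_ (hV.prod hV) hO'
    refine ContinuousOn.prodMk ?_ continuousOn_snd
    exact hmc.comp (f := fun p : N × N => (p.1, p.2, (1 : ℝ))) (by fun_prop)
      fun p hp => ⟨hp.1, hp.2, zero_le_one, le_rfl⟩
  refine ⟨O₁ ∪ O₂, (hO'.inter (hC₂c.isOpen_compl.preimage continuous_snd)).union hO₂, ?_, ?_⟩
  · rintro ⟨p, q⟩ hpq
    obtain rfl : p = q := hpq
    by_cases hp : p ∈ C₂
    · refine Or.inr ⟨⟨hC₂V hp, hC₂V hp⟩, ?_⟩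
      change (m p p 1, p) ∈ O'
      rw [hm0 p p 1 (by rw [sub_self, smul_zero])]
      exact hd rfl
    · exact Or.inl ⟨hd rfl, hp⟩
  · intro x y hxy
    have hcont : Continuous (fun p : unitInterval × X => m (x p.2) (y p.2) p.1) := by
      rw [continuous_iff_continuousAt]
      rintro ⟨s, t⟩
      rcases hxy t with h | h
      · have h1 : ∀ᶠ p : unitInterval × X in 𝓝 (s, t), y p.2 ∈ C₂ᶜ :=
          (y.continuous.comp continuous_snd).continuousAt.preimage_mem_nhds
            (hC₂c.isOpen_compl.mem_nhds h.2)
        refine ContinuousAt.congr (f := fun p : unitInterval × X => x p.2) (by fun_prop) ?_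
        exact h1.mono fun p hp => (hm0 _ _ _ (by rw [hβC₂ _ hp, mul_zero, zero_smul])).symm
      · have h1 : ∀ᶠ p : unitInterval × X in 𝓝 (s, t),
            (x p.2, y p.2, (p.1 : ℝ)) ∈ V ×ˢ (V ×ˢ Set.Icc (0 : ℝ) 1) := by
          have e1 : ∀ᶠ p : unitInterval × X in 𝓝 (s, t), x p.2 ∈ V :=
            (x.continuous.comp continuous_snd).continuousAt.preimage_mem_nhds
              (hV.mem_nhds h.1.1)
          have e2 : ∀ᶠ p : unitInterval × X in 𝓝 (s, t), y p.2 ∈ V :=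
            (y.continuous.comp continuous_snd).continuousAt.preimage_mem_nhds
              (hV.mem_nhds h.1.2)
          filter_upwards [e1, e2] with p hp1 hp2 using ⟨hp1, hp2, p.1.2⟩
        have h2 : ContinuousAt (fun p : unitInterval × X => (x p.2, y p.2, (p.1 : ℝ))) (s, t) := by
          fun_prop
        have h3 := (hmc (x t, y t, (s : ℝ)) h1.self_of_nhds).tendsto
        exact h3.comp (tendsto_nhdsWithin_iff.2 ⟨h2, h1⟩)
    have hx' : Continuous (fun t => m (x t) (y t) 1) :=
      hcont.comp (f := fun t => ((1 : unitInterval), t)) (by fun_prop)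
    refine ⟨⟨fun t => m (x t) (y t) 1, hx'⟩, ⟨⟨⟨fun p => m (x p.2) (y p.2) p.1, hcont⟩, ?_, ?_⟩⟩,
      fun t => ?_, fun t ht => ?_⟩
    · intro t
      exact hm0 _ _ _ (by rw [show ((0 : unitInterval) : ℝ) = 0 from rfl, zero_mul, zero_smul])
    · intro t; rfl
    · change (m (x t) (y t) 1, y t) ∈ O'
      rcases hxy t with h | h
      · rw [hm0 _ _ _ (by rw [hβC₂ _ h.2, mul_zero, zero_smul])]
        exact h.1
      · exact h.2
    · change m (x t) (y t) 1 = y t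
      rcases ht with ht | ht
      · have hyC₂ : y t ∈ C₂ := interior_subset (hC₁C₂ ht)
        have h : (x t, y t) ∈ O₂ := (hxy t).resolve_left fun h => h.2 hyC₂
        have hβt : β (y t) = 1 := hβ1 ht
        rw [hmV _ _ _ h.1.1 h.1.2, hβt, one_mul, one_smul, add_sub_cancel, φ.left_inv h.1.2.1]
      · rw [hm0 _ _ _ (by rw [ht, sub_self, smul_zero])]
        exact ht

/-- Maps to a compact manifold that are sufficiently close to each other are homotopic. -/
theorem exists_homotopic_of_close (X : Type*) [TopologicalSpace X] {d : ℕ}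
    [ChartedSpace (EuclideanSpace ℝ (Fin d)) N] [CompactSpace N] [T2Space N] :
    ∃ O : Set (N × N), IsOpen O ∧ Set.diagonal N ⊆ O ∧ ∀ x y : C(X, N),
      (∀ t, (x t, y t) ∈ O) → x.Homotopic y := by
  have h : IsDeformable X (Set.univ : Set N) := by
    refine isCompact_univ.induction_on (p := IsDeformable X) ?_ ?_ (fun _ _ => .union) ?_
    · exact fun O' hO' hd => ⟨O', hO', hd, fun x y hxy => ⟨x, .refl x, hxy, fun t ht =>
        ht.resolve_left id⟩⟩
    · intro C C' hC h O' hO' hd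
      obtain ⟨O, hO, hdO, h₁⟩ := h O' hO' hd
      refine ⟨O, hO, hdO, fun x y hxy => ?_⟩
      obtain ⟨x', hx', hx'y, hx'C⟩ := h₁ x y hxy
      exact ⟨x', hx', hx'y, fun t ht => hx'C t (ht.imp_left fun h => hC h)⟩
    · intro q₀ _
      obtain ⟨C, hC, h⟩ := exists_isDeformable_nhds (X := X) (d := d) q₀
      exact ⟨C, mem_nhdsWithin_of_mem_nhds hC, h⟩
  obtain ⟨O, hO, hd, h₁⟩ := h Set.univ isOpen_univ (Set.subset_univ _)
  refine ⟨O, hO, hd, fun x y hxy => ?_⟩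
  obtain ⟨x', hx', -, hx'C⟩ := h₁ x y hxy
  have h2 : x' = y := ContinuousMap.ext fun t => hx'C t (Or.inl (Set.mem_univ _))
  rwa [h2] at hx'

end Homotopy

/-- The homotopy class of a loop is locally constant with respect to uniform convergence. -/
theorem exists_loopClass_eq_of_close [CompactSpace M] [T2Space M] :
    ∃ O : Set (M × M), IsOpen O ∧ Set.diagonal M ⊆ O ∧
      ∀ x y : SmoothLoop (cotI n) (Cot n M), (∀ t, ((x t).1, (y t).1) ∈ O) →
        loopClass x = loopClass y := by
  obtain ⟨O, hO, hd, h⟩ := exists_homotopic_of_close (N := M) UnitAddCircle (d := n)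
  refine ⟨O, hO, hd, fun x y hxy => Quotient.sound (h _ _ fun t => ?_)⟩
  induction t using QuotientAddGroup.induction_on with
  | H t => exact hxy t

/-! ### Derivatives of functions along critical loops -/

section TimeDeriv

variable {𝔣 : Data n M} {W : Type*} [NormedAddCommGroup W] [NormedSpace ℝ W]
  {Φ : ℝ × ℝ → Cot n M → W}

/-- The vector field `f(η) χ(t) X_F + X_{H_t}`, whose integral curves are the loops of the critical
points with Lagrange multiplier `η`; the parameter is `p = (η, t)`. -/
def critVF (𝔣 : Data n M) (p : ℝ × ℝ) (z : Cot n M) : TangentSpace (cotI n) z :=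
  (𝔣.f p.1 * 𝔣.χ p.2) • hamVF 𝔣.F z + hamVF (𝔣.H p.2) z

variable (Φ) in
/-- Smoothness of a function of `p = (η, t)` and `z ∈ T*M`. -/
def IsSmoothParam : Prop :=
  ContMDiff (𝓘(ℝ, ℝ × ℝ).prod (cotI n)) 𝓘(ℝ, W) ∞ (fun q : (ℝ × ℝ) × Cot n M => Φ q.1 q.2)

/-- The derivative of `Φ(η, t, x(t))` with respect to `t` along the integral curves `x` of
`critVF`, as a function of `(η, t)` and the point `x(t)`. -/
def timeDeriv (𝔣 : Data n M) (Φ : ℝ × ℝ → Cot n M → W) (p : ℝ × ℝ) (z : Cot n M) : W :=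
  mfderiv (𝓘(ℝ, ℝ × ℝ).prod (cotI n)) 𝓘(ℝ, W) (fun q : (ℝ × ℝ) × Cot n M => Φ q.1 q.2) (p, z)
    (show (ℝ × ℝ) × CotVec n from (((0 : ℝ), (1 : ℝ)), critVF 𝔣 p z))

theorem contMDiffAt_dco_critVF (h𝔣 : IsSmoothData 𝔣) (p : ℝ × ℝ) (z : Cot n M) :
    ContMDiffAt (𝓘(ℝ, ℝ × ℝ).prod (cotI n)) 𝓘(ℝ, CotVec n) ∞
      (fun q : (ℝ × ℝ) × Cot n M => dco z q.2 (critVF 𝔣 q.1 q.2)) (p, z) := by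
  have h1 : ContMDiffAt (𝓘(ℝ, ℝ × ℝ).prod (cotI n)) 𝓘(ℝ, CotVec n) ∞
      (fun q : (ℝ × ℝ) × Cot n M => dco z q.2 (hamVF 𝔣.F q.2)) (p, z) :=
    ContMDiffAt.comp (p, z) (contMDiffAt_dco ⟨z, hamVF 𝔣.F z⟩)
      ((contMDiff_hamVF_autonomous h𝔣.F).comp contMDiff_snd (p, z))
  have h2 : ContMDiff (𝓘(ℝ, ℝ × ℝ).prod (cotI n)) (𝓘(ℝ, ℝ).prod (cotI n)) ∞
      (fun q : (ℝ × ℝ) × Cot n M => (q.1.2, q.2)) :=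
    (contDiff_snd.contMDiff.comp contMDiff_fst).prodMk contMDiff_snd
  have h3 : ContMDiffAt (𝓘(ℝ, ℝ × ℝ).prod (cotI n)) 𝓘(ℝ, CotVec n) ∞
      (fun q : (ℝ × ℝ) × Cot n M => dco z q.2 (hamVF (𝔣.H q.1.2) q.2)) (p, z) :=
    ContMDiffAt.comp (p, z) (contMDiffAt_dco ⟨z, hamVF (𝔣.H p.2) z⟩)
      ((contMDiff_hamVF h𝔣.H).comp h2 (p, z))
  have h4 : ContDiff ℝ ∞ (fun p : ℝ × ℝ => 𝔣.f p.1 * 𝔣.χ p.2) :=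
    (h𝔣.f.comp contDiff_fst).mul (h𝔣.χ.comp contDiff_snd)
  have h5 : ContMDiffAt (𝓘(ℝ, ℝ × ℝ).prod (cotI n)) 𝓘(ℝ, ℝ) ∞
      (fun q : (ℝ × ℝ) × Cot n M => 𝔣.f q.1.1 * 𝔣.χ q.1.2) (p, z) :=
    h4.contMDiff.comp contMDiff_fst (p, z)
  refine ((h5.smul h1).add h3).congr_of_eventuallyEq (Filter.Eventually.of_forall fun q => ?_)
  change dco z q.2 (_ + _) = _
  rw [dco_add, dco_smul]
  rfl

theorem contMDiffAt_param_comp_coInv (hΦ : IsSmoothParam Φ) {z₀ z : Cot n M} (hz : z ∈ dom z₀)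
    (p : ℝ × ℝ) :
    ContDiffAt ℝ ∞ (fun w : (ℝ × ℝ) × CotVec n => Φ w.1 (coInv z₀ w.2)) (p, co z₀ z) := by
  refine ContMDiffAt.contDiffAt ?_
  rw [modelWithCornersSelf_prod, ← chartedSpaceSelf_prod]
  have h1 : ContMDiffAt (𝓘(ℝ, ℝ × ℝ).prod 𝓘(ℝ, CotVec n)) (cotI n) ∞
      (fun w : (ℝ × ℝ) × CotVec n => coInv z₀ w.2) (p, co z₀ z) :=
    ContMDiffAt.comp (I' := 𝓘(ℝ, CotVec n)) (p, co z₀ z) (contMDiffAt_coInv (co_mem hz))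
      contMDiffAt_snd
  exact ContMDiffAt.comp (I' := 𝓘(ℝ, ℝ × ℝ).prod (cotI n)) (p, co z₀ z) (hΦ _)
    (contMDiffAt_fst.prodMk h1)

/-- The derivative along integral curves in natural coordinates. -/
theorem timeDeriv_eq (hΦ : IsSmoothParam Φ) {z₀ z : Cot n M} (hz : z ∈ dom z₀) (p : ℝ × ℝ) :
    timeDeriv 𝔣 Φ p z = fderiv ℝ (fun w : (ℝ × ℝ) × CotVec n => Φ w.1 (coInv z₀ w.2)) (p, co z₀ z)
      ((0, 1), dco z₀ z (critVF 𝔣 p z)) := by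
  have h1 := (contMDiffAt_param_comp_coInv hΦ hz p).differentiableAt (by simp)
  have h1' : HasMFDerivAt (𝓘(ℝ, ℝ × ℝ).prod 𝓘(ℝ, CotVec n)) 𝓘(ℝ, W)
      (fun w : (ℝ × ℝ) × CotVec n => Φ w.1 (coInv z₀ w.2)) (p, co z₀ z)
      (fderiv ℝ (fun w : (ℝ × ℝ) × CotVec n => Φ w.1 (coInv z₀ w.2)) (p, co z₀ z)) := by
    rw [← modelWithCornersSelf_prod, chartedSpaceSelf_prod]
    exact h1.hasFDerivAt.hasMFDerivAt
  have h2 : HasMFDerivAt (𝓘(ℝ, ℝ × ℝ).prod (cotI n)) (𝓘(ℝ, ℝ × ℝ).prod 𝓘(ℝ, CotVec n))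
      (fun q : (ℝ × ℝ) × Cot n M => (q.1, co z₀ q.2)) (p, z)
      ((ContinuousLinearMap.fst ℝ (ℝ × ℝ) (TangentSpace (cotI n) z)).prod
        ((dco z₀ z).comp (ContinuousLinearMap.snd ℝ (ℝ × ℝ) (TangentSpace (cotI n) z)))) := by
    have e1 : HasMFDerivAt (𝓘(ℝ, ℝ × ℝ).prod (cotI n)) 𝓘(ℝ, CotVec n)
        (fun q : (ℝ × ℝ) × Cot n M => co z₀ q.2) (p, z)
        ((dco z₀ z).comp (ContinuousLinearMap.snd ℝ (ℝ × ℝ) (TangentSpace (cotI n) z))) :=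
      HasMFDerivAt.comp (p, z) (hasMFDerivAt_co hz) (hasMFDerivAt_snd (x := (p, z)))
    exact HasMFDerivAt.prodMk (hasMFDerivAt_fst (x := (p, z))) e1
  have h3 := HasMFDerivAt.comp (p, z) h1' h2
  have h4 : (fun q : (ℝ × ℝ) × Cot n M => Φ q.1 q.2) =ᶠ[𝓝 (p, z)]
      (fun w : (ℝ × ℝ) × CotVec n => Φ w.1 (coInv z₀ w.2)) ∘ fun q => (q.1, co z₀ q.2) := by
    have h5 : ∀ᶠ q : (ℝ × ℝ) × Cot n M in 𝓝 (p, z), q.2 ∈ dom z₀ :=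
      (continuous_snd.tendsto (p, z)).eventually (dom_mem_nhds hz)
    exact h5.mono fun q hq => congrArg (Φ q.1) (coInv_co hq).symm
  exact DFunLike.congr_fun (h3.congr_of_eventuallyEq h4).mfderiv _

theorem IsSmoothParam.timeDeriv (h𝔣 : IsSmoothData 𝔣) (hΦ : IsSmoothParam Φ) :
    IsSmoothParam (timeDeriv 𝔣 Φ) := by
  rintro ⟨p, z⟩
  have hz := mem_dom_self z
  have h1 : ContMDiffAt (𝓘(ℝ, ℝ × ℝ).prod (cotI n)) 𝓘(ℝ, CotVec n) ∞
      (fun q : (ℝ × ℝ) × Cot n M => co z q.2) (p, z) :=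
    ContMDiffAt.comp (p, z) (contMDiffAt_co hz) contMDiffAt_snd
  have h2 : ContDiffAt ℝ ∞ (fun w : ((ℝ × ℝ) × CotVec n) × CotVec n =>
      fderiv ℝ (fun w : (ℝ × ℝ) × CotVec n => Φ w.1 (coInv z w.2)) w.1 ((0, 1), w.2))
      ((p, co z z), dco z z (critVF 𝔣 p z)) :=
    ((contMDiffAt_param_comp_coInv hΦ hz p).fderiv_right (m := ∞) (by simp)).fst'.clm_apply
      (contDiffAt_const.prodMk contDiffAt_snd)
  have h0 : ContMDiffAt (𝓘(ℝ, ℝ × ℝ).prod (cotI n)) 𝓘(ℝ, ℝ × ℝ) ∞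
      (fun q : (ℝ × ℝ) × Cot n M => q.1) (p, z) := contMDiffAt_fst
  have h3 := ContMDiffAt.comp (I' := 𝓘(ℝ, ((ℝ × ℝ) × CotVec n) × CotVec n)) (p, z) h2.contMDiffAt
    ((h0.prodMk_space h1).prodMk_space (contMDiffAt_dco_critVF h𝔣 p z))
  refine h3.congr_of_eventuallyEq ?_
  have h5 : ∀ᶠ q : (ℝ × ℝ) × Cot n M in 𝓝 (p, z), q.2 ∈ dom z :=
    (continuous_snd.tendsto (p, z)).eventually (dom_mem_nhds hz)
  exact h5.mono fun q hq => timeDeriv_eq hΦ hq q.1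

theorem vel_eq_critVF {x : ℝ → Cot n M} {η t : ℝ} (h : defect 𝔣 x η t = 0) :
    vel (cotI n) x t = critVF 𝔣 (η, t) (x t) := by
  have h1 : vel (cotI n) x t - ((𝔣.f η * 𝔣.χ t) • hamVF 𝔣.F (x t) + hamVF (𝔣.H t) (x t)) = 0 :=
    (sub_sub _ _ _).symm.trans h
  exact sub_eq_zero.1 h1

theorem hasDerivAt_timeDeriv (hΦ : IsSmoothParam Φ) {x : ℝ → Cot n M}
    {η t : ℝ} (hx : MDifferentiableAt 𝓘(ℝ, ℝ) (cotI n) x t)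
    (h : vel (cotI n) x t = critVF 𝔣 (η, t) (x t)) :
    HasDerivAt (fun τ => Φ (η, τ) (x τ)) (timeDeriv 𝔣 Φ (η, t) (x t)) t := by
  have h1 : HasFDerivAt (fun τ : ℝ => (η, τ))
      (ContinuousLinearMap.toSpanSingleton ℝ ((0 : ℝ), (1 : ℝ))) t :=
    ((hasDerivAt_const t η).prodMk (hasDerivAt_id t)).hasFDerivAt
  have h2 := HasMFDerivAt.prodMk h1.hasMFDerivAt hx.hasMFDerivAt
  let L : ℝ →L[ℝ] W := (mfderiv (𝓘(ℝ, ℝ × ℝ).prod (cotI n)) 𝓘(ℝ, W)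
    (fun q : (ℝ × ℝ) × Cot n M => Φ q.1 q.2) ((η, t), x t)).comp
      ((ContinuousLinearMap.toSpanSingleton ℝ ((0 : ℝ), (1 : ℝ))).prod
        (mfderiv 𝓘(ℝ, ℝ) (cotI n) x t))
  have e1 := ((hΦ ((η, t), x t)).mdifferentiableAt (by simp)).hasMFDerivAt
  have e2 : HasMFDerivAt 𝓘(ℝ, ℝ) 𝓘(ℝ, W) (fun τ => Φ (η, τ) (x τ)) t L :=
    HasMFDerivAt.comp (g := fun q : (ℝ × ℝ) × Cot n M => Φ q.1 q.2)
      (f := fun τ : ℝ => ((η, τ), x τ)) t e1 h2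
  have h3 : HasFDerivAt (fun τ => Φ (η, τ) (x τ)) L t := e2.hasFDerivAt
  refine h3.hasDerivAt.congr_deriv ?_
  refine congrArg (mfderiv (𝓘(ℝ, ℝ × ℝ).prod (cotI n)) 𝓘(ℝ, W)
    (fun q : (ℝ × ℝ) × Cot n M => Φ q.1 q.2) ((η, t), x t)) ?_
  refine Prod.ext ?_ h
  exact one_smul ℝ ((0 : ℝ), (1 : ℝ))

/-- The iterated time derivatives of a function on `T*M` along critical loops. -/
theorem iteratedDeriv_timeDeriv (h𝔣 : IsSmoothData 𝔣) {x : ℝ → Cot n M} {η : ℝ}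
    (hx : MDifferentiable 𝓘(ℝ, ℝ) (cotI n) x) (hd : ∀ t, defect 𝔣 x η t = 0) (k : ℕ) :
    ∀ {Φ : ℝ × ℝ → Cot n M → W}, IsSmoothParam Φ →
      IsSmoothParam ((timeDeriv 𝔣)^[k] Φ) ∧
      iteratedDeriv k (fun t => Φ (η, t) (x t)) = fun t => ((timeDeriv 𝔣)^[k] Φ) (η, t) (x t) := by
  induction k with
  | zero => exact fun hΦ => ⟨hΦ, iteratedDeriv_zero⟩
  | succ k ih =>
    intro Φ hΦ
    have h1 := ih (hΦ.timeDeriv h𝔣)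
    refine ⟨h1.1, ?_⟩
    rw [iteratedDeriv_succ', Function.iterate_succ_apply, ← h1.2]
    congr 1
    exact funext fun t => (hasDerivAt_timeDeriv hΦ (hx t) (vel_eq_critVF (hd t))).deriv

end TimeDeriv

/-! ### Limits of critical loops -/

section CritLimit

variable {𝔣 : Data n M} {W : Type*} [NormedAddCommGroup W] [NormedSpace ℝ W]
  {Φ : ℝ × ℝ → Cot n M → W} {ι : Type*} {l : Filter ι}
  {x : ι → SmoothLoop (cotI n) (Cot n M)} {η : ι → ℝ} {y : ℝ → Cot n M} {η₀ : ℝ}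

/-- The solutions `(x i, η i)` of the equation for critical points stay in a compact set and
converge pointwise to `(y, η₀)` along the filter `l`. -/
structure IsCritLimit (𝔣 : Data n M) (l : Filter ι) (x : ι → SmoothLoop (cotI n) (Cot n M))
    (η : ι → ℝ) (y : ℝ → Cot n M) (η₀ : ℝ) : Prop where
  defect_eq_zero : ∀ i t, defect 𝔣 (x i) (η i) t = 0
  bounded : ∃ (K : Set (Cot n M)) (L : ℝ), IsCompact K ∧ (∀ i t, x i t ∈ K) ∧ ∀ i, |η i| ≤ L
  tendsto : ∀ t, Filter.Tendsto (fun i => x i t) l (𝓝 (y t))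
  tendsto_mult : Filter.Tendsto η l (𝓝 η₀)

theorem IsCritLimit.hasDerivAt (h : IsCritLimit 𝔣 l x η y η₀) (hΦ : IsSmoothParam Φ) (i : ι)
    (t : ℝ) : HasDerivAt (fun τ => Φ (η i, τ) (x i τ)) (timeDeriv 𝔣 Φ (η i, t) (x i t)) t :=
  hasDerivAt_timeDeriv hΦ ((x i).smooth.mdifferentiable (by simp) t)
    (vel_eq_critVF (h.defect_eq_zero i t))

theorem IsCritLimit.tendsto_param (h : IsCritLimit 𝔣 l x η y η₀) (hΦ : IsSmoothParam Φ) (t : ℝ) :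
    Filter.Tendsto (fun i => Φ (η i, t) (x i t)) l (𝓝 (Φ (η₀, t) (y t))) :=
  (hΦ.continuous.tendsto ((η₀, t), y t)).comp
    ((h.tendsto_mult.prodMk_nhds tendsto_const_nhds).prodMk_nhds (h.tendsto t))

/-- The equation bounds the derivatives in terms of the values, so that pointwise convergence is
uniform. -/
theorem IsCritLimit.tendstoUniformlyOn (h : IsCritLimit 𝔣 l x η y η₀) (h𝔣 : IsSmoothData 𝔣)
    (hΦ : IsSmoothParam Φ) (A B : ℝ) :
    TendstoUniformlyOn (fun i t => Φ (η i, t) (x i t)) (fun t => Φ (η₀, t) (y t)) l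
      (Set.Icc A B) := by
  obtain ⟨K, L, hK, hxK, hηL⟩ := h.bounded
  obtain ⟨C, hC⟩ := (((isCompact_Icc (a := -L) (b := L)).prod
    (isCompact_Icc (a := A) (b := B))).prod hK).exists_bound_of_continuousOn
      (hΦ.timeDeriv h𝔣).continuous.continuousOn
  have h1 (i : ι) : LipschitzWith C.toNNReal
      (fun t : Set.Icc A B => Φ (η i, t) (x i t)) := by
    refine LipschitzWith.of_dist_le_mul fun s t => ?_
    have h2 := (convex_Icc A B).norm_image_sub_le_of_norm_hasDerivWithin_le
      (f := fun τ => Φ (η i, τ) (x i τ)) (C := C.toNNReal)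
      (fun τ _ => (h.hasDerivAt hΦ i τ).hasDerivWithinAt)
      (fun τ hτ => (hC ((η i, τ), x i τ) ⟨⟨abs_le.1 (hηL i), hτ⟩, hxK i τ⟩).trans
        (Real.le_coe_toNNReal C)) t.2 s.2
    rw [dist_eq_norm, Subtype.dist_eq, dist_eq_norm]
    exact h2
  have h2 := (LipschitzWith.uniformEquicontinuous _ _ h1).equicontinuous
  rw [tendstoUniformlyOn_iff_tendstoUniformly_comp_coe]
  refine UniformFun.tendsto_iff_tendstoUniformly.1
    ((h2.tendsto_uniformFun_iff_pi l fun t : Set.Icc A B => Φ (η₀, t) (y t)).2 ?_)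
  exact tendsto_pi_nhds.2 fun t => h.tendsto_param hΦ t

theorem IsCritLimit.hasDerivAt_limit [l.NeBot] (h : IsCritLimit 𝔣 l x η y η₀)
    (h𝔣 : IsSmoothData 𝔣) (hΦ : IsSmoothParam Φ) (t : ℝ) :
    HasDerivAt (fun τ => Φ (η₀, τ) (y τ)) (timeDeriv 𝔣 Φ (η₀, t) (y t)) t :=
  hasDerivAt_of_tendstoUniformlyOn (isOpen_Ioo (a := t - 1) (b := t + 1))
    ((h.tendstoUniformlyOn h𝔣 (hΦ.timeDeriv h𝔣) (t - 1) (t + 1)).mono Set.Ioo_subset_Icc_self)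
    (Filter.Eventually.of_forall fun i τ _ => h.hasDerivAt hΦ i τ)
    (fun τ _ => h.tendsto_param hΦ τ) ⟨by linarith, by linarith⟩

theorem IsCritLimit.contDiff [l.NeBot] (h : IsCritLimit 𝔣 l x η y η₀) (h𝔣 : IsSmoothData 𝔣)
    (hΦ : IsSmoothParam Φ) : ContDiff ℝ ∞ (fun τ => Φ (η₀, τ) (y τ)) := by
  refine contDiff_infty.2 fun k => ?_
  induction k generalizing Φ with
  | zero => exact contDiff_zero.2 (continuous_iff_continuousAt.2 fun t =>
      (h.hasDerivAt_limit h𝔣 hΦ t).continuousAt)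
  | succ k ih =>
    refine contDiff_succ_iff_deriv (n := (k : WithTop ℕ∞)).2
      ⟨fun t => (h.hasDerivAt_limit h𝔣 hΦ t).differentiableAt,
        fun hk => absurd hk (WithTop.coe_ne_top (a := (k : ℕ∞))), ?_⟩
    rw [funext fun t => (h.hasDerivAt_limit h𝔣 hΦ t).deriv]
    exact ih (hΦ.timeDeriv h𝔣)

theorem isSmoothParam_comp {φ : Cot n M → W} (hφ : ContMDiff (cotI n) 𝓘(ℝ, W) ∞ φ) :
    IsSmoothParam (fun _ : ℝ × ℝ => φ) :=
  hφ.comp contMDiff_snd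

/-- The limit loop is smooth, as its coordinates are, and solves the equation. -/
theorem IsCritLimit.contMDiff_limit [T2Space M] [l.NeBot] (h : IsCritLimit 𝔣 l x η y η₀)
    (h𝔣 : IsSmoothData 𝔣) :
    ContMDiff 𝓘(ℝ, ℝ) (cotI n) ∞ y ∧ ∀ t, defect 𝔣 y η₀ t = 0 := by
  refine forall_and.1 fun t => ?_
  let z₀ := y t
  have hz₀ := mem_dom_self z₀
  have hdom {z : Cot n M} (hz : z ∈ (chartAt (ModelProd (EuclideanSpace ℝ (Fin n))
      (EuclideanSpace ℝ (Fin n) →L[ℝ] ℝ)) z₀).source) : z ∈ dom z₀ := by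
    rwa [dom, extChartAt_source]
  let ρ : SmoothBumpFunction (cotI n) z₀ := Classical.arbitrary _
  have h1 : ContMDiff (cotI n) 𝓘(ℝ, ℝ) ∞ ρ := ρ.contMDiff
  have h2 : ContMDiff (cotI n) 𝓘(ℝ, CotVec n) ∞ (fun z => ρ z • co z₀ z) :=
    ρ.contMDiff_smul fun z hz => (contMDiffAt_co (hdom hz)).contMDiffWithinAt
  have h3 := h.contDiff h𝔣 (isSmoothParam_comp h1)
  have h4 := h.contDiff h𝔣 (isSmoothParam_comp h2)
  have h5 : ρ (y t) = 1 := ρ.eq_one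
  have h6 : ∀ᶠ τ in 𝓝 t, 0 < ρ (y τ) :=
    h3.continuous.continuousAt.eventually (lt_mem_nhds (one_pos.trans_eq h5.symm))
  have h7 : ∀ᶠ τ in 𝓝 t, y τ ∈ dom z₀ :=
    h6.mono fun τ hτ => hdom (ρ.support_subset_source hτ.ne')
  -- dividing `ρ • co z₀` by `ρ` recovers the coordinates of `y` near `t`
  have h8 : ContDiffAt ℝ ∞ (fun τ => (ρ (y τ))⁻¹ • (ρ (y τ) • co z₀ (y τ))) t :=
    (h3.contDiffAt.inv (by rw [h5]; exact one_ne_zero)).smul h4.contDiffAt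
  have h9 : ContMDiffAt 𝓘(ℝ, ℝ) (cotI n) ∞ y t := by
    refine contMDiffAt_of_co h7 (h8.contMDiffAt.congr_of_eventuallyEq ?_)
    exact h6.mono fun τ hτ => (inv_smul_smul₀ hτ.ne' _).symm
  refine ⟨h9, ?_⟩
  -- as `ρ = 1` near `y t`, the derivative of `ρ • co z₀` along `y` is the velocity in coordinates
  have e1 := h.hasDerivAt_limit h𝔣 (isSmoothParam_comp h2) t
  have e2 : HasDerivAt (fun τ => ρ (y τ) • co z₀ (y τ)) (dco z₀ (y t) (vel (cotI n) y t)) t := by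
    refine (hasDerivAt_co_curve (h9.mdifferentiableAt (by simp)) hz₀).congr_of_eventuallyEq ?_
    refine (h9.continuousAt.eventually ρ.eventuallyEq_one).mono fun τ hτ => ?_
    have h : ρ (y τ) = 1 := hτ
    change ρ (y τ) • co z₀ (y τ) = _
    rw [h, one_smul]
  have e3 : timeDeriv 𝔣 (fun _ z => ρ z • co z₀ z) (η₀, t) (y t)
      = dco z₀ (y t) (critVF 𝔣 (η₀, t) (y t)) := by
    rw [timeDeriv_eq (isSmoothParam_comp h2) hz₀]
    have e4 : (fun w : (ℝ × ℝ) × CotVec n => ρ (coInv z₀ w.2) • co z₀ (coInv z₀ w.2))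
        =ᶠ[𝓝 ((η₀, t), co z₀ z₀)] Prod.snd := by
      have e5 : ∀ᶠ w in 𝓝 (co z₀ z₀), ρ (coInv z₀ w) = 1 := by
        have e6 : Filter.Tendsto (coInv z₀) (𝓝 (co z₀ z₀)) (𝓝 z₀) := by
          have := (contMDiffAt_coInv (co_mem hz₀)).continuousAt.tendsto
          rwa [coInv_co hz₀] at this
        exact e6.eventually ρ.eventuallyEq_one
      have e7 : ∀ᶠ w in 𝓝 (co z₀ z₀), w ∈ tgt z₀ := (isOpen_tgt z₀).mem_nhds (co_mem hz₀)
      refine ((continuous_snd.tendsto ((η₀, t), co z₀ z₀)).eventually (e5.and e7)).mono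
        fun w hw => ?_
      change ρ (coInv z₀ w.2) • co z₀ (coInv z₀ w.2) = w.2
      rw [hw.1, one_smul, co_coInv hw.2]
    rw [e4.fderiv_eq, fderiv_snd]
    rfl
  have e8 : vel (cotI n) y t = critVF 𝔣 (η₀, t) (y t) :=
    dco_injective hz₀ ((e2.unique e1).trans e3)
  change vel (cotI n) y t - _ - _ = 0
  rw [e8, sub_sub]
  exact sub_self _

end CritLimit

section CritLimit

variable {𝔣 : Data n M} {ι : Type*} {l : Filter ι} {x : ι → SmoothLoop (cotI n) (Cot n M)}
  {η : ι → ℝ} {η₀ : ℝ}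

theorem isSmoothParam_χ_mul (h𝔣 : IsSmoothData 𝔣) {φ : Cot n M → ℝ}
    (hφ : ContMDiff (cotI n) 𝓘(ℝ, ℝ) ∞ φ) :
    IsSmoothParam (fun (p : ℝ × ℝ) z => 𝔣.χ p.2 * φ z) :=
  ((h𝔣.χ.comp contDiff_snd).contMDiff.comp contMDiff_fst).mul (hφ.comp contMDiff_snd)

theorem isSmoothParam_H (h𝔣 : IsSmoothData 𝔣) :
    IsSmoothParam (fun (p : ℝ × ℝ) z => liouville z (hamVF (𝔣.H p.2) z) - 𝔣.H p.2 z) := by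
  have h2 : ContMDiff (𝓘(ℝ, ℝ × ℝ).prod (cotI n)) (𝓘(ℝ, ℝ).prod (cotI n)) ∞
      (fun q : (ℝ × ℝ) × Cot n M => (q.1.2, q.2)) :=
    (contDiff_snd.contMDiff.comp contMDiff_fst).prodMk contMDiff_snd
  exact (contMDiff_liouville.comp ((contMDiff_hamVF h𝔣.H).comp h2)).sub (h𝔣.H.comp h2)

theorem IsCritLimit.tendsto_integral [l.NeBot] {y : ℝ → Cot n M} (h : IsCritLimit 𝔣 l x η y η₀)
    (h𝔣 : IsSmoothData 𝔣) {Φ : ℝ × ℝ → Cot n M → ℝ} (hΦ : IsSmoothParam Φ) :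
    Filter.Tendsto (fun i => ∫ t in (0 : ℝ)..1, Φ (η i, t) (x i t)) l
      (𝓝 (∫ t in (0 : ℝ)..1, Φ (η₀, t) (y t))) := by
  have h1 : IntervalIntegrable (fun t => Φ (η₀, t) (y t)) MeasureTheory.volume 0 1 :=
    (h.contDiff h𝔣 hΦ).continuous.intervalIntegrable 0 1
  have h2 (i : ι) : IntervalIntegrable (fun t => Φ (η i, t) (x i t)) MeasureTheory.volume 0 1 :=
    (continuous_iff_continuousAt.2 fun t => (h.hasDerivAt hΦ i t).continuousAt).intervalIntegrable
      0 1
  refine Metric.tendsto_nhds.2 fun ε hε => ?_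
  refine (Metric.tendstoUniformlyOn_iff.1 (h.tendstoUniformlyOn h𝔣 hΦ 0 1) (ε / 2)
    (half_pos hε)).mono fun i hi => ?_
  rw [dist_eq_norm, ← intervalIntegral.integral_sub (h2 i) h1]
  refine (intervalIntegral.norm_integral_le_of_norm_le_const (C := ε / 2) fun t ht => ?_).trans_lt
    (by norm_num; linarith)
  rw [Set.uIoc_of_le zero_le_one] at ht
  rw [← dist_eq_norm, dist_comm]
  exact (hi t ⟨ht.1.le, ht.2⟩).le

theorem action_eq_of_defect_eq_zero (h𝔣 : IsSmoothData 𝔣) {y : ℝ → Cot n M}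
    (hy : ContMDiff 𝓘(ℝ, ℝ) (cotI n) ∞ y) {η : ℝ} (hd : ∀ t, defect 𝔣 y η t = 0) :
    action 𝔣 y η =
      𝔣.f η * (∫ t in (0 : ℝ)..1, 𝔣.χ t * (liouville (y t) (hamVF 𝔣.F (y t)) - 𝔣.F (y t)))
        + ∫ t in (0 : ℝ)..1, (liouville (y t) (hamVF (𝔣.H t) (y t)) - 𝔣.H t (y t)) := by
  rw [action_eq h𝔣 hy]
  simp only [hd, liouville_zero, intervalIntegral.integral_zero, zero_add]

theorem IsCritLimit.tendsto_action [l.NeBot] [T2Space M] {y : ℝ → Cot n M}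
    (h : IsCritLimit 𝔣 l x η y η₀) (h𝔣 : IsSmoothData 𝔣) :
    Filter.Tendsto (fun i => action 𝔣 (x i) (η i)) l (𝓝 (action 𝔣 y η₀)) := by
  obtain ⟨hy, hd⟩ := h.contMDiff_limit h𝔣
  rw [action_eq_of_defect_eq_zero h𝔣 hy hd]
  simp only [fun i => action_eq_of_defect_eq_zero h𝔣 (x i).smooth (h.defect_eq_zero i)]
  have h1 : ContMDiff (cotI n) 𝓘(ℝ, ℝ) ∞ (fun z => liouville z (hamVF 𝔣.F z) - 𝔣.F z) :=
    (contMDiff_liouville.comp (contMDiff_hamVF_autonomous h𝔣.F)).sub h𝔣.F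
  exact (((h𝔣.f.continuous.tendsto η₀).comp h.tendsto_mult).mul
    (h.tendsto_integral h𝔣 (isSmoothParam_χ_mul h𝔣 h1))).add
      (h.tendsto_integral h𝔣 (isSmoothParam_H h𝔣))

/-- The convergence of critical loops is uniform in the topology of `M`. -/
theorem IsCritLimit.eventually_close [T2Space M] {y : ℝ → Cot n M} (hyc : Continuous y)
    (h : IsCritLimit 𝔣 l x η y η₀) (h𝔣 : IsSmoothData 𝔣) {O : Set (M × M)} (hO : IsOpen O)
    (hd : Set.diagonal M ⊆ O) :
    ∀ᶠ i in l, ∀ t ∈ Set.Icc (0 : ℝ) 1, ((x i t).1, (y t).1) ∈ O := by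
  refine isCompact_Icc.induction_on (p := fun s => ∀ᶠ i in l, ∀ t ∈ s, ((x i t).1, (y t).1) ∈ O)
    (by simp) (fun s s' hs h' => h'.mono fun i hi t ht => hi t (hs ht))
    (fun s s' h1 h2 => (h1.and h2).mono fun i hi t ht => ht.elim (hi.1 t) (hi.2 t))
    fun t _ => ?_
  -- the loops are separated from the complement of a neighbourhood by a bump function
  obtain ⟨V, hV, hVO⟩ : ∃ V ∈ 𝓝 (y t), ∀ z ∈ V, ∀ z' ∈ V, (z.1, z'.1) ∈ O := by
    have h1 : Continuous (fun p : Cot n M × Cot n M => (p.1.1, p.2.1)) :=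
      (contMDiff_footpoint.continuous.comp continuous_fst).prodMk
        (contMDiff_footpoint.continuous.comp continuous_snd)
    have h2 : (fun p : Cot n M × Cot n M => (p.1.1, p.2.1)) ⁻¹' O ∈ 𝓝 (y t, y t) :=
      (hO.preimage h1).mem_nhds (hd rfl)
    rw [nhds_prod_eq] at h2
    obtain ⟨V, hV, hVV⟩ := Filter.mem_prod_same_iff.1 h2
    exact ⟨V, hV, fun z hz z' hz' => hVV (Set.mk_mem_prod hz hz')⟩
  obtain ⟨ρ, -, hρV⟩ := (SmoothBumpFunction.nhds_basis_support (I := cotI n) hV).mem_iff.1 hV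
  have h1 : ContMDiff (cotI n) 𝓘(ℝ, ℝ) ∞ ρ := ρ.contMDiff
  have h2 : ∀ᶠ τ in 𝓝 t, 1 / 2 < ρ (y τ) := by
    refine (h1.continuous.comp hyc).continuousAt.eventually (lt_mem_nhds ?_)
    change 1 / 2 < ρ (y t)
    rw [ρ.eq_one]; norm_num
  have h3 := h.tendstoUniformlyOn h𝔣 (isSmoothParam_comp h1) (t - 1) (t + 1)
  have h4 := Metric.tendstoUniformlyOn_iff.1 h3 (1 / 2) (by norm_num)
  have h5 : ∀ᶠ τ in 𝓝 t, τ ∈ Set.Icc (t - 1) (t + 1) :=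
    Icc_mem_nhds (by linarith) (by linarith)
  refine ⟨_, mem_nhdsWithin_of_mem_nhds (h2.and h5), h4.mono fun i hi τ hτ => ?_⟩
  have h6 := hi τ hτ.2
  rw [Real.dist_eq] at h6
  have h7 : 0 < ρ (x i τ) := by linarith [(abs_lt.1 h6).2, hτ.1]
  have h8 : 0 < ρ (y τ) := by linarith [hτ.1]
  exact hVO _ (hρV h7.ne') _ (hρV h8.ne')

theorem IsCritLimit.eventually_loopClass_eq [CompactSpace M] [T2Space M]
    {y : SmoothLoop (cotI n) (Cot n M)} (h : IsCritLimit 𝔣 l x η y η₀) (h𝔣 : IsSmoothData 𝔣) :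
    ∀ᶠ i in l, loopClass (x i) = loopClass y := by
  obtain ⟨O, hO, hd, hcl⟩ := exists_loopClass_eq_of_close (n := n) (M := M)
  refine (h.eventually_close y.smooth.continuous h𝔣 hO hd).mono fun i hi => hcl _ _ fun t => ?_
  have hper : Function.Periodic (fun t => ((x i t).1, (y t).1)) 1 := fun t => by
    simp only [(x i).periodic t, y.periodic t]
  obtain ⟨t', ht', h1⟩ := hper.exists_mem_Ico₀ one_pos t
  have h2 : ((x i t).1, (y t).1) = ((x i t').1, (y t').1) := h1
  rw [h2]
  exact hi t' ⟨ht'.1, ht'.2.le⟩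

theorem periodic_iteratedDeriv {f : ℝ → ℝ} {c : ℝ} (hf : Function.Periodic f c) (k : ℕ) :
    Function.Periodic (iteratedDeriv k f) c := fun t => by
  have h := congrFun (iteratedDeriv_comp_add_const k f c) t
  rw [funext hf] at h
  exact h.symm

/-- Critical loops that converge pointwise converge with all derivatives, as the derivatives are
functions of the values by the equation. -/
theorem IsCritLimit.tendsto_loop [l.NeBot] [T2Space M] {y : SmoothLoop (cotI n) (Cot n M)}
    (h : IsCritLimit 𝔣 l x η y η₀) (h𝔣 : IsSmoothData 𝔣) : Filter.Tendsto x l (𝓝 y) := by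
  have hd := (h.contMDiff_limit h𝔣).2
  rw [nhds_iInf, Filter.tendsto_iInf]
  intro φ
  rw [nhds_iInf, Filter.tendsto_iInf]
  intro k
  rw [nhds_induced, Filter.tendsto_comap_iff]
  refine UniformFun.tendsto_iff_tendstoUniformly.2 ?_
  change TendstoUniformly (fun i => iteratedDeriv k (fun t => φ (x i t)))
    (iteratedDeriv k (fun t => φ (y t))) l
  have hφ := isSmoothParam_comp φ.contMDiff
  have e1 (i : ι) := (iteratedDeriv_timeDeriv h𝔣 ((x i).smooth.mdifferentiable (by simp))
    (h.defect_eq_zero i) k hφ).2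
  have e2 := iteratedDeriv_timeDeriv h𝔣 (y.smooth.mdifferentiable (by simp)) hd k hφ
  have h1 := h.tendstoUniformlyOn h𝔣 e2.1 0 1
  intro U hU
  refine (h1 U hU).mono fun i hi t => ?_
  have p1 : Function.Periodic (fun t => φ (x i t)) 1 := fun t => by
    simp only [(x i).periodic t]
  have p2 : Function.Periodic (fun t => φ (y t)) 1 := fun t => by simp only [y.periodic t]
  have hper : Function.Periodic (fun t => (iteratedDeriv k (fun t => φ (y t)) t,
      iteratedDeriv k (fun t => φ (x i t)) t)) 1 := fun t => by
    simp only [periodic_iteratedDeriv p1 k t, periodic_iteratedDeriv p2 k t]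
  obtain ⟨t', ht', h2⟩ := hper.exists_mem_Ico₀ one_pos t
  have h3 : (iteratedDeriv k (fun t => φ (y t)) t, iteratedDeriv k (fun t => φ (x i t)) t)
    = (iteratedDeriv k (fun t => φ (y t)) t', iteratedDeriv k (fun t => φ (x i t)) t') := h2
  rw [h3, e1 i, e2.2]
  exact hi t' ⟨ht'.1, ht'.2.le⟩

end CritLimit

/-! ### Compactness of the set of critical points -/

section Compactness

variable {𝔣 : Data n M} {J : EndField n M} {a b R : ℝ}

/-- The loops of critical points of positive action stay in the region where the radius is at
most `R`, as soon as the Hamiltonians are trivial outside of this region: a critical loop that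
leaves it is constant, and then its action vanishes. -/
theorem radius_le_of_mem_crit [T2Space M] (h𝔣 : IsData₀ 𝔣) (hJ : IsACS J) (ha : 0 < a)
    {v : SmoothLoop (cotI n) (Cot n M) × ℝ} (hv : v ∈ Crit 𝔣) (hA : a < action 𝔣 v.1 v.2)
    (hfar : ∀ z, R < radius J z → IsTrivialAt 𝔣 z) (t₀ : ℝ) : radius J (v.1 t₀) ≤ R := by
  by_contra! hcon
  obtain ⟨x, η⟩ := v
  have hO : IsOpen {z | R < radius J z} := isOpen_lt continuous_const hJ.contMDiff_radius.continuous
  have h1 := curve_const_of_vel_eq_zero (x.smooth.mdifferentiable (by simp)) hO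
    (fun t ht => ((hfar _ ht).defect_eq η).symm.trans (defect_eq_zero_of_mem_crit h𝔣 hv t)) hcon
  have hz := hfar _ hcon
  have h2 : ∫ t in (0 : ℝ)..1, 𝔣.χ t * 𝔣.F (x t) = 0 := integral_eq_zero_of_mem_crit h𝔣 hv
  have h3 : x.toFun = fun _ => x t₀ := funext h1
  change a < action 𝔣 x.toFun η at hA
  rw [action, h2, h3] at hA
  simp only [hz.H, vel_const, liouville_zero, intervalIntegral.integral_zero, mul_zero,
    sub_zero] at hA
  exact lt_asymm ha hA

/-- The critical points in an action window are compact if they are bounded and the end points of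
the window do not belong to the action spectrum. -/
theorem isCompact_critWindow [CompactSpace M] [T2Space M] (h𝔣 : IsData₀ 𝔣)
    (α : FreeHomotopyClass M) (ha : a ∉ actionSpectrum 𝔣 α) (hb : b ∉ actionSpectrum 𝔣 α)
    {K : Set (Cot n M)} (hK : IsCompact K) (hxK : ∀ v ∈ CritWindow 𝔣 α a b, ∀ t, v.1 t ∈ K)
    {L : ℝ} (hL : ∀ v ∈ CritWindow 𝔣 α a b, |v.2| ≤ L) : IsCompact (CritWindow 𝔣 α a b) := by
  have hs := h𝔣.isSmoothData
  rw [isCompact_iff_isCompact_univ, isCompact_iff_ultrafilter_le_nhds]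
  intro l _
  have h1 (t : ℝ) : ∃ z ∈ K, Filter.Tendsto (fun v : CritWindow 𝔣 α a b => v.1.1 t) l (𝓝 z) :=
    hK.ultrafilter_le_nhds (l.map fun v : CritWindow 𝔣 α a b => v.1.1 t)
      (Filter.tendsto_principal.2 (Filter.Eventually.of_forall fun v => hxK v v.2 t))
  obtain ⟨η₀, -, hη₀⟩ : ∃ η₀ ∈ Set.Icc (-L) L,
      Filter.Tendsto (fun v : CritWindow 𝔣 α a b => v.1.2) l (𝓝 η₀) :=
    isCompact_Icc.ultrafilter_le_nhds (l.map fun v : CritWindow 𝔣 α a b => v.1.2)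
      (Filter.tendsto_principal.2 (Filter.Eventually.of_forall fun v => abs_le.1 (hL v v.2)))
  choose y hyK hy using h1
  have h : IsCritLimit 𝔣 (l : Filter (CritWindow 𝔣 α a b)) (fun v => v.1.1) (fun v => v.1.2)
      y η₀ :=
    ⟨fun v t => defect_eq_zero_of_mem_crit h𝔣 v.2.1.1 t,
      ⟨K, L, hK, fun v => hxK v v.2, fun v => hL v v.2⟩, hy, hη₀⟩
  obtain ⟨hys, hyd⟩ := h.contMDiff_limit hs
  have hper : Function.Periodic y 1 := fun t => by
    refine tendsto_nhds_unique (hy (t + 1)) ?_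
    simp only [fun v : CritWindow 𝔣 α a b => v.1.1.periodic t]
    exact hy t
  let Y : SmoothLoop (cotI n) (Cot n M) := ⟨y, hys, hper⟩
  replace h : IsCritLimit 𝔣 (l : Filter (CritWindow 𝔣 α a b)) (fun v => v.1.1) (fun v => v.1.2)
      Y η₀ := h
  have hcrit : (Y, η₀) ∈ Crit 𝔣 := by
    refine mem_crit h𝔣 hyd (tendsto_nhds_unique
      (h.tendsto_integral hs (isSmoothParam_χ_mul hs hs.F)) ?_)
    simp only [fun v : CritWindow 𝔣 α a b => integral_eq_zero_of_mem_crit h𝔣 v.2.1.1]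
    exact tendsto_const_nhds
  have hclass : loopClass Y = α := by
    obtain ⟨v, hv⟩ := (h.eventually_loopClass_eq hs).exists
    exact hv.symm.trans v.2.1.2
  have hin : (Y, η₀) ∈ CritIn 𝔣 α := ⟨hcrit, hclass⟩
  have hact := h.tendsto_action hs
  have hA : a ≤ action 𝔣 Y η₀ :=
    ge_of_tendsto hact (Filter.Eventually.of_forall fun v => v.2.2.1.le)
  have hB : action 𝔣 Y η₀ ≤ b :=
    le_of_tendsto hact (Filter.Eventually.of_forall fun v => v.2.2.2.le)
  have hwin : (Y, η₀) ∈ CritWindow 𝔣 α a b :=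
    ⟨hin, hA.lt_of_ne fun he => ha ⟨_, hin, he.symm⟩, hB.lt_of_ne fun he => hb ⟨_, hin, he⟩⟩
  refine ⟨⟨(Y, η₀), hwin⟩, Set.mem_univ _, ?_⟩
  rw [nhds_subtype_eq_comap, ← Filter.tendsto_iff_comap]
  exact (h.tendsto_loop hs).prodMk_nhds hη₀

/-- Outside of a large sublevel set of the radius the Hamiltonians are trivial. -/
theorem exists_radius_bound [T2Space M] (h𝔣 : IsData₀ 𝔣) (hJ : IsACS J) {S : Set (Cot n M)}
    (hS : IsStarshaped S) (hsupp : suppVF 𝔣.F ⊆ interior (region S)) :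
    ∃ R, (∀ z ∈ region S, radius J z ≤ R) ∧ ∀ z, R < radius J z → IsTrivialAt 𝔣 z := by
  obtain ⟨K, hK, hHK⟩ := h𝔣.H_mem.compact
  obtain ⟨R, hR⟩ := (hS.isCompact_region.union hK).exists_bound_of_continuousOn
    hJ.contMDiff_radius.continuous.continuousOn
  have hR' (z : Cot n M) (hz : z ∈ region S ∪ K) : radius J z ≤ R :=
    (Real.le_norm_self _).trans (hR z hz)
  refine ⟨R, fun z hz => hR' z (Or.inl hz), fun z hz => ⟨?_, fun t => ?_, fun t => ?_⟩⟩
  · by_contra hne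
    exact hz.not_ge (hR' z (Or.inl (interior_subset (hsupp (subset_closure hne)))))
  · refine hamVF_eq_zero_of_eventually ?_
    filter_upwards [hK.isClosed.isOpen_compl.mem_nhds fun h => hz.not_ge (hR' z (Or.inr h))]
      with w hw using hHK t w hw
  · exact hHK t z fun h => hz.not_ge (hR' z (Or.inr h))

end Compactness


end RFH

end

theorem mainTheorem5 {n : ℕ} {M : Type*} [TopologicalSpace M]
    [ChartedSpace (EuclideanSpace ℝ (Fin n)) M] [IsManifold (𝓡 n) ∞ M]
    [CompactSpace M] [ConnectedSpace M] [T2Space M]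
    (g : ContMDiffRiemannianMetric (𝓡 n) ∞ (EuclideanSpace ℝ (Fin n))
      (fun q : M => TangentSpace (𝓡 n) q))
    (α : RFH.FreeHomotopyClass M)
    (𝔣 : RFH.Data n M) (h𝔣 : RFH.IsRegular 𝔣)
    (a b : ℝ) (ha : 0 < a) (hab : a < b)
    (ha_spec : a ∉ RFH.actionSpectrum 𝔣 α) (hb_spec : b ∉ RFH.actionSpectrum 𝔣 α)
    (Sig : Set (RFH.Cot n M)) (hSig : RFH.IsStarshaped Sig) (hF : RFH.IsDefining Sig 𝔣.F)
    (hf : RFH.IsFFab 𝔣.F a b 𝔣.f)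
    (hH : RFH.kappa 𝔣.H ≤ ENNReal.ofReal (a / 2))
    (S : Set (RFH.Cot n M)) (hS : RFH.IsStarshaped S)
    (hSigS : RFH.region Sig ⊆ interior (RFH.region S))
    (hsupp : RFH.suppVF 𝔣.F ⊆ interior (RFH.region S))
    (J : RFH.EndField n M) (hJ : RFH.IsConvexACS S J) :
    RFH.IsAdmissible g α 𝔣 a b J := by
  have h₀ := h𝔣.toIsData₀
  have hs := h₀.isSmoothData
  obtain ⟨t₀, hχ, -⟩ := h₀.exists_isChi
  obtain ⟨ρ, T, ⟨J', k, G, -, hk, hkF, -⟩, hfar⟩ := hf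
  obtain ⟨R, hR, hRfar⟩ := RFH.exists_radius_bound h₀ hJ.toIsACS hS hsupp
  have hK := hJ.isCompact_radius_le hS R
  have hKf (u) (hu : u ∈ RFH.FlowLines 𝔣 J α a b) (s t : ℝ) : RFH.radius J ((u s).1 t) ≤ R :=
    hu.1.radius_le hs h₀.f_mem hχ.integral_eq_one hS hJ ha hu.2.1 hR hRfar s t
  have hKc (v) (hv : v ∈ RFH.CritWindow 𝔣 α a b) (t : ℝ) : RFH.radius J (v.1 t) ≤ R :=
    RFH.radius_le_of_mem_crit h₀ hJ.toIsACS ha hv.1.1 hv.2.1 hRfar t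
  refine ⟨h𝔣, hJ.toIsACS, ha, hab, ?_, ?_, ?_⟩
  · refine Set.eq_empty_of_forall_notMem fun c hc => ?_
    rcases hc.2 with rfl | rfl
    exacts [ha_spec hc.1, hb_spec hc.1]
  · obtain ⟨E, L, hE, hL⟩ := RFH.exists_mult_bound h₀ hJ.toIsACS (a := a) (b := b) ha hk
      (fun z hz => (hkF z hz).1) hfar.eq_id hH hK
    refine RFH.isCompact_critWindow h₀ α ha_spec hb_spec hK hKc (L := L) fun v hv => ?_
    -- the gradient vanishes at critical points
    refine hL v.1 v.2 (fun _ => 0) (hKc v hv) continuous_const (fun t _ => ?_) ?_ ?_ hv.2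
    · rw [RFH.defect_eq_zero_of_mem_crit h₀ hv.1.1 t, RFH.omega_zero_right]
    · rw [intervalIntegral.integral_zero]; exact hE.le
    · rw [RFH.integral_eq_zero_of_mem_crit h₀ hv.1.1, mul_zero, zero_pow two_ne_zero]; exact hE.le
  · obtain ⟨L, hL⟩ := RFH.exists_mult_bound_flowLine h₀ hJ.toIsACS (a := a) (b := b) ha hk
      (fun z hz => (hkF z hz).1) hfar.eq_id hH hK
    obtain ⟨C, hC0, hC⟩ := RFH.exists_covectorNorm_le g hK
    refine ⟨C + 1, max L 0 + 1, by positivity, by positivity, fun u hu =>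
      ⟨fun s t => (hC _ (hKf u hu s t)).trans_lt (lt_add_one C), fun s => ?_⟩⟩
    exact ((hL u hu.1 hu.2.1 (hKf u hu) s).trans (le_max_left L 0)).trans_lt (lt_add_one _)
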